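/- Let $X=\mathrm{Spec}(O_{\mathbb R}(X))$ be a smooth irreducible (integral) affine real variety with $X(\mathbb R)\neq\emptyset$, let $G=\mathrm{Spec}(O_{\mathbb R}(G))$ be a smooth affine real algebraic group, and let $G\times X\to X$ be an action of varieties. Put $A=O_{\mathbb R}(G)\otimes_{\mathbb R}\mathbb C$, a Hopf $*$-algebra with $(f\otimes\lambda)^*=f\otimes\bar\lambda$, and $B=O_{\mathbb R}(X)\otimes_{\mathbb R}\mathbb C$, a left $A$-comodule algebra with coaction $b\mapsto b_{(-1)}\otimes b_{(0)}$. Let $\Omega^k=\mathrm{span}_{\mathbb C}\{b_0\,db_1\wedge\cdots\wedge db_k : b_i\in B\}$ be the space of complex differential $k$-forms on $X(\mathbb R)$ generated by regular functions, with the classical wedge product and the de Rham differential; the action induces on $\Omega^\bullet=\bigoplus_k\Omega^k$ the multiplicative coaction $\omega\mapsto\omega_{(-1)}\otimes\omega_{(0)}$ of $A$ that extends the coaction of $B$ and commutes with $d$. Then $(\Omega^\bullet,\wedge,d)$ is an $A$-covariant differential calculus on $B$: a differential graded algebra with $\Omega^0=B$, generated by $B$ and $dB$, on which $A$ coacts by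 an algebra map preserving degrees and commuting with $d$. Let $\gamma:A\otimes A\to\mathbb C$ be a unitary 2-cocycle, that is, a convolution invertible functional with $\gamma(g_{(1)}\otimes h_{(1)})\gamma(g_{(2)}h_{(2)}\otimes k)=\gamma(h_{(1)}\otimes k_{(1)})\gamma(g\otimes h_{(2)}k_{(2)})$, $\gamma(h\otimes 1)=\epsilon(h)=\gamma(1\otimes h)$ and $\overline{\gamma(a\otimes b)}=\gamma^{-1}(S(a)^*\otimes S(b)^*)$. Let $A_\gamma$ be the coalgebra $A$ with product $a\cdot_\gamma b=\gamma(a_{(1)}\otimes b_{(1)})\,a_{(2)}b_{(2)}\,\gamma^{-1}(a_{(3)}\otimes b_{(3)})$, let $B_\gamma$ be $B$ with product $b\cdot_\gamma c=\gamma(b_{(-1)}\otimes c_{(-1)})\,b_{(0)}c_{(0)}$, and let $(\Omega^\bullet_\gamma,\wedge_\gamma,d_\gamma)$ be the graded space $\Omega^\bullet$ with its coaction, with $d_\gamma=d$ and with $\omega\wedge_\gamma\eta=\gamma(\omega_{(-1)}\otimes\eta_{(-1)})\,\omega_{(0)}\wedge\eta_{(0)}$. Then $A_\gamma$ is a Hopf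 algebra with bijective antipode, $B_\gamma$ is a left $A_\gamma$-comodule algebra, and $(\Omega^\bullet_\gamma,\wedge_\gamma,d_\gamma)$ is an $A_\gamma$-covariant differential calculus on $B_\gamma$ which is covariantly quasi-tame: $\Omega^1_\gamma$ is finitely generated and projective as a left $B_\gamma$-module, and there is a $B_\gamma$-bilinear, $A_\gamma$-covariant map $s_\gamma:\Omega^2_\gamma\to\Omega^1_\gamma\otimes_{B_\gamma}\Omega^1_\gamma$ with $\wedge_\gamma\circ s_\gamma=\mathrm{id}$. More precisely, there is a well-defined $B$-bilinear, $A$-covariant map $s:\Omega^2\to\Omega^1\otimes_B\Omega^1$ with $s(\omega\wedge\eta)=\tfrac12(\omega\otimes_B\eta-\eta\otimes_B\omega)$ for all $\omega,\eta\in\Omega^1$, and it satisfies $\wedge\circ s=\mathrm{id}$; the formula $\varphi(\omega\otimes_{B_\gamma}\eta)=\gamma(\omega_{(-1)}\otimes\eta_{(-1)})\,\omega_{(0)}\otimes_B\eta_{(0)}$ defines a linear isomorphism $\varphi:\Omega^1_\gamma\otimes_{B_\gamma}\Omega^1_\gamma\to\Omega^1\otimes_B\Omega^1$; and one can take $s_\gamma=\varphi^{-1}\circ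 s$. -/

import Mathlib

open scoped TensorProduct

noncomputable section

namespace CocycleCalculus

/-! ### Algebras, Hopf algebras and comodule algebras over `ℂ`

A cocycle deformation changes only the products of the algebras involved; the underlying vector
spaces, units, coproducts and coactions stay the same.  Products are therefore recorded as bilinear
maps, and the axioms are predicates on them. -/

section General

variable {A C M : Type*} [AddCommGroup A] [Module ℂ A] [AddCommGroup C] [Module ℂ C]
  [AddCommGroup M] [Module ℂ M]

/-- `m` is an associative product on `C` with unit `e`. -/
structure IsUnitalAlgebra (m : C →ₗ[ℂ] C →ₗ[ℂ] C) (e : C) : Prop where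
  assoc : ∀ x y z, m (m x y) z = m x (m y z)
  one_mul : ∀ x, m e x = x
  mul_one : ∀ x, m x e = x

variable [Coalgebra ℂ A]

/-- The product `m` with unit `e` makes the coalgebra `A` a Hopf algebra with bijective antipode. -/
structure IsHopfAlgebra (m : A →ₗ[ℂ] A →ₗ[ℂ] A) (e : A) : Prop where
  algebra : IsUnitalAlgebra m e
  comul_one : Coalgebra.comul (R := ℂ) e = e ⊗ₜ[ℂ] e
  comul_mul : ∀ a b, Coalgebra.comul (R := ℂ) (m a b) =
    TensorProduct.map₂ m m (Coalgebra.comul (R := ℂ) a) (Coalgebra.comul (R := ℂ) b)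
  counit_one : Coalgebra.counit (R := ℂ) e = 1
  counit_mul : ∀ a b, Coalgebra.counit (R := ℂ) (m a b) =
    Coalgebra.counit (R := ℂ) a * Coalgebra.counit (R := ℂ) b
  exists_antipode : ∃ S : A →ₗ[ℂ] A, Function.Bijective S ∧
    (∀ a, TensorProduct.lift m (S.rTensor A (Coalgebra.comul (R := ℂ) a)) =
      Coalgebra.counit (R := ℂ) a • e) ∧
    (∀ a, TensorProduct.lift m (S.lTensor A (Coalgebra.comul (R := ℂ) a)) =
      Coalgebra.counit (R := ℂ) a • e)

/-- `δ` is a left coaction of the coalgebra `A` on `M`. -/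
structure IsComodule (δ : M →ₗ[ℂ] A ⊗[ℂ] M) : Prop where
  coassoc : ∀ x, TensorProduct.assoc ℂ A A M ((Coalgebra.comul (R := ℂ)).rTensor M (δ x)) =
    δ.lTensor A (δ x)
  counit : ∀ x, TensorProduct.lid ℂ M ((Coalgebra.counit (R := ℂ)).rTensor M (δ x)) = x

/-- `C`, with product `mC` and unit `eC`, is a left comodule algebra, under `δ`, over `A` with
product `mA` and unit `eA`. -/
structure IsComoduleAlgebra (mA : A →ₗ[ℂ] A →ₗ[ℂ] A) (eA : A)
    (mC : C →ₗ[ℂ] C →ₗ[ℂ] C) (eC : C) (δ : C →ₗ[ℂ] A ⊗[ℂ] C) : Prop where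
  algebra : IsUnitalAlgebra mC eC
  comodule : IsComodule δ
  map_one : δ eC = eA ⊗ₜ[ℂ] eC
  map_mul : ∀ x y, δ (mC x y) = TensorProduct.map₂ mA mC (δ x) (δ y)

end General

/-! ### Covariant differential calculi -/

/-- The operations of a differential calculus `(Ω^•, ∧, d)` on an algebra `B` on which a Hopf
algebra with underlying coalgebra `A` coacts.  The total space `Ω^• = ⨁ Ω^k` is `E`, the inclusion
of `B = Ω^0` in it is `ι`, and the bimodule structures are given by multiplication in `E`. -/
structure CalculusData (A B E : Type*) [AddCommGroup A] [Module ℂ A] [AddCommGroup B] [Module ℂ B]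
    [AddCommGroup E] [Module ℂ E] where
  mulA : A →ₗ[ℂ] A →ₗ[ℂ] A
  oneA : A
  mulB : B →ₗ[ℂ] B →ₗ[ℂ] B
  oneB : B
  coactB : B →ₗ[ℂ] A ⊗[ℂ] B
  wedge : E →ₗ[ℂ] E →ₗ[ℂ] E
  ι : B →ₗ[ℂ] E
  Ω : ℕ → Submodule ℂ E
  d : E →ₗ[ℂ] E
  coact : E →ₗ[ℂ] A ⊗[ℂ] E

namespace CalculusData

variable {A B E : Type*} [AddCommGroup A] [Module ℂ A] [AddCommGroup B] [Module ℂ B]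
  [AddCommGroup E] [Module ℂ E]

/-- The axioms of an `A`-covariant differential calculus on the left `A`-comodule algebra `B`:
`E` is a differential graded algebra with `Ω^0 = B`, generated by `B` and `dB`; each `Ω^k` is a
relative Hopf module, and `∧` and `d` are covariant. -/
structure IsCovariantCalculus [Coalgebra ℂ A] (D : CalculusData A B E) : Prop where
  hopf : IsHopfAlgebra D.mulA D.oneA
  base : IsComoduleAlgebra D.mulA D.oneA D.mulB D.oneB D.coactB
  total : IsComoduleAlgebra D.mulA D.oneA D.wedge (D.ι D.oneB) D.coact
  ι_injective : Function.Injective D.ι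
  ι_mul : ∀ b c, D.ι (D.mulB b c) = D.wedge (D.ι b) (D.ι c)
  range_ι : LinearMap.range D.ι = D.Ω 0
  isInternal : DirectSum.IsInternal D.Ω
  wedge_mem : ∀ {i j : ℕ} {ω η : E}, ω ∈ D.Ω i → η ∈ D.Ω j → D.wedge ω η ∈ D.Ω (i + j)
  d_mem : ∀ {i : ℕ} {ω : E}, ω ∈ D.Ω i → D.d ω ∈ D.Ω (i + 1)
  d_d : ∀ ω, D.d (D.d ω) = 0
  leibniz : ∀ {i : ℕ} {ω : E}, ω ∈ D.Ω i → ∀ η,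
    D.d (D.wedge ω η) = D.wedge (D.d ω) η + (-1 : ℂ) ^ i • D.wedge ω (D.d η)
  generated : ∀ W : Submodule ℂ E, (∀ b, D.ι b ∈ W) → (∀ b, D.d (D.ι b) ∈ W) →
    (∀ x ∈ W, ∀ y ∈ W, D.wedge x y ∈ W) → W = ⊤
  coact_ι : ∀ b, D.coact (D.ι b) = D.ι.lTensor A (D.coactB b)
  coact_mem : ∀ (i : ℕ) (ω : D.Ω i), D.coact ω ∈ LinearMap.range ((D.Ω i).subtype.lTensor A)
  coact_d : ∀ ω, D.coact (D.d ω) = D.d.lTensor A (D.coact ω)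

namespace IsCovariantCalculus

variable [Coalgebra ℂ A] {D : CalculusData A B E} (h : D.IsCovariantCalculus)

theorem lsmul_mem (h : D.IsCovariantCalculus) (b : B) {k : ℕ} {ω : E} (hω : ω ∈ D.Ω k) : D.wedge (D.ι b) ω ∈ D.Ω k := by
  have hb : D.ι b ∈ D.Ω 0 := h.range_ι ▸ LinearMap.mem_range_self D.ι b
  have := h.wedge_mem hb hω
  rwa [zero_add] at this

theorem rsmul_mem (h : D.IsCovariantCalculus) (b : B) {k : ℕ} {ω : E} (hω : ω ∈ D.Ω k) : D.wedge ω (D.ι b) ∈ D.Ω k := by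
  have hb : D.ι b ∈ D.Ω 0 := h.range_ι ▸ LinearMap.mem_range_self D.ι b
  exact h.wedge_mem hω hb

/-- The left action `b · ω` of `B` on `Ω^k`. -/
def lact (k : ℕ) : B →ₗ[ℂ] D.Ω k →ₗ[ℂ] D.Ω k :=
  LinearMap.mk₂ ℂ (fun b ω => ⟨D.wedge (D.ι b) ω, h.lsmul_mem b ω.2⟩)
    (fun _ _ _ => Subtype.ext <| by simp) (fun _ _ _ => Subtype.ext <| by simp)
    (fun _ _ _ => Subtype.ext <| by simp) (fun _ _ _ => Subtype.ext <| by simp)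

/-- The right action `ω · b` of `B` on `Ω^k`, with the arguments in the order `ω`, `b`. -/
def ract (k : ℕ) : D.Ω k →ₗ[ℂ] B →ₗ[ℂ] D.Ω k :=
  LinearMap.mk₂ ℂ (fun ω b => ⟨D.wedge ω (D.ι b), h.rsmul_mem b ω.2⟩)
    (fun _ _ _ => Subtype.ext <| by simp) (fun _ _ _ => Subtype.ext <| by simp)
    (fun _ _ _ => Subtype.ext <| by simp) (fun _ _ _ => Subtype.ext <| by simp)

/-- `B` as a ring, with the product of the calculus. -/
@[reducible] def ringB : Ring B :=
  { (inferInstance : AddCommGroup B) with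
    mul := fun b c => D.mulB b c
    one := D.oneB
    mul_assoc := h.base.algebra.assoc
    one_mul := h.base.algebra.one_mul
    mul_one := h.base.algebra.mul_one
    left_distrib := fun a b c => map_add (D.mulB a) b c
    right_distrib := fun a b c => D.mulB.map_add₂ a b c
    zero_mul := fun a => D.mulB.map_zero₂ a
    mul_zero := fun a => map_zero (D.mulB a) }

/-- `Ω^1` as a left `B`-module. -/
@[reducible] def moduleOneForms : @Module B (D.Ω 1) h.ringB.toSemiring _ :=
  letI := h.ringB
  { smul := fun b ω => h.lact 1 b ω
    one_smul := fun ω => Subtype.ext (h.total.algebra.one_mul ω)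
    mul_smul := fun b c ω => Subtype.ext <| by
      change D.wedge (D.ι (D.mulB b c)) ω = D.wedge (D.ι b) (D.wedge (D.ι c) ω)
      rw [h.ι_mul, h.total.algebra.assoc]
    smul_zero := fun b => map_zero (h.lact 1 b)
    smul_add := fun b => map_add (h.lact 1 b)
    add_smul := fun b c ω => Subtype.ext <| by
      exact congrArg (fun f : E →ₗ[ℂ] E => f ω) ((D.wedge ∘ₗ D.ι).map_add b c)
    zero_smul := fun ω => Subtype.ext <| by
      exact congrArg (fun f : E →ₗ[ℂ] E => f ω) ((D.wedge ∘ₗ D.ι).map_zero) }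

/-- `Ω^1` is finitely generated and projective as a left `B`-module. -/
def OneFormsFiniteProjective : Prop :=
  letI := h.ringB
  letI := h.moduleOneForms
  Module.Finite B (D.Ω 1) ∧ Module.Projective B (D.Ω 1)

/-- The relations `ω b ⊗ η = ω ⊗ b η` defining `Ω^1 ⊗_B Ω^1` as a quotient of `Ω^1 ⊗ Ω^1`. -/
def balanced : Submodule ℂ (D.Ω 1 ⊗[ℂ] D.Ω 1) :=
  Submodule.span ℂ {z | ∃ (ω η : D.Ω 1) (b : B),
    z = h.ract 1 ω b ⊗ₜ[ℂ] η - ω ⊗ₜ[ℂ] h.lact 1 b η}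

/-- The bimodule tensor product `Ω^1 ⊗_B Ω^1`. -/
abbrev Tensor : Type _ := (D.Ω 1 ⊗[ℂ] D.Ω 1) ⧸ h.balanced

/-- The elementary tensors `ω ⊗_B η`. -/
def tmul : D.Ω 1 →ₗ[ℂ] D.Ω 1 →ₗ[ℂ] h.Tensor :=
  (TensorProduct.mk ℂ (D.Ω 1) (D.Ω 1)).compr₂ h.balanced.mkQ

/-- The left action `b · (ω ⊗_B η) = b ω ⊗_B η`. -/
def lactTensor (b : B) : h.Tensor →ₗ[ℂ] h.Tensor :=
  h.balanced.mapQ h.balanced ((h.lact 1 b).rTensor (D.Ω 1)) <| by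
    rw [balanced, Submodule.span_le]
    rintro _ ⟨ω, η, c, rfl⟩
    refine Submodule.subset_span ⟨h.lact 1 b ω, η, c, ?_⟩
    have : h.lact 1 b (h.ract 1 ω c) = h.ract 1 (h.lact 1 b ω) c :=
      Subtype.ext (h.total.algebra.assoc _ _ _).symm
    simp [this]

/-- The right action `(ω ⊗_B η) · b = ω ⊗_B η b`. -/
def ractTensor (b : B) : h.Tensor →ₗ[ℂ] h.Tensor :=
  h.balanced.mapQ h.balanced (((h.ract 1).flip b).lTensor (D.Ω 1)) <| by
    rw [balanced, Submodule.span_le]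
    rintro _ ⟨ω, η, c, rfl⟩
    refine Submodule.subset_span ⟨ω, h.ract 1 η b, c, ?_⟩
    have : h.ract 1 (h.lact 1 c η) b = h.lact 1 c (h.ract 1 η b) :=
      Subtype.ext (h.total.algebra.assoc _ _ _)
    simp [this]

/-- The coaction `ω ↦ ω₍₋₁₎ ⊗ ω₍₀₎` of `A` on `Ω^k`. -/
def coactForms (k : ℕ) : D.Ω k →ₗ[ℂ] A ⊗[ℂ] D.Ω k :=
  (LinearEquiv.ofInjective ((D.Ω k).subtype.lTensor A)
      (Module.Flat.lTensor_preserves_injective_linearMap _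
        (Submodule.injective_subtype _))).symm.toLinearMap ∘ₗ
    (D.coact ∘ₗ (D.Ω k).subtype).codRestrict _ (h.coact_mem k)

theorem lTensor_coactForms (h : D.IsCovariantCalculus) (k : ℕ) (ω : D.Ω k) :
    (D.Ω k).subtype.lTensor A (h.coactForms k ω) = D.coact ω := by
  have := LinearEquiv.apply_symm_apply (LinearEquiv.ofInjective ((D.Ω k).subtype.lTensor A)
      (Module.Flat.lTensor_preserves_injective_linearMap _
        (Submodule.injective_subtype _)))
        ((D.coact ∘ₗ (D.Ω k).subtype).codRestrict _ (h.coact_mem k) ω)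
  exact congrArg Subtype.val this

theorem coactForms_lact (h : D.IsCovariantCalculus) (k : ℕ) (b : B) (ω : D.Ω k) :
    h.coactForms k (h.lact k b ω) =
      TensorProduct.map₂ D.mulA (h.lact k) (D.coactB b) (h.coactForms k ω) := by
  apply Module.Flat.lTensor_preserves_injective_linearMap (M := A) _
    (Submodule.injective_subtype (D.Ω k))
  rw [lTensor_coactForms]
  change D.coact (D.wedge (D.ι b) ω) = _
  rw [h.total.map_mul, h.coact_ι, ← h.lTensor_coactForms]
  generalize D.coactB b = x
  generalize h.coactForms k ω = y
  induction x with
  | zero => simp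
  | add x x' hx hx' => simp only [map_add, LinearMap.add_apply, hx, hx']
  | tmul a c =>
    induction y with
    | zero => simp
    | add y y' hy hy' => simp only [map_add, hy, hy']
    | tmul a' ω' => simp [lact]

theorem coactForms_ract (h : D.IsCovariantCalculus) (k : ℕ) (ω : D.Ω k) (b : B) :
    h.coactForms k (h.ract k ω b) =
      TensorProduct.map₂ D.mulA (h.ract k) (h.coactForms k ω) (D.coactB b) := by
  apply Module.Flat.lTensor_preserves_injective_linearMap (M := A) _
    (Submodule.injective_subtype (D.Ω k))
  rw [lTensor_coactForms]
  change D.coact (D.wedge ω (D.ι b)) = _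
  rw [h.total.map_mul, h.coact_ι, ← h.lTensor_coactForms]
  generalize D.coactB b = x
  generalize h.coactForms k ω = y
  induction x with
  | zero => simp
  | add x x' hx hx' => simp only [map_add, hx, hx']
  | tmul a c =>
    induction y with
    | zero => simp
    | add y y' hy hy' => simp only [map_add, LinearMap.add_apply, hy, hy']
    | tmul a' ω' => simp [ract]

/-- The pairing `(a ⊗ ω, a' ⊗ η) ↦ a a' ⊗ (ω ⊗_B η)`. -/
def diagonal : A ⊗[ℂ] D.Ω 1 →ₗ[ℂ] A ⊗[ℂ] D.Ω 1 →ₗ[ℂ] A ⊗[ℂ] h.Tensor :=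
  TensorProduct.map₂ D.mulA h.tmul

theorem diagonal_balanced (h : D.IsCovariantCalculus) (x : A ⊗[ℂ] D.Ω 1) (y : A ⊗[ℂ] B)
    (z : A ⊗[ℂ] D.Ω 1) :
    h.diagonal (TensorProduct.map₂ D.mulA (h.ract 1) x y) z =
      h.diagonal x (TensorProduct.map₂ D.mulA (h.lact 1) y z) := by
  induction x with
  | zero => simp
  | add x x' hx hx' => simp only [map_add, LinearMap.add_apply, hx, hx']
  | tmul a ω =>
    induction y with
    | zero => simp
    | add y y' hy hy' => simp only [map_add, LinearMap.add_apply, hy, hy']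
    | tmul a' b =>
      induction z with
      | zero => simp
      | add z z' hz hz' => simp only [map_add, hz, hz']
      | tmul a'' η =>
        have key : h.balanced.mkQ (h.ract 1 ω b ⊗ₜ[ℂ] η) =
            h.balanced.mkQ (ω ⊗ₜ[ℂ] h.lact 1 b η) := by
          rw [← sub_eq_zero, ← map_sub, Submodule.mkQ_apply, Submodule.Quotient.mk_eq_zero]
          exact Submodule.subset_span ⟨ω, η, b, rfl⟩
        change D.mulA (D.mulA a a') a'' ⊗ₜ[ℂ] h.balanced.mkQ (h.ract 1 ω b ⊗ₜ[ℂ] η) =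
          D.mulA a (D.mulA a' a'') ⊗ₜ[ℂ] h.balanced.mkQ (ω ⊗ₜ[ℂ] h.lact 1 b η)
        rw [h.hopf.algebra.assoc, key]

/-- The diagonal coaction `ω ⊗_B η ↦ ω₍₋₁₎ η₍₋₁₎ ⊗ (ω₍₀₎ ⊗_B η₍₀₎)` of `A` on `Ω^1 ⊗_B Ω^1`. -/
def coactTensor : h.Tensor →ₗ[ℂ] A ⊗[ℂ] h.Tensor :=
  h.balanced.liftQ
    (TensorProduct.lift (h.diagonal.compl₁₂ (h.coactForms 1) (h.coactForms 1))) <| by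
    refine Submodule.span_le.2 ?_
    rintro _ ⟨ω, η, b, rfl⟩
    rw [SetLike.mem_coe, LinearMap.mem_ker, map_sub, sub_eq_zero]
    simp only [TensorProduct.lift.tmul, LinearMap.compl₁₂_apply]
    rw [coactForms_ract, coactForms_lact, diagonal_balanced]

/-- The product `ω ∧ η` of one-forms. -/
def wedgeOne : D.Ω 1 →ₗ[ℂ] D.Ω 1 →ₗ[ℂ] D.Ω 2 :=
  LinearMap.mk₂ ℂ (fun ω η => ⟨D.wedge ω η, h.wedge_mem ω.2 η.2⟩)
    (fun _ _ _ => Subtype.ext <| by simp) (fun _ _ _ => Subtype.ext <| by simp)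
    (fun _ _ _ => Subtype.ext <| by simp) (fun _ _ _ => Subtype.ext <| by simp)

/-- The map `∧ : Ω^1 ⊗_B Ω^1 → Ω^2`. -/
def wedgeTensor : h.Tensor →ₗ[ℂ] D.Ω 2 :=
  h.balanced.liftQ (TensorProduct.lift h.wedgeOne) <| by
    rw [balanced, Submodule.span_le]
    rintro _ ⟨ω, η, b, rfl⟩
    rw [SetLike.mem_coe, LinearMap.mem_ker, map_sub, sub_eq_zero]
    exact Subtype.ext (h.total.algebra.assoc _ _ _)

/-- `s : Ω^2 → Ω^1 ⊗_B Ω^1` is a morphism of relative Hopf modules (that is, `B`-bilinear and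
`A`-covariant) with `∧ ∘ s = id`. -/
structure IsCovariantSplitting (s : D.Ω 2 →ₗ[ℂ] h.Tensor) : Prop where
  map_lact : ∀ b θ, s (h.lact 2 b θ) = h.lactTensor b (s θ)
  map_ract : ∀ b θ, s (h.ract 2 θ b) = h.ractTensor b (s θ)
  covariant : ∀ θ, h.coactTensor (s θ) = s.lTensor A (h.coactForms 2 θ)
  splits : ∀ θ, h.wedgeTensor (s θ) = θ

/-- The calculus is covariantly quasi-tame: `Ω^1` is finitely generated and projective as a left
`B`-module, and `∧ : Ω^1 ⊗_B Ω^1 → Ω^2` has a splitting in the category of relative Hopf modules. -/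
def CovariantlyQuasiTame : Prop :=
  h.OneFormsFiniteProjective ∧ ∃ s : D.Ω 2 →ₗ[ℂ] h.Tensor, h.IsCovariantSplitting s

end IsCovariantCalculus

end CalculusData

/-! ### Cocycle deformation -/

section Cocycle

variable {A : Type*} [Ring A] [HopfAlgebra ℂ A]

/-- For a functional `γ` on `A ⊗ A`, the map `a ⊗ b ↦ γ(a₍₁₎ ⊗ b₍₁₎) a₍₂₎ b₍₂₎`. -/
def leftTwist (γ : A ⊗[ℂ] A →ₗ[ℂ] ℂ) : A ⊗[ℂ] A →ₗ[ℂ] A :=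
  TensorProduct.lid ℂ A ∘ₗ TensorProduct.map γ (LinearMap.mul' ℂ A) ∘ₗ Coalgebra.comul

/-- A unitary 2-cocycle on the Hopf algebra `A` with involution `star`, together with its
convolution inverse. -/
structure UnitaryTwoCocycle (star : A → A) where
  γ : A ⊗[ℂ] A →ₗ[ℂ] ℂ
  γinv : A ⊗[ℂ] A →ₗ[ℂ] ℂ
  convolution_inv : ∀ x, TensorProduct.lid ℂ ℂ
    (TensorProduct.map γ γinv (Coalgebra.comul (R := ℂ) x)) = Coalgebra.counit (R := ℂ) x
  inv_convolution : ∀ x, TensorProduct.lid ℂ ℂ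
    (TensorProduct.map γinv γ (Coalgebra.comul (R := ℂ) x)) = Coalgebra.counit (R := ℂ) x
  cocycle : ∀ g h k, γ (leftTwist γ (g ⊗ₜ[ℂ] h) ⊗ₜ[ℂ] k) = γ (g ⊗ₜ[ℂ] leftTwist γ (h ⊗ₜ[ℂ] k))
  apply_one : ∀ h, γ (h ⊗ₜ[ℂ] 1) = Coalgebra.counit (R := ℂ) h
  one_apply : ∀ h, γ (1 ⊗ₜ[ℂ] h) = Coalgebra.counit (R := ℂ) h
  unitary : ∀ a b, (starRingEnd ℂ) (γ (a ⊗ₜ[ℂ] b)) =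
    γinv (star (HopfAlgebra.antipode ℂ a) ⊗ₜ[ℂ] star (HopfAlgebra.antipode ℂ b))

namespace UnitaryTwoCocycle

variable {star : A → A} (c : UnitaryTwoCocycle star)

/-- The product `a ·_γ b = γ(a₍₁₎ ⊗ b₍₁₎) a₍₂₎ b₍₂₎ γ⁻¹(a₍₃₎ ⊗ b₍₃₎)` of the deformed Hopf algebra
`A_γ`. -/
def mulA : A →ₗ[ℂ] A →ₗ[ℂ] A :=
  TensorProduct.curry <|
    TensorProduct.rid ℂ A ∘ₗ TensorProduct.map (leftTwist c.γ) c.γinv ∘ₗ Coalgebra.comul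

variable {M N P : Type*} [AddCommGroup M] [Module ℂ M] [AddCommGroup N] [Module ℂ N]
  [AddCommGroup P] [Module ℂ P]

/-- The deformation `(v, w) ↦ γ(v₍₋₁₎ ⊗ w₍₋₁₎) f(v₍₀₎, w₍₀₎)` of a bilinear map `f` on two
comodules. -/
def deform (δM : M →ₗ[ℂ] A ⊗[ℂ] M) (δN : N →ₗ[ℂ] A ⊗[ℂ] N) (f : M →ₗ[ℂ] N →ₗ[ℂ] P) :
    M →ₗ[ℂ] N →ₗ[ℂ] P :=
  TensorProduct.curry <|
    TensorProduct.lid ℂ P ∘ₗ TensorProduct.map c.γ (TensorProduct.lift f) ∘ₗ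
      (TensorProduct.tensorTensorTensorComm ℂ A M A N).toLinearMap ∘ₗ TensorProduct.map δM δN

variable {B E : Type*} [AddCommGroup B] [Module ℂ B] [AddCommGroup E] [Module ℂ E]

/-- The cocycle deformation `(Ω^•_γ, ∧_γ, d_γ)` over `B_γ`: the products of `A`, `B` and `Ω^•` are
deformed, and the differential, the grading and the coactions remain the same maps. -/
@[reducible] def deformData (D : CalculusData A B E) : CalculusData A B E where
  mulA := c.mulA
  oneA := D.oneA
  mulB := c.deform D.coactB D.coactB D.mulB
  oneB := D.oneB
  coactB := D.coactB
  wedge := c.deform D.coact D.coact D.wedge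
  ι := D.ι
  Ω := D.Ω
  d := D.d
  coact := D.coact

end UnitaryTwoCocycle

end Cocycle

/-! ### Differential forms on the real points of an affine variety -/

section Forms

variable (O : Type*) [CommRing O] [Algebra ℝ O]

/-- The real points of `Spec O`. -/
abbrev RealPoint : Type _ := O →ₐ[ℝ] ℝ

variable {O}

/-- The tangent space at a real point `x`: the derivations `O → ℝ` at `x`. -/
def tangentSpace (x : RealPoint O) : Submodule ℝ (O →ₗ[ℝ] ℝ) where
  carrier := {v | ∀ f g, v (f * g) = x f * v g + x g * v f}
  zero_mem' := fun f g => by simp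
  add_mem' := fun {v w} hv hw f g => by
    simp only [Set.mem_ofPred_eq] at hv hw
    simp only [LinearMap.add_apply, hv, hw]
    ring
  smul_mem' := fun r v hv f g => by
    simp only [Set.mem_ofPred_eq] at hv
    simp only [LinearMap.smul_apply, hv, smul_eq_mul]
    ring

/-- The complexified cotangent space at `x`. -/
abbrev Cotangent (x : RealPoint O) : Type _ := tangentSpace x →ₗ[ℝ] ℂ

variable (O)

/-- Sections over the real points of the bundle of exterior algebras of the complexified cotangent
spaces, with the pointwise wedge product. -/
abbrev Sections : Type _ := ∀ x : RealPoint O, ExteriorAlgebra ℂ (Cotangent x)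

variable {O}

/-- The value at `x` of a complex regular function. -/
def evalAt (x : RealPoint O) : ℂ ⊗[ℝ] O →ₐ[ℂ] ℂ :=
  Algebra.TensorProduct.lift (AlgHom.id ℂ ℂ) ((Algebra.ofId ℝ ℂ).comp x) fun _ _ => .all _ _

/-- The differential at `x` of a complex regular function: `v ↦ λ v(f)` for `λ ⊗ f`. -/
def diffAt (x : RealPoint O) : ℂ ⊗[ℝ] O →ₗ[ℂ] Cotangent x :=
  LinearMap.liftBaseChange ℂ
    { toFun := fun f =>
        { toFun := fun v => (((v : O →ₗ[ℝ] ℝ) f : ℝ) : ℂ)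
          map_add' := fun v w => by simp
          map_smul' := fun r v => by simp }
      map_add' := fun f g => by ext v; simp
      map_smul' := fun r f => by ext v; simp }

/-- A complex regular function as a section of degree `0`. -/
def functionSection : ℂ ⊗[ℝ] O →ₐ[ℂ] Sections O :=
  AlgHom.pi fun x => (Algebra.ofId ℂ _).comp (evalAt x)

/-- The differential of a complex regular function, as a section of degree `1`. -/
def diffSection : ℂ ⊗[ℝ] O →ₗ[ℂ] Sections O :=
  LinearMap.pi fun x => ExteriorAlgebra.ι ℂ ∘ₗ diffAt x

variable (O)

/-- The algebra `Ω^•(X(ℝ))` of differential forms generated by the complex regular functions and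
their differentials. -/
def formAlgebra : Subalgebra ℂ (Sections O) :=
  Algebra.adjoin ℂ (Set.range (functionSection (O := O)) ∪ Set.range (diffSection (O := O)))

/-- The underlying type of `Ω^•(X(ℝ))`. -/
def Form : Type _ := formAlgebra O

instance : Ring (Form O) := inferInstanceAs (Ring (formAlgebra O))

instance : Algebra ℂ (Form O) := inferInstanceAs (Algebra ℂ (formAlgebra O))

variable {O}

/-- A complex regular function as an element of `Ω^•(X(ℝ))`. -/
def functionForm : ℂ ⊗[ℝ] O →ₐ[ℂ] Form O :=
  functionSection.codRestrict (formAlgebra O) fun b => Algebra.subset_adjoin (Or.inl ⟨b, rfl⟩)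

/-- The differential of a complex regular function as an element of `Ω^•(X(ℝ))`. -/
def diffForm : ℂ ⊗[ℝ] O →ₗ[ℂ] Form O :=
  diffSection.codRestrict (Subalgebra.toSubmodule (formAlgebra O)) fun b =>
    Algebra.subset_adjoin (Or.inr ⟨b, rfl⟩)

variable (O)

/-- `Ω^k(X(ℝ))`, the span of the forms `b₀ db₁ ∧ ⋯ ∧ db_k`. -/
def forms (k : ℕ) : Submodule ℂ (Form O) :=
  Submodule.span ℂ {ω | ∃ (b₀ : ℂ ⊗[ℝ] O) (b : Fin k → ℂ ⊗[ℝ] O),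
    ω = functionForm b₀ * (List.ofFn fun i => diffForm (b i)).prod}

end Forms

/-! ### The calculus of a variety with an action of an algebraic group -/

section Action

variable {OG OX : Type*} [CommRing OG] [HopfAlgebra ℝ OG] [CommRing OX] [Algebra ℝ OX]

/-- The involution `λ ⊗ f ↦ conj λ ⊗ f` of `ℂ ⊗ O(G)`. -/
def conjStar (OG : Type*) [CommRing OG] [Algebra ℝ OG] : ℂ ⊗[ℝ] OG → ℂ ⊗[ℝ] OG :=
  Complex.conjAe.toLinearMap.rTensor OG

/-- An action `G × X → X` of the group on the variety, as a coaction on regular functions. -/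
structure VarietyAction (OG OX : Type*) [CommRing OG] [HopfAlgebra ℝ OG] [CommRing OX]
    [Algebra ℝ OX] where
  hom : OX →ₐ[ℝ] OG ⊗[ℝ] OX
  coassoc : ∀ f, TensorProduct.assoc ℝ OG OG OX
    ((Coalgebra.comul (R := ℝ)).rTensor OX (hom f)) = hom.toLinearMap.lTensor OG (hom f)
  counit : ∀ f, TensorProduct.lid ℝ OX ((Coalgebra.counit (R := ℝ)).rTensor OX (hom f)) = f

/-- The coaction of `ℂ ⊗ O(G)` on `ℂ ⊗ O(X)` obtained by extension of scalars. -/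
def VarietyAction.coact (α : VarietyAction OG OX) :
    ℂ ⊗[ℝ] OX →ₗ[ℂ] (ℂ ⊗[ℝ] OG) ⊗[ℂ] (ℂ ⊗[ℝ] OX) :=
  (TensorProduct.AlgebraTensorModule.distribBaseChange ℝ ℂ OG OX).toLinearMap ∘ₗ
    α.hom.toLinearMap.baseChange ℂ

/-- The operations of the classical calculus of `X(ℝ)`, for a given differential `d` and a given
coaction `δ` of `ℂ ⊗ O(G)` on forms. -/
@[reducible] def VarietyAction.deRhamData (α : VarietyAction OG OX)
    (d : Form OX →ₗ[ℂ] Form OX)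
    (δ : Form OX →ₗ[ℂ] (ℂ ⊗[ℝ] OG) ⊗[ℂ] Form OX) :
    CalculusData (ℂ ⊗[ℝ] OG) (ℂ ⊗[ℝ] OX) (Form OX) where
  mulA := LinearMap.mul ℂ _
  oneA := 1
  mulB := LinearMap.mul ℂ _
  oneB := 1
  coactB := α.coact
  wedge := LinearMap.mul ℂ _
  ι := functionForm.toLinearMap
  Ω := forms OX
  d := d
  coact := δ

/-- `d` is the de Rham differential on `Ω^•(X(ℝ))` and `δ` is the coaction on forms induced by the
action of the group.  The formulas determine both maps, because the forms
`b₀ db₁ ∧ ⋯ ∧ db_k` span `Ω^•(X(ℝ))`. -/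
structure VarietyAction.IsDeRham (α : VarietyAction OG OX)
    (d : Form OX →ₗ[ℂ] Form OX)
    (δ : Form OX →ₗ[ℂ] (ℂ ⊗[ℝ] OG) ⊗[ℂ] Form OX) : Prop where
  d_apply : ∀ (k : ℕ) (b₀ : ℂ ⊗[ℝ] OX) (b : Fin k → ℂ ⊗[ℝ] OX),
    d (functionForm b₀ * (List.ofFn fun i => diffForm (b i)).prod) =
      diffForm b₀ * (List.ofFn fun i => diffForm (b i)).prod
  coact_mul : ∀ ω η, δ (ω * η) = δ ω * δ η
  coact_function : ∀ b, δ (functionForm b) =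
    (functionForm (O := OX)).toLinearMap.lTensor (ℂ ⊗[ℝ] OG) (α.coact b)
  coact_diff : ∀ b, δ (diffForm b) =
    (diffForm (O := OX)).lTensor (ℂ ⊗[ℝ] OG) (α.coact b)

end Action

end CocycleCalculus

end

open CocycleCalculus

noncomputable section

namespace CocycleCalculus

/-! ### Shortcut instances for the additivity of linear maps -/

section Shortcuts

variable {M N : Type*} [AddCommMonoid M] [Module ℂ M] [AddCommMonoid N] [Module ℂ N]

/-! The proof has a classical half and a deformation half.

Classical half. The forms on the real points are the exterior algebra of the Kähler differentials of
`ℂ ⊗ O` (`exists_ringEquiv_form`). Injectivity of the comparison map rests on density: a regular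
function that vanishes at every real point is zero (`eq_zero_of_forall_realPoint`). For this, a
derivation of `O` is integrated to a flow that stays in the variety, so the functions vanishing at
all real points are stable under derivations. An Euler field at the given real point, built from a
dual basis of the Kähler differentials, multiplies a leading term by its order; hence such a
function lies in every power of the maximal ideal and is zero by Krull's theorem. The resulting
universal property `exists_form_algHom` produces the grading, the de Rham differential, the
contractions and the coaction: each is a homomorphism into a suitable algebra in which the relations
of functions and differentials hold. If `y_i` and `f_i` are a dual basis of the one-forms and `T_i`
are the corresponding contractions, then `θ ↦ ½ ∑ dy_i ⊗ T_i θ` is the antisymmetrization, which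
proves that the latter is well defined. It is bilinear because functions are central, and it splits
the wedge product because one-forms anticommute.

Deformation half. On a tensor product of comodules, `γ` acts by an operator `twist`, invertible
because `γ` is. A deformed product is the old product after the twist (`lift_deform`), the twist
commutes with colinear maps (`twist_map`), and the cocycle identity becomes a coherence between
iterated twists (`twist_assoc`). Therefore associativity, the Leibniz rule, covariance and
bilinearity of colinear maps all survive. The twist of `Ω^1 ⊗ Ω^1` carries the relations of the
tensor product over `B_γ` to those over `B` (`map_balanced`); this gives the isomorphism `φ`, and
`φ⁻¹ ∘ s` inherits all properties of `s`.

Two points need separate arguments. A dual basis of `Ω^1` is not colinear, so it cannot be deformed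
directly. It is placed in a finite-dimensional subcomodule `V`, which gives a colinear surjection `B
⊗ V → Ω^1` with a `B`-linear section; the section is made colinear at the price of a factor `A`,
because `(B ⊗ V) ⊗ A` is cofree. After the deformation the factor is removed with the counit
(`exists_deformed_section`).

The other point is the antipode of `A_γ`. It is the old one, multiplied on its two sides by `U(a) =
γ(a₍₁₎ ⊗ S(a₍₂₎))` and its convolution inverse. One antipode identity is computed on `A^cop ⊗ A`,
where `S ⊗ id` is a coalgebra map, and the other follows by passing to the co-opposite. -/

instance : ZeroHomClass (M →ₗ[ℂ] N) M N := inferInstance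

instance : AddHomClass (M →ₗ[ℂ] N) M N := inferInstance

instance : ZeroHomClass (M ≃ₗ[ℂ] N) M N := inferInstance

instance : AddHomClass (M ≃ₗ[ℂ] N) M N := inferInstance

end Shortcuts

/-! ### Density of the real points -/

section Density

/-- A dual basis of the module of differentials which consists of exact forms. -/
theorem exists_kaehler_dual_basis (k S : Type*) [CommRing k] [CommRing S] [Algebra k S]
    [Module.Finite S Ω[S⁄k]] [Module.Projective S Ω[S⁄k]] :
    ∃ (n : ℕ) (y : Fin n → S) (i : Ω[S⁄k] →ₗ[S] Fin n → S),
      ∀ ω, ω = ∑ l, i ω l • KaehlerDifferential.D k S (y l) := by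
  classical
  have hfg : (Submodule.span S (Set.range (KaehlerDifferential.D k S))).FG := by
    rw [KaehlerDifferential.span_range_derivation]; exact Module.Finite.fg_top
  -- A finitely generated span is generated by finitely many members of the spanning set, so the
  -- generators can be taken exact. Projectivity then splits the presentation that they define.
  obtain ⟨t, ht, hspan⟩ := (Submodule.fg_span_iff_fg_span_finset_subset _).1 hfg
  rw [KaehlerDifferential.span_range_derivation] at hspan
  choose y hy using fun z : t => ht z.2
  let e := t.equivFin
  let r : (Fin t.card → S) →ₗ[S] Ω[S⁄k] :=
    Fintype.linearCombination S fun l => KaehlerDifferential.D k S (y (e.symm l))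
  have hr : Function.Surjective r := by
    rw [← LinearMap.range_eq_top, Fintype.range_linearCombination, ← top_le_iff, hspan]
    refine Submodule.span_mono ?_
    intro z hz
    exact ⟨e ⟨z, hz⟩, by simp [hy]⟩
  obtain ⟨i, hi⟩ := Module.projective_lifting_property r LinearMap.id hr
  refine ⟨t.card, fun l => y (e.symm l), i, fun ω => ?_⟩
  have := LinearMap.congr_fun hi ω
  simpa [r, Fintype.linearCombination_apply] using this.symm

theorem contDiff_eval {σ : Type*} [Fintype σ] (p : MvPolynomial σ ℝ) :
    ContDiff ℝ 1 fun u : σ → ℝ => MvPolynomial.eval u p := by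
  induction p using MvPolynomial.induction_on with
  | C a => simpa using contDiff_const
  | add p q hp hq => simpa using hp.add hq
  | mul_X p i hp => simpa using hp.mul (contDiff_apply ℝ ℝ i)

/-- This is the chain rule along an integral curve of the vector field with components `p`. Products
are handled by the Leibniz rule on both sides, so only the coordinates have to be checked, and there
it is the equation of the curve. -/
theorem hasDerivAt_eval_comp {σ : Type*} [Fintype σ] (p : σ → MvPolynomial σ ℝ) {u : ℝ → σ → ℝ}
    {t : ℝ} (hu : HasDerivAt u (fun l => MvPolynomial.eval (u t) (p l)) t)
    (q : MvPolynomial σ ℝ) :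
    HasDerivAt (fun s => MvPolynomial.eval (u s) q)
      (MvPolynomial.eval (u t) (MvPolynomial.mkDerivation ℝ p q)) t := by
  induction q using MvPolynomial.induction_on with
  | C a => simpa using hasDerivAt_const t a
  | add q q' hq hq' =>
    simp only [map_add]
    exact hq.add hq'
  | mul_X q i hq =>
    have := hq.mul (hasDerivAt_pi.1 hu i)
    simp only [map_mul, MvPolynomial.eval_X, Derivation.leibniz, MvPolynomial.mkDerivation_X,
      smul_eq_mul, map_add]
    convert! this using 1
    ring

/-- The flow of a vector field on an affine real variety stays in the variety. -/
theorem exists_flow {O : Type*} [CommRing O] [Algebra ℝ O] [Algebra.FiniteType ℝ O]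
    (D : Derivation ℝ O O) (x : O →ₐ[ℝ] ℝ) :
    ∃ b > (0 : ℝ), ∃ y : ℝ → O →ₐ[ℝ] ℝ, y 0 = x ∧
      ∀ f, HasDerivWithinAt (fun t => y t f) (x (D f)) (Set.Icc 0 b) 0 := by
  classical
  obtain ⟨n, π, hπ⟩ := Algebra.FiniteType.iff_quotient_mvPolynomial''.1 ‹Algebra.FiniteType ℝ O›
  choose p hp using fun l : Fin n => hπ (D (π (MvPolynomial.X l)))
  let 𝒟 := MvPolynomial.mkDerivation ℝ p
  have hD : ∀ q, π (𝒟 q) = D (π q) := by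
    intro q
    induction q using MvPolynomial.induction_on with
    | C a =>
      rw [MvPolynomial.derivation_C, map_zero, ← MvPolynomial.algebraMap_eq, AlgHom.commutes,
        Derivation.map_algebraMap]
    | add q q' hq hq' => simp [hq, hq']
    | mul_X q i hq => simp [Derivation.leibniz, hq, 𝒟, hp]
  let u₀ : Fin n → ℝ := fun l => x (π (MvPolynomial.X l))
  have hev : ∀ q, MvPolynomial.eval u₀ q = x (π q) := by
    intro q
    induction q using MvPolynomial.induction_on with
    | C a =>
      rw [MvPolynomial.eval_C, ← MvPolynomial.algebraMap_eq, AlgHom.commutes, AlgHom.commutes]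
      rfl
    | add q q' hq hq' => simp [hq, hq']
    | mul_X q i hq => simp [hq, u₀]
  have hv : ContDiff ℝ 1 fun u : Fin n → ℝ => fun l => MvPolynomial.eval u (p l) :=
    contDiff_pi.2 fun l => contDiff_eval (p l)
  -- By Picard–Lindelöf, the polynomial lift of the vector field has an integral curve through the
  -- given point; so far the curve lies only in the ambient affine space.
  obtain ⟨u, hu0, ε, hε, hu⟩ :=
    (hv.contDiffAt (x := u₀)).exists_forall_mem_closedBall_exists_eq_forall_mem_Ioo_hasDerivAt₀ 0
  simp only [zero_sub, zero_add] at hu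
  -- A closed interval inside the domain of the curve, so that compactness bounds the coefficients
  -- below.
  let b := ε / 2
  have hb : 0 < b := by positivity
  have hmem : ∀ t ∈ Set.Icc 0 b, t ∈ Set.Ioo (-ε) ε := fun t ht =>
    ⟨by linarith [ht.1], by have := ht.2; simp only [b] at this; linarith⟩
  obtain ⟨s, hs⟩ := (isNoetherianRing_iff_ideal_fg _).1 inferInstance (RingHom.ker π)
  -- The lift `𝒟` induces `D` on the quotient, so it preserves the ideal of the variety, and the
  -- derivative of each generator is a combination of the generators.
  have hcoef : ∀ j : s, ∃ a : s → MvPolynomial (Fin n) ℝ, 𝒟 j = ∑ k, a k * (k : MvPolynomial _ ℝ) := by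
    intro j
    have hj : (j : MvPolynomial (Fin n) ℝ) ∈ RingHom.ker π := hs ▸ Submodule.subset_span j.2
    have : 𝒟 j ∈ Submodule.span (MvPolynomial (Fin n) ℝ)
        (Set.range (Subtype.val : s → MvPolynomial (Fin n) ℝ)) := by
      have h2 : 𝒟 j ∈ RingHom.ker π := by
        rw [RingHom.mem_ker] at hj ⊢
        rw [hD, hj, map_zero]
      rw [← hs] at h2
      convert h2
      simp
    obtain ⟨a, ha⟩ := (Submodule.mem_span_range_iff_exists_fun _).1 this
    exact ⟨a, by simpa using ha.symm⟩
  choose a ha using hcoef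
  let w : ℝ → s → ℝ := fun t j => MvPolynomial.eval (u t) j
  have hcont : ContinuousOn u (Set.Icc 0 b) := fun t ht =>
    (hu t (hmem t ht)).continuousAt.continuousWithinAt
  have hw' : ∀ t ∈ Set.Icc 0 b,
      HasDerivAt w (fun j => ∑ k, MvPolynomial.eval (u t) (a j k) * w t k) t := by
    intro t ht
    refine hasDerivAt_pi.2 fun j => ?_
    have := hasDerivAt_eval_comp p (hu t (hmem t ht)) j
    change HasDerivAt _ (MvPolynomial.eval (u t) (𝒟 j)) t at this
    rw [ha] at this
    simpa [w] using this
  obtain ⟨K, hK⟩ := (isCompact_Icc (a := (0 : ℝ)) (b := b)).exists_bound_of_continuousOn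
    (f := fun t => ∑ j, ∑ k, |MvPolynomial.eval (u t) (a j k)|) <|
      continuousOn_finsetSum _ fun j _ => continuousOn_finsetSum _ fun k _ =>
        ((MvPolynomial.continuous_eval (a j k)).comp_continuousOn hcont).abs
  -- Along the curve the generators of the ideal solve a homogeneous linear system with bounded
  -- coefficients and vanish at time `0`. Grönwall's inequality makes them vanish throughout, so the
  -- curve stays in the variety.
  have hw : ∀ t ∈ Set.Icc 0 b, w t = 0 := by
    refine eq_zero_of_abs_deriv_le_mul_abs_self_of_eq_zero_right (K := K)
      (fun t ht => (hw' t ht).continuousAt.continuousWithinAt)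
      (fun t ht => (hw' t (Set.Ico_subset_Icc_self ht)).hasDerivWithinAt) ?_ ?_
    · ext j
      have hj : (j : MvPolynomial (Fin n) ℝ) ∈ RingHom.ker π := hs ▸ Submodule.subset_span j.2
      rw [RingHom.mem_ker] at hj
      simp only [w, hu0, hev, hj, map_zero, Pi.zero_apply]
    · intro t ht
      have hKt := hK t (Set.Ico_subset_Icc_self ht)
      have hK0 : 0 ≤ K := (norm_nonneg _).trans hKt
      refine (pi_norm_le_iff_of_nonneg (by positivity)).2 fun j => ?_
      calc ‖∑ k, MvPolynomial.eval (u t) (a j k) * w t k‖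
          ≤ ∑ k, |MvPolynomial.eval (u t) (a j k)| * ‖w t‖ := by
            refine (norm_sum_le _ _).trans (Finset.sum_le_sum fun k _ => ?_)
            rw [norm_mul, Real.norm_eq_abs]
            gcongr
            exact norm_le_pi_norm (w t) k
        _ = (∑ k, |MvPolynomial.eval (u t) (a j k)|) * ‖w t‖ := by rw [Finset.sum_mul]
        _ ≤ K * ‖w t‖ := by
            gcongr
            refine le_trans ?_ ((le_abs_self _).trans hKt)
            exact Finset.single_le_sum
              (f := fun j => ∑ k, |MvPolynomial.eval (u t) (a j k)|)
              (fun j _ => Finset.sum_nonneg fun k _ => abs_nonneg _) (Finset.mem_univ j)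
  have hker : ∀ t ∈ Set.Icc 0 b, ∀ q ∈ RingHom.ker π, MvPolynomial.eval (u t) q = 0 := by
    intro t ht q hq
    have : RingHom.ker π ≤ RingHom.ker (MvPolynomial.eval (u t)) := by
      rw [← hs, Submodule.span_le]
      intro j hj
      exact congrFun (hw t ht) ⟨j, hj⟩
    exact this hq
  let e := Ideal.quotientKerAlgEquivOfSurjective hπ
  -- The value off the interval is irrelevant, because only the derivative within the interval is
  -- taken.
  let y : ℝ → O →ₐ[ℝ] ℝ := fun t => if ht : t ∈ Set.Icc 0 b then
    (Ideal.Quotient.liftₐ (RingHom.ker π) (MvPolynomial.aeval (u t))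
      fun q hq => hker t ht q hq).comp e.symm.toAlgHom else x
  have hy : ∀ t ∈ Set.Icc 0 b, ∀ q, y t (π q) = MvPolynomial.eval (u t) q := by
    intro t ht q
    have h1 : e.symm (π q) = Ideal.Quotient.mk _ q := by
      rw [AlgEquiv.symm_apply_eq]; rfl
    simp only [y, dif_pos ht, AlgHom.comp_apply]
    erw [h1]
    rfl
  refine ⟨b, hb, y, ?_, fun f => ?_⟩
  · ext f
    obtain ⟨q, rfl⟩ := hπ f
    rw [hy 0 ⟨le_rfl, hb.le⟩, hu0, hev]
  · obtain ⟨q, rfl⟩ := hπ f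
    have h0 : (0 : ℝ) ∈ Set.Icc 0 b := ⟨le_rfl, hb.le⟩
    have := (hasDerivAt_eval_comp p (hu 0 (hmem 0 h0)) q).hasDerivWithinAt (s := Set.Icc 0 b)
    change HasDerivWithinAt _ (MvPolynomial.eval (u 0) (𝒟 q)) _ _ at this
    rw [hu0, hev, hD] at this
    exact this.congr (fun t ht => hy t ht q) (hy 0 h0 q)

/-- Such an `f` is constantly zero along the flow of `D`, whose points are real points, and its
derivative at time `0` is `x (D f)`. One-sided derivatives on the interval are unique, which
suffices. -/
theorem derivation_apply_eq_zero_of_forall_realPoint {O : Type*} [CommRing O] [Algebra ℝ O]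
    [Algebra.FiniteType ℝ O] (D : Derivation ℝ O O) {f : O} (hf : ∀ x : RealPoint O, x f = 0)
    (x : RealPoint O) : x (D f) = 0 := by
  obtain ⟨b, hb, y, -, hy⟩ := exists_flow D x
  have h1 := hy f
  simp only [hf] at h1
  exact (uniqueDiffOn_Icc hb 0 ⟨le_rfl, hb.le⟩).eq_deriv _ h1 (hasDerivWithinAt_const _ _ _)

/-- The derivation `f ↦ f - f(x)` with values in `O ⧸ 𝔪²`. -/
def cotangentDerivation {O : Type*} [CommRing O] [Algebra ℝ O] (x : RealPoint O) :
    Derivation ℝ O (O ⧸ RingHom.ker x ^ 2) :=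
  Derivation.mk'
    { toFun := fun f => Ideal.Quotient.mk _ (f - algebraMap ℝ O (x f))
      map_add' := fun f g => by rw [← map_add]; congr 1; simp only [map_add]; ring
      map_smul' := fun r f => by
        rw [RingHom.id_apply, ← Ideal.Quotient.mk_eq_mk, ← Ideal.Quotient.mk_eq_mk,
          ← Submodule.Quotient.mk_smul]
        congr 1
        simp [Algebra.smul_def, mul_sub] } <| by
    intro f g
    change Ideal.Quotient.mk _ _ = f • Ideal.Quotient.mk _ _ + g • Ideal.Quotient.mk _ _
    simp only [← Ideal.Quotient.mk_eq_mk, ← Submodule.Quotient.mk_smul]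
    rw [← Submodule.Quotient.mk_add, Submodule.Quotient.eq]
    -- The defect in the Leibniz rule is, up to sign, a product of two elements of the maximal
    -- ideal.
    have : f * g - algebraMap ℝ O (x (f * g)) - (f • (g - algebraMap ℝ O (x g)) +
        g • (f - algebraMap ℝ O (x f))) =
        -((f - algebraMap ℝ O (x f)) * (g - algebraMap ℝ O (x g))) := by
      simp only [map_mul, smul_eq_mul]; ring
    rw [this, neg_mem_iff, pow_two]
    have hm : ∀ f, f - algebraMap ℝ O (x f) ∈ RingHom.ker x := fun f => by
      rw [RingHom.mem_ker, map_sub, AlgHom.commutes]; simp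
    exact Ideal.mul_mem_mul (hm f) (hm g)

/-- An Euler vector field at a real point multiplies the leading term of a function by its order. -/
theorem euler_sub_smul_mem {O : Type*} [CommRing O] [Algebra ℝ O] {𝔪 : Ideal O}
    (E : Derivation ℝ O O) (hE : ∀ f ∈ 𝔪, E f - f ∈ 𝔪 ^ 2) (k : ℕ) :
    ∀ f ∈ 𝔪 ^ (k + 1), E f - ((k + 1 : ℕ) : O) * f ∈ 𝔪 ^ (k + 2) := by
  induction k with
  | zero => intro f hf; simpa using hE f (by simpa using hf)
  | succ k ih =>
    intro f hf
    rw [pow_succ' 𝔪 (k + 1)] at hf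
    refine Submodule.mul_induction_on hf ?_ ?_
    · intro g hg h hh
      -- The orders add under the Leibniz rule: `k + 1` from `h` and `1` from `g`, each with an
      -- error one order higher.
      have : E (g * h) - ((k + 1 + 1 : ℕ) : O) * (g * h) =
          g * (E h - ((k + 1 : ℕ) : O) * h) + h * (E g - g) := by
        rw [Derivation.leibniz]; push_cast; simp only [smul_eq_mul]; ring
      rw [this]
      refine add_mem ?_ ?_
      · rw [show k + 1 + 2 = (k + 2) + 1 from rfl, pow_succ' 𝔪 (k + 2)]
        exact Ideal.mul_mem_mul hg (ih h hh)
      · rw [pow_add 𝔪 (k + 1) 2]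
        exact Ideal.mul_mem_mul hh (hE g hg)
    · intro g h hg hh
      have : E (g + h) - ((k + 1 + 1 : ℕ) : O) * (g + h) =
          (E g - ((k + 1 + 1 : ℕ) : O) * g) + (E h - ((k + 1 + 1 : ℕ) : O) * h) := by
        rw [map_add]; ring
      rw [this]
      exact add_mem hg hh

/-- On a smooth integral affine real variety with a real point, a regular function which vanishes
at all real points is zero. -/
theorem eq_zero_of_forall_realPoint {O : Type*} [CommRing O] [IsDomain O] [Algebra ℝ O]
    [Algebra.Smooth ℝ O] (x₀ : RealPoint O) {f : O} (hf : ∀ x : RealPoint O, x f = 0) : f = 0 := by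
  have : IsNoetherianRing O := Algebra.FiniteType.isNoetherianRing ℝ O
  obtain ⟨n, y, i, hi⟩ := exists_kaehler_dual_basis ℝ O
  let 𝔪 := RingHom.ker x₀
  have hm : ∀ f, f - algebraMap ℝ O (x₀ f) ∈ 𝔪 := fun f => by
    rw [RingHom.mem_ker, map_sub, AlgHom.commutes]; simp
  let D : Fin n → Derivation ℝ O O := fun l =>
    ((LinearMap.proj l).comp i).compDer (KaehlerDifferential.D ℝ O)
  -- The dual basis provides more generators `y l` than local coordinates in general; no
  -- independence is needed for an Euler field.
  let E : Derivation ℝ O O := ∑ l, (y l - algebraMap ℝ O (x₀ (y l))) • D l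
  have hEapp : ∀ g, E g = ∑ l, (y l - algebraMap ℝ O (x₀ (y l))) * D l g := fun g => by
    simp only [E, ← Derivation.coeFnAddMonoidHom_apply, map_sum, Finset.sum_apply]; rfl
  -- The dual basis writes the differential of `g` as the sum of the `D l g` times the differentials
  -- of `y l`. The derivation `f ↦ f - f(x₀)` modulo `𝔪 ^ 2` turns this into the claim.
  have hE : ∀ g ∈ 𝔪, E g - g ∈ 𝔪 ^ 2 := by
    intro g hg
    have h1 := congrArg (cotangentDerivation x₀).liftKaehlerDifferential
      (hi (KaehlerDifferential.D ℝ O g))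
    rw [map_sum] at h1
    simp only [map_smul, Derivation.liftKaehlerDifferential_comp_D] at h1
    change Ideal.Quotient.mk _ _ = ∑ l, D l g • Ideal.Quotient.mk (𝔪 ^ 2) _ at h1
    simp only [← Ideal.Quotient.mk_eq_mk, ← Submodule.Quotient.mk_smul] at h1
    simp only [Ideal.Quotient.mk_eq_mk, ← map_sum] at h1
    rw [eq_comm, Ideal.Quotient.eq] at h1
    rw [RingHom.mem_ker] at hg
    rw [hg, map_zero, sub_zero] at h1
    convert h1 using 2
    rw [hEapp]
    exact Finset.sum_congr rfl fun l _ => mul_comm _ _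
  have key : ∀ k : ℕ, ∀ f : O, (∀ x : RealPoint O, x f = 0) → f ∈ 𝔪 ^ (k + 1) := by
    intro k
    induction k with
    | zero => intro f hf; simpa [𝔪, RingHom.mem_ker] using hf x₀
    | succ k ih =>
      intro f hf
      have h1 := euler_sub_smul_mem E hE k f (ih f hf)
      -- Each `D l f` again vanishes at all real points, so the induction hypothesis applies to it;
      -- its coefficient in `E f` contributes one more factor in `𝔪`. Comparing with the Euler
      -- relation and dividing by `k + 1` raises the order of `f`.
      have h2 : E f ∈ 𝔪 ^ (k + 2) := by
        rw [hEapp, pow_succ' 𝔪 (k + 1)]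
        exact sum_mem fun l _ => Ideal.mul_mem_mul (hm _)
          (ih _ (derivation_apply_eq_zero_of_forall_realPoint (D l) hf))
      have h3 : ((k + 1 : ℕ) : O) * f ∈ 𝔪 ^ (k + 2) := by
        have := sub_mem h2 h1
        rwa [sub_sub_cancel] at this
      have h4 := Ideal.mul_mem_left _ (algebraMap ℝ O ((k + 1 : ℕ) : ℝ)⁻¹) h3
      rwa [← mul_assoc, ← map_natCast (algebraMap ℝ O), ← map_mul, inv_mul_cancel₀
        (by positivity), map_one, one_mul] at h4
  have hinf : f ∈ ⨅ k : ℕ, 𝔪 ^ k := by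
    rw [Submodule.mem_iInf]
    rintro (_ | k)
    · simp
    · exact key k f hf
  -- Krull's intersection theorem, for a proper ideal of a Noetherian domain.
  rw [Ideal.iInf_pow_eq_bot_of_isDomain (I := 𝔪) (RingHom.ker_ne_top x₀)] at hinf
  simpa using hinf

/-- A complex regular function which vanishes at all real points is zero. -/
theorem eq_zero_of_forall_evalAt {O : Type*} [CommRing O] [IsDomain O] [Algebra ℝ O]
    [Algebra.Smooth ℝ O] (x₀ : RealPoint O) {b : ℂ ⊗[ℝ] O}
    (hb : ∀ x : RealPoint O, evalAt x b = 0) : b = 0 := by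
  have hrep : ∀ c : ℂ ⊗[ℝ] O, ∃ f g : O, c = 1 ⊗ₜ f + Complex.I ⊗ₜ g := by
    intro c
    induction c with
    | zero => exact ⟨0, 0, by simp⟩
    | tmul z f =>
      refine ⟨z.re • f, z.im • f, ?_⟩
      rw [← TensorProduct.smul_tmul, ← TensorProduct.smul_tmul, ← TensorProduct.add_tmul]
      congr 1
      apply Complex.ext <;> simp
    | add c c' hc hc' =>
      obtain ⟨f, g, rfl⟩ := hc
      obtain ⟨f', g', rfl⟩ := hc'
      exact ⟨f + f', g + g', by simp only [TensorProduct.tmul_add]; abel⟩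
  obtain ⟨f, g, rfl⟩ := hrep b
  have hfg : ∀ x : RealPoint O, x f = 0 ∧ x g = 0 := by
    intro x
    have := hb x
    simp only [evalAt, map_add, Algebra.TensorProduct.lift_tmul, AlgHom.coe_id, id_eq,
      AlgHom.comp_apply, Algebra.ofId_apply, Complex.coe_algebraMap, one_mul] at this
    have h1 := congrArg Complex.re this
    have h2 := congrArg Complex.im this
    simp at h1 h2
    exact ⟨h1, h2⟩
  rw [eq_zero_of_forall_realPoint x₀ fun x => (hfg x).1,
    eq_zero_of_forall_realPoint x₀ fun x => (hfg x).2]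
  simp

end Density

end CocycleCalculus

end

noncomputable section

namespace CocycleCalculus

/-! ### The universal property of the algebra of differential forms -/

section ExteriorLift

variable {B K R : Type*} [CommRing B] [AddCommGroup K] [Module B K] [Ring R]

/-- A ring homomorphism out of an exterior algebra over `B`, for a target in which the image of `B`
is not required to be central. -/
theorem exists_exteriorAlgebra_hom (φ : B →+* R) (ψ : K →+ R)
    (hsmul : ∀ b ω, ψ (b • ω) = φ b * ψ ω) (hcomm : ∀ b ω, ψ ω * φ b = φ b * ψ ω)
    (hsq : ∀ ω, ψ ω * ψ ω = 0) :
    ∃ F : ExteriorAlgebra B K →+* R,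
      (∀ b, F (algebraMap B _ b) = φ b) ∧ ∀ ω, F (ExteriorAlgebra.ι B ω) = ψ ω := by
  -- The centralizer of the image of `B` contains that image and the image of `K`, and it is a
  -- `B`-algebra, so the usual universal property applies to it.
  let R' : Subring R := Subring.centralizer (Set.range φ)
  have hφ : ∀ b, φ b ∈ R' := fun b => Subring.mem_centralizer_iff.2 <| by
    rintro _ ⟨c, rfl⟩
    rw [← map_mul, ← map_mul, mul_comm]
  have hψ : ∀ ω, ψ ω ∈ R' := fun ω => Subring.mem_centralizer_iff.2 <| by
    rintro _ ⟨c, rfl⟩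
    exact (hcomm c ω).symm
  let _ : Algebra B R' := (φ.codRestrict R' hφ).toAlgebra' fun b r => Subtype.ext <|
    Subring.mem_centralizer_iff.1 r.2 _ ⟨b, rfl⟩
  let f : K →ₗ[B] R' :=
    { toFun := fun ω => ⟨ψ ω, hψ ω⟩
      map_add' := fun ω η => Subtype.ext (map_add ψ ω η)
      map_smul' := fun b ω => Subtype.ext (hsmul b ω) }
  refine ⟨R'.subtype.comp (ExteriorAlgebra.lift B ⟨f, fun ω => Subtype.ext (hsq ω)⟩).toRingHom,
    fun b => ?_, fun ω => ?_⟩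
  · change ((ExteriorAlgebra.lift B ⟨f, _⟩ (algebraMap B _ b) : R') : R) = _
    rw [AlgHom.commutes]
    rfl
  · change ((ExteriorAlgebra.lift B ⟨f, _⟩ (ExteriorAlgebra.ι B ω) : R') : R) = _
    rw [ExteriorAlgebra.lift_ι_apply]
    rfl

theorem exteriorAlgebra_ι_smul {R : Type*} [CommRing R] {K : Type*} [AddCommGroup K] [Module R K]
    (b : R) (ω : K) : ExteriorAlgebra.ι R (b • ω) =
    algebraMap R (ExteriorAlgebra R K) b * ExteriorAlgebra.ι R ω := by
  rw [map_smul, Algebra.smul_def]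

theorem exteriorAlgebra_ringHom_ext {F G : ExteriorAlgebra B K →+* R}
    (h₁ : ∀ b, F (algebraMap B _ b) = G (algebraMap B _ b))
    (h₂ : ∀ ω, F (ExteriorAlgebra.ι B ω) = G (ExteriorAlgebra.ι B ω)) : F = G := by
  ext x
  induction x using ExteriorAlgebra.induction with
  | algebraMap b => exact h₁ b
  | ι x => exact h₂ x
  | mul x y hx hy => rw [map_mul, map_mul, hx, hy]
  | add x y hx hy => rw [map_add, map_add, hx, hy]

/-- The relations of functions and their differentials in an algebra of differential forms. -/
structure IsFormRelations {k B R : Type*} [CommRing k] [CommRing B] [Algebra k B] [Ring R]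
    [Algebra k R] (φ : B →ₐ[k] R) (D : B →ₗ[k] R) : Prop where
  leibniz : ∀ b c, D (b * c) = φ b * D c + φ c * D b
  comm : ∀ b c, D c * φ b = φ b * D c
  sq : ∀ b, D b * D b = 0

/-- With `B` acting on `R` by left multiplication through `φ`, the map `D` is a derivation and
factors through the Kähler differentials. Vanishing squares are assumed only for exact elements.
They give anticommutation there by polarization, this extends to combinations by centrality, and
division by `2` returns vanishing squares. -/
theorem exists_exteriorAlgebra_kaehler_hom {B R : Type*} [CommRing B] [Algebra ℂ B] [Ring R]
    [Algebra ℂ R] {φ : B →ₐ[ℂ] R} {D : B →ₗ[ℂ] R} (h : IsFormRelations φ D) :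
    ∃ F : ExteriorAlgebra B Ω[B⁄ℂ] →+* R, (∀ b, F (algebraMap B _ b) = φ b) ∧
      ∀ b, F (ExteriorAlgebra.ι B (KaehlerDifferential.D ℂ B b)) = D b := by
  let _ : Module B R := Module.compHom R φ.toRingHom
  have hs : ∀ (b : B) (r : R), b • r = φ b * r := fun _ _ => rfl
  have : IsScalarTower ℂ B R := ⟨fun z b r => by
    rw [hs, hs, map_smul, smul_mul_assoc]⟩
  let ψ := (Derivation.mk' D h.leibniz).liftKaehlerDifferential
  have hψD : ∀ b, ψ (KaehlerDifferential.D ℂ B b) = D b := fun b =>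
    Derivation.liftKaehlerDifferential_comp_D _ b
  have hspan : ∀ ω : Ω[B⁄ℂ], ω ∈ Submodule.span B (Set.range (KaehlerDifferential.D ℂ B)) :=
    fun ω => KaehlerDifferential.span_range_derivation ℂ B ▸ Submodule.mem_top
  have hsmul : ∀ b ω, ψ (b • ω) = φ b * ψ ω := fun b ω => map_smul ψ b ω
  have hcomm : ∀ b ω, ψ ω * φ b = φ b * ψ ω := by
    intro b ω
    induction hspan ω using Submodule.span_induction with
    | mem x hx => obtain ⟨c, rfl⟩ := hx; rw [hψD, h.comm]
    | zero => simp
    | add x y _ _ hx hy => rw [map_add, add_mul, mul_add, hx, hy]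
    | smul c x _ hx =>
      rw [hsmul, mul_assoc, hx, ← mul_assoc, ← mul_assoc, ← map_mul, ← map_mul, mul_comm]
  have hDD : ∀ b c, D b * D c = -(D c * D b) := by
    intro b c
    have := h.sq (b + c)
    rw [map_add, add_mul, mul_add, mul_add, h.sq, h.sq, zero_add, add_zero] at this
    exact eq_neg_of_add_eq_zero_left this
  have hanti : ∀ ω η, ψ ω * ψ η = -(ψ η * ψ ω) := by
    intro ω η
    induction hspan ω using Submodule.span_induction with
    | zero => simp
    | add x y _ _ hx hy => rw [map_add, add_mul, mul_add, hx, hy, neg_add]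
    | smul c x _ hx =>
      rw [hsmul, mul_assoc, hx, ← mul_assoc, hcomm, mul_neg, mul_assoc]
    | mem x hx =>
      obtain ⟨c, rfl⟩ := hx
      induction hspan η using Submodule.span_induction with
      | zero => simp
      | add x y _ _ hx hy => rw [map_add, add_mul, mul_add, hx, hy, neg_add]
      | smul c x _ hx =>
        rw [hsmul, mul_assoc, ← mul_assoc, hcomm, mul_assoc, hx, mul_neg]
      | mem x hx => obtain ⟨c', rfl⟩ := hx; rw [hψD, hψD, hDD]
  have hsq : ∀ ω, ψ ω * ψ ω = 0 := by
    intro ω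
    have h1 : (2 : ℂ) • (ψ ω * ψ ω) = 0 := by
      rw [two_smul]; nth_rewrite 1 [hanti]; exact neg_add_cancel _
    exact (smul_eq_zero.1 h1).resolve_left two_ne_zero
  obtain ⟨F, h1, h2⟩ := exists_exteriorAlgebra_hom φ.toRingHom ψ.toAddMonoidHom hsmul hcomm hsq
  exact ⟨F, h1, fun b => (h2 _).trans (hψD b)⟩

/-- The exterior algebra of a finite free module over `B` is separated by the ring homomorphisms
which separate `B`. -/
theorem eq_zero_of_forall_exteriorAlgebra_hom {n : ℕ} {I : Type*} (e : I → B →+* ℂ)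
    (he : ∀ b, (∀ x, e x b = 0) → b = 0)
    (F : ∀ x : I, ExteriorAlgebra B (Fin n → B) →+* ExteriorAlgebra ℂ (Fin n → ℂ))
    (hF₁ : ∀ x b, F x (algebraMap B _ b) = algebraMap ℂ _ (e x b))
    (hF₂ : ∀ x v, F x (ExteriorAlgebra.ι B v) = ExteriorAlgebra.ι ℂ fun l => e x (v l))
    {ω : ExteriorAlgebra B (Fin n → B)} (hω : ∀ x, F x ω = 0) : ω = 0 := by
  let bB := (Pi.basisFun B (Fin n)).ExteriorAlgebra
  let bC := (Pi.basisFun ℂ (Fin n)).ExteriorAlgebra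
  -- The standard monomials go to the standard monomials, so `F x` acts on coordinates by `e x`, and
  -- the coordinates can be separated one at a time.
  have hbasis : ∀ x s, F x (bB s) = bC s := by
    intro x s
    simp only [bB, bC, ExteriorAlgebra.basis_apply, ExteriorAlgebra.ιMulti_family,
      ExteriorAlgebra.ιMulti_apply, map_list_prod, List.map_ofFn]
    congr 2
    ext1 j
    simp only [Function.comp_apply, hF₂]
    congr 1
    ext l
    simp [Pi.single_apply, apply_ite]
  rw [← bB.repr.map_eq_zero_iff]
  ext s
  refine he _ fun x => ?_
  have h1 := hω x
  rw [← bB.sum_repr ω, map_sum] at h1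
  simp only [Algebra.smul_def, map_mul, hF₁, hbasis] at h1
  simp only [← Algebra.smul_def] at h1
  have h2 := congrArg (fun z => bC.repr z s) h1
  simpa [Finsupp.single_apply] using h2

end ExteriorLift

/-! ### Comparison of forms on the real points with Kähler differentials -/

section FormLift

variable {O : Type*} [CommRing O] [Algebra ℝ O]

theorem functionForm_mul_comm (b : ℂ ⊗[ℝ] O) (ω : Form O) :
    ω * functionForm b = functionForm b * ω := by
  refine Subtype.ext (funext fun x => ?_)
  exact (Algebra.commutes (evalAt x b) _).symm

theorem evalAt_one_tmul (x : RealPoint O) (f : O) : evalAt x (1 ⊗ₜ f) = (x f : ℂ) := by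
  simp [evalAt, Algebra.ofId_apply]

theorem diffAt_tmul (x : RealPoint O) (z : ℂ) (f : O) (v : tangentSpace x) :
    diffAt x (z ⊗ₜ f) v = z * ((v : O →ₗ[ℝ] ℝ) f : ℂ) := by
  simp [diffAt]

theorem evalAt_tmul (x : RealPoint O) (z : ℂ) (f : O) : evalAt x (z ⊗ₜ f) = z * (x f : ℂ) := by
  simp [evalAt, Algebra.ofId_apply]

theorem diffAt_mul (x : RealPoint O) (b c : ℂ ⊗[ℝ] O) :
    diffAt x (b * c) = evalAt x b • diffAt x c + evalAt x c • diffAt x b := by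
  induction b with
  | zero => simp
  | add b b' hb hb' => simp only [add_mul, map_add, hb, hb', add_smul, smul_add]; abel
  | tmul z f =>
    induction c with
    | zero => simp
    | add c c' hc hc' => simp only [mul_add, map_add, hc, hc', add_smul, smul_add]; abel
    | tmul w g =>
      ext v
      have hv := v.2 f g
      simp only [Algebra.TensorProduct.tmul_mul_tmul, LinearMap.add_apply, LinearMap.smul_apply,
        diffAt_tmul, evalAt_tmul, smul_eq_mul, hv]
      push_cast
      ring

theorem isFormRelations_form :
    IsFormRelations (functionForm (O := O)) (diffForm (O := O)) where
  leibniz b c := by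
    refine Subtype.ext (funext fun x => ?_)
    change ExteriorAlgebra.ι ℂ (diffAt x (b * c)) = algebraMap ℂ _ (evalAt x b) *
      ExteriorAlgebra.ι ℂ (diffAt x c) + algebraMap ℂ _ (evalAt x c) *
      ExteriorAlgebra.ι ℂ (diffAt x b)
    rw [diffAt_mul, map_add, map_smul, map_smul, Algebra.smul_def, Algebra.smul_def]
  comm b c := functionForm_mul_comm b _
  sq b := by
    refine Subtype.ext (funext fun x => ?_)
    exact ExteriorAlgebra.ι_sq_zero _

/-- The value of a differential form at a real point. -/
def evalForm (x : RealPoint O) : Form O →ₐ[ℂ] ExteriorAlgebra ℂ (Cotangent x) :=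
  (Pi.evalAlgHom ℂ _ x).comp (formAlgebra O).val

theorem form_induction {p : Form O → Prop} (hf : ∀ b, p (functionForm b))
    (hd : ∀ b, p (diffForm b)) (hadd : ∀ ω η, p ω → p η → p (ω + η))
    (hmul : ∀ ω η, p ω → p η → p (ω * η)) (ω : Form O) : p ω := by
  obtain ⟨ω, hω⟩ := ω
  induction hω using Algebra.adjoin_induction with
  | mem _ hx =>
    rcases hx with ⟨b, rfl⟩ | ⟨b, rfl⟩
    · exact hf b
    · exact hd b
  | algebraMap r =>
    convert hf (algebraMap ℂ _ r)
    rw [AlgHom.commutes]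
    rfl
  | add x y hx hy h1 h2 => exact hadd _ _ h1 h2
  | mul x y hx hy h1 h2 => exact hmul _ _ h1 h2

theorem form_algHom_ext {R : Type*} [Ring R] [Algebra ℂ R] {F G : Form O →ₐ[ℂ] R}
    (h₁ : ∀ b, F (functionForm b) = G (functionForm b))
    (h₂ : ∀ b, F (diffForm b) = G (diffForm b)) : F = G := by
  ext ω
  induction ω using form_induction with
  | hf b => exact h₁ b
  | hd b => exact h₂ b
  | hadd ω η h1 h2 => rw [map_add, map_add, h1, h2]
  | hmul ω η h1 h2 => rw [map_mul, map_mul, h1, h2]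

/-- The real and imaginary parts of a complex derivation, as tangent vectors. -/
def tangentOfDerivation (x : RealPoint O) (D : Derivation ℂ (ℂ ⊗[ℝ] O) (ℂ ⊗[ℝ] O))
    (p : ℂ →ₗ[ℝ] ℝ) : tangentSpace x :=
  ⟨p ∘ₗ (evalAt x).toLinearMap.restrictScalars ℝ ∘ₗ D.toLinearMap.restrictScalars ℝ ∘ₗ
    TensorProduct.mk ℝ ℂ O 1, fun f g => by
      have h : ∀ (r : ℝ) (z : ℂ), p ((r : ℂ) * z) = r * p z := fun r z => by
        rw [← Complex.real_smul, map_smul, smul_eq_mul]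
      change p (evalAt x (D (1 ⊗ₜ (f * g)))) = x f * p (evalAt x (D (1 ⊗ₜ g))) +
        x g * p (evalAt x (D (1 ⊗ₜ f)))
      have h1 : (1 : ℂ) ⊗ₜ[ℝ] (f * g) = (1 ⊗ₜ f) * (1 ⊗ₜ g) := by simp
      rw [h1, Derivation.leibniz, map_add, smul_eq_mul, smul_eq_mul, map_mul, map_mul,
        evalAt_one_tmul, evalAt_one_tmul, map_add, h, h]⟩

/-- A complex derivation followed by evaluation at `x` is `v + i w` with real tangent vectors `v`
and `w` at `x`, and cotangent vectors can be paired with both. Thus the values `D l b` at `x` depend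
only on the differential of `b` at `x`. -/
theorem exists_cotangent_coordinates {n : ℕ} (x : RealPoint O)
    (D : Fin n → Derivation ℂ (ℂ ⊗[ℝ] O) (ℂ ⊗[ℝ] O)) :
    ∃ C : Cotangent x →ₗ[ℂ] Fin n → ℂ, ∀ b l, C (diffAt x b) l = evalAt x (D l b) := by
  let C : Cotangent x →ₗ[ℂ] Fin n → ℂ :=
    { toFun := fun τ l => τ (tangentOfDerivation x (D l) Complex.reLm) +
        Complex.I * τ (tangentOfDerivation x (D l) Complex.imLm)
      map_add' := fun τ τ' => by ext l; simp; ring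
      map_smul' := fun z τ => by ext l; simp; ring }
  refine ⟨C, fun b l => ?_⟩
  induction b with
  | zero => simp
  | add b b' hb hb' => rw [map_add, map_add, Pi.add_apply, hb, hb', map_add, map_add]
  | tmul z f =>
    change diffAt x (z ⊗ₜ f) (tangentOfDerivation x (D l) Complex.reLm) +
      Complex.I * diffAt x (z ⊗ₜ f) (tangentOfDerivation x (D l) Complex.imLm) = _
    rw [diffAt_tmul, diffAt_tmul]
    have h1 : z ⊗ₜ[ℝ] f = z • ((1 : ℂ) ⊗ₜ[ℝ] f) := by
      rw [TensorProduct.smul_tmul', smul_eq_mul, mul_one]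
    rw [h1, Derivation.map_smul, map_smul, smul_eq_mul]
    set w := evalAt x (D l (1 ⊗ₜ f)) with hw
    change z * (w.re : ℂ) + Complex.I * (z * (w.im : ℂ)) = z * w
    conv_rhs => rw [← Complex.re_add_im w]
    ring

variable [IsDomain O] [Algebra.Smooth ℝ O]

/-- Differential forms on the real points are the exterior algebra of the Kähler differentials. -/
theorem exists_ringEquiv_form (x₀ : RealPoint O) :
    ∃ Ψ : ExteriorAlgebra (ℂ ⊗[ℝ] O) Ω[(ℂ ⊗[ℝ] O)⁄ℂ] ≃+* Form O,
      (∀ b, Ψ (algebraMap _ _ b) = functionForm b) ∧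
      ∀ b, Ψ (ExteriorAlgebra.ι _ (KaehlerDifferential.D ℂ _ b)) = diffForm b := by
  obtain ⟨Ψ, hΨ₁, hΨ₂⟩ := exists_exteriorAlgebra_kaehler_hom (isFormRelations_form (O := O))
  have hsurj : Function.Surjective Ψ := by
    intro ω
    induction ω using form_induction with
    | hf b => exact ⟨_, hΨ₁ b⟩
    | hd b => exact ⟨_, hΨ₂ b⟩
    | hadd ω η h1 h2 =>
      obtain ⟨x, rfl⟩ := h1
      obtain ⟨y, rfl⟩ := h2
      exact ⟨x + y, map_add Ψ x y⟩
    | hmul ω η h1 h2 =>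
      obtain ⟨x, rfl⟩ := h1
      obtain ⟨y, rfl⟩ := h2
      exact ⟨x * y, map_mul Ψ x y⟩
  have hinj : Function.Injective Ψ := by
    rw [injective_iff_map_eq_zero]
    intro ω hω
    obtain ⟨n, y, i, hi⟩ := exists_kaehler_dual_basis ℂ (ℂ ⊗[ℝ] O)
    let r : (Fin n → ℂ ⊗[ℝ] O) →ₗ[ℂ ⊗[ℝ] O] Ω[(ℂ ⊗[ℝ] O)⁄ℂ] :=
      Fintype.linearCombination _ fun l => KaehlerDifferential.D ℂ _ (y l)
    have hri : r ∘ₗ i = LinearMap.id := LinearMap.ext fun ω => by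
      simpa [r, Fintype.linearCombination_apply] using (hi ω).symm
    -- The Kähler differentials are a retract of a free module, hence so are the exterior algebras;
    -- it is enough to kill the image in the free one, where evaluation at points separates.
    have hmap : ∀ ω, ExteriorAlgebra.map r (ExteriorAlgebra.map i ω) = ω := fun ω => by
      rw [← AlgHom.comp_apply, ExteriorAlgebra.map_comp_map, hri, ExteriorAlgebra.map_id]; rfl
    let D : Fin n → Derivation ℂ (ℂ ⊗[ℝ] O) (ℂ ⊗[ℝ] O) := fun l =>
      ((LinearMap.proj l).comp i).compDer (KaehlerDifferential.D ℂ _)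
    have hE : ∀ x : RealPoint O, ∃ F : ExteriorAlgebra (ℂ ⊗[ℝ] O) (Fin n → ℂ ⊗[ℝ] O) →+*
        ExteriorAlgebra ℂ (Fin n → ℂ),
        (∀ b, F (algebraMap _ _ b) = algebraMap ℂ _ (evalAt x b)) ∧
        ∀ v, F (ExteriorAlgebra.ι _ v) = ExteriorAlgebra.ι ℂ fun l => evalAt x (v l) := by
      intro x
      refine exists_exteriorAlgebra_hom ((algebraMap ℂ _).comp (evalAt x).toRingHom)
        { toFun := fun v : Fin n → ℂ ⊗[ℝ] O => ExteriorAlgebra.ι ℂ fun l => evalAt x (v l)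
          map_zero' := by
            simp only [Pi.zero_apply, map_zero]; exact map_zero (ExteriorAlgebra.ι ℂ)
          map_add' := fun v w => by rw [← map_add]; congr 1; ext l; simp } ?_ ?_ ?_
      · intro b v
        change ExteriorAlgebra.ι ℂ _ = algebraMap ℂ _ (evalAt x b) * ExteriorAlgebra.ι ℂ _
        rw [← Algebra.smul_def, ← map_smul]
        congr 1; ext l; simp
      · exact fun b v => (Algebra.commutes (evalAt x b)
          (ExteriorAlgebra.ι ℂ fun l => evalAt x (v l))).symm
      · exact fun v => ExteriorAlgebra.ι_sq_zero _
    choose F hF₁ hF₂ using hE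
    have hzero : ExteriorAlgebra.map i ω = 0 := by
      refine eq_zero_of_forall_exteriorAlgebra_hom (fun x : RealPoint O => (evalAt x).toRingHom)
        (fun b hb => eq_zero_of_forall_evalAt x₀ hb) F hF₁ hF₂ fun x => ?_
      obtain ⟨C, hC⟩ := exists_cotangent_coordinates x D
      -- Evaluating the coefficients of `map i ω` at `x` is the same as taking the coordinates `C`
      -- of the value at `x` of the form `Ψ ω`. Both are ring homomorphisms, so functions and exact
      -- forms suffice.
      have hcomp : (F x).comp (ExteriorAlgebra.map i).toRingHom =
          ((ExteriorAlgebra.map C).toRingHom.comp (evalForm x).toRingHom).comp Ψ := by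
        refine exteriorAlgebra_ringHom_ext (fun b => ?_) fun η => ?_
        · change F x (ExteriorAlgebra.map i (algebraMap _ _ b)) =
            ExteriorAlgebra.map C (evalForm x (Ψ (algebraMap _ _ b)))
          rw [hΨ₁, AlgHom.commutes, hF₁]
          exact ((ExteriorAlgebra.map C).commutes (evalAt x b)).symm
        · change F x (ExteriorAlgebra.map i (ExteriorAlgebra.ι _ η)) =
            ExteriorAlgebra.map C (evalForm x (Ψ (ExteriorAlgebra.ι _ η)))
          have hη : η ∈ Submodule.span (ℂ ⊗[ℝ] O) (Set.range (KaehlerDifferential.D ℂ (ℂ ⊗[ℝ] O))) :=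
            KaehlerDifferential.span_range_derivation ℂ (ℂ ⊗[ℝ] O) ▸ Submodule.mem_top
          induction hη using Submodule.span_induction with
          | zero => simp only [map_zero]
          | add η η' _ _ h1 h2 => simp only [map_add, h1, h2]
          | smul b η _ h1 =>
            rw [exteriorAlgebra_ι_smul, map_mul, map_mul, map_mul, map_mul, map_mul, h1,
              AlgHom.commutes, hF₁, hΨ₁]
            congr 1
            exact ((ExteriorAlgebra.map C).commutes (evalAt x b)).symm
          | mem η h =>
            obtain ⟨b, rfl⟩ := h
            rw [hΨ₂, ExteriorAlgebra.map_apply_ι, hF₂]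
            change _ = ExteriorAlgebra.map C (ExteriorAlgebra.ι ℂ (diffAt x b))
            rw [ExteriorAlgebra.map_apply_ι]
            congr 1
            ext l
            exact (hC b l).symm
      have := RingHom.congr_fun hcomp ω
      change F x (ExteriorAlgebra.map i ω) = ExteriorAlgebra.map C (evalForm x (Ψ ω)) at this
      rw [this, hω, map_zero, map_zero]
    rw [← hmap ω, hzero, map_zero]
  exact ⟨RingEquiv.ofBijective Ψ ⟨hinj, hsurj⟩, hΨ₁, hΨ₂⟩

/-- The universal property of the algebra of differential forms. -/
theorem exists_form_algHom (x₀ : RealPoint O) {R : Type*} [Ring R] [Algebra ℂ R]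
    {φ : ℂ ⊗[ℝ] O →ₐ[ℂ] R} {D : ℂ ⊗[ℝ] O →ₗ[ℂ] R} (h : IsFormRelations φ D) :
    ∃ F : Form O →ₐ[ℂ] R, (∀ b, F (functionForm b) = φ b) ∧ ∀ b, F (diffForm b) = D b := by
  obtain ⟨Ψ, hΨ₁, hΨ₂⟩ := exists_ringEquiv_form x₀
  obtain ⟨F, hF₁, hF₂⟩ := exists_exteriorAlgebra_kaehler_hom h
  have h1 : ∀ b, F (Ψ.symm (functionForm b)) = φ b := fun b => by
    rw [← hΨ₁, Ψ.symm_apply_apply, hF₁]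
  refine ⟨AlgHom.mk (F.comp Ψ.symm.toRingHom) fun z => ?_, h1, fun b => ?_⟩
  · have := h1 (algebraMap ℂ _ z)
    rwa [AlgHom.commutes, AlgHom.commutes] at this
  · change F (Ψ.symm (diffForm b)) = _
    rw [← hΨ₂, Ψ.symm_apply_apply, hF₂]

end FormLift

end CocycleCalculus

end

noncomputable section

namespace CocycleCalculus

/-! ### The de Rham differential, the grading and contractions -/

section FormOperations

variable {O : Type*} [CommRing O] [Algebra ℝ O]

theorem diffForm_mul (b c : ℂ ⊗[ℝ] O) : diffForm (b * c) =
    functionForm b * diffForm c + functionForm c * diffForm b :=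
  isFormRelations_form.leibniz b c

theorem diffForm_sq (b : ℂ ⊗[ℝ] O) : diffForm b * diffForm b = 0 :=
  isFormRelations_form.sq b

theorem diffForm_anticomm (b c : ℂ ⊗[ℝ] O) : diffForm b * diffForm c = -(diffForm c * diffForm b) := by
  have := diffForm_sq (b + c)
  rw [map_add, add_mul, mul_add, mul_add, diffForm_sq, diffForm_sq, zero_add, add_zero] at this
  exact eq_neg_of_add_eq_zero_left this

theorem function_mul_prod_mem_forms (b : ℂ ⊗[ℝ] O) (l : List (ℂ ⊗[ℝ] O)) :
    functionForm b * (l.map diffForm).prod ∈ forms O l.length :=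
  Submodule.subset_span ⟨b, l.get, by
    conv_lhs => rw [← List.ofFn_get l, List.map_ofFn]
    rfl⟩

theorem forms_eq_span (k : ℕ) : forms O k = Submodule.span ℂ {ω | ∃ (b : ℂ ⊗[ℝ] O)
    (l : List (ℂ ⊗[ℝ] O)), l.length = k ∧ ω = functionForm b * (l.map diffForm).prod} := by
  refine le_antisymm (Submodule.span_mono ?_) (Submodule.span_le.2 ?_)
  · rintro _ ⟨b, c, rfl⟩
    exact ⟨b, List.ofFn c, by simp, by rw [List.map_ofFn]; rfl⟩
  · rintro _ ⟨b, l, rfl, rfl⟩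
    exact function_mul_prod_mem_forms b l

theorem forms_induction {k : ℕ} {p : Form O → Prop} (h0 : p 0)
    (hadd : ∀ ω η, p ω → p η → p (ω + η)) (hsmul : ∀ (z : ℂ) ω, p ω → p (z • ω))
    (hgen : ∀ (b : ℂ ⊗[ℝ] O) (l : List (ℂ ⊗[ℝ] O)), l.length = k →
      p (functionForm b * (l.map diffForm).prod)) {ω : Form O} (hω : ω ∈ forms O k) : p ω := by
  rw [forms_eq_span] at hω
  induction hω using Submodule.span_induction with
  | mem _ h => obtain ⟨b, l, hl, rfl⟩ := h; exact hgen b l hl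
  | zero => exact h0
  | add x y _ _ hx hy => exact hadd x y hx hy
  | smul z x _ hx => exact hsmul z x hx

theorem forms_zero : forms O 0 = LinearMap.range (functionForm (O := O)).toLinearMap := by
  refine le_antisymm (fun ω hω => ?_) ?_
  · refine forms_induction (zero_mem _) (fun _ _ => add_mem) (fun z _ => Submodule.smul_mem _ z)
      (fun b l hl => ?_) hω
    rw [List.length_eq_zero_iff] at hl
    subst hl
    exact ⟨b, by simp⟩
  · rintro _ ⟨b, rfl⟩
    simpa using function_mul_prod_mem_forms b []

theorem functionForm_mem (b : ℂ ⊗[ℝ] O) : functionForm b ∈ forms O 0 := by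
  rw [forms_zero]; exact ⟨b, rfl⟩

theorem diffForm_mem (b : ℂ ⊗[ℝ] O) : diffForm b ∈ forms O 1 := by
  simpa using function_mul_prod_mem_forms 1 [b]

theorem mul_mem_forms {i j : ℕ} {ω η : Form O} (hω : ω ∈ forms O i) (hη : η ∈ forms O j) :
    ω * η ∈ forms O (i + j) := by
  refine forms_induction (p := fun ω => ω * η ∈ forms O (i + j)) (by simp)
    (fun _ _ h h' => by simpa only [add_mul] using add_mem h h')
    (fun z _ h => by simpa only [smul_mul_assoc] using Submodule.smul_mem _ z h)
    (fun b l hl => ?_) hω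
  refine forms_induction (p := fun η => _ * η ∈ forms O (i + j)) (by simp)
    (fun _ _ h h' => by simpa only [mul_add] using add_mem h h')
    (fun z _ h => by simpa only [mul_smul_comm] using Submodule.smul_mem _ z h)
    (fun c m hm => ?_) hη
  have := function_mul_prod_mem_forms (b * c) (l ++ m)
  rw [List.length_append, hl, hm, List.map_append, List.prod_append, map_mul] at this
  convert this using 1
  rw [mul_assoc, ← mul_assoc (List.prod _), functionForm_mul_comm]
  simp only [mul_assoc]

/-- Splitting off the last exact factor allows statements about `Ω^(k+1)` to be reduced to a product
of `Ω^k` with one exact form. -/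
theorem forms_induction_succ {k : ℕ} {p : Form O → Prop} (h0 : p 0)
    (hadd : ∀ ω η, p ω → p η → p (ω + η)) (hsmul : ∀ (z : ℂ) ω, p ω → p (z • ω))
    (hmul : ∀ ω ∈ forms O k, ∀ b, p (ω * diffForm b)) {ω : Form O} (hω : ω ∈ forms O (k + 1)) :
    p ω := by
  refine forms_induction h0 hadd hsmul (fun b l hl => ?_) hω
  obtain ⟨m, c, rfl⟩ : ∃ m c, l = m ++ [c] :=
    ⟨l.dropLast, l.getLast (List.ne_nil_of_length_eq_add_one hl), (List.dropLast_append_getLast _).symm⟩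
  rw [List.map_append, List.prod_append, List.map_singleton, List.prod_singleton, ← mul_assoc]
  refine hmul _ ?_ c
  have := function_mul_prod_mem_forms b m
  rwa [show m.length = k by simpa using hl] at this

theorem oneForm_induction {p : Form O → Prop} (h0 : p 0)
    (hadd : ∀ ω η, p ω → p η → p (ω + η))
    (hmul : ∀ b c, p (functionForm b * diffForm c)) {ω : Form O} (hω : ω ∈ forms O 1) : p ω := by
  have := forms_induction (p := fun ω => ∀ z : ℂ, p (z • ω)) (by simpa using h0)
    (fun _ _ h h' z => by rw [smul_add]; exact hadd _ _ (h z) (h' z))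
    (fun w _ h z => by rw [smul_smul]; exact h _) (fun b l hl z => ?_) hω 1
  · simpa using this
  · obtain ⟨c, rfl⟩ := List.length_eq_one_iff.1 hl
    simpa using hmul (z • b) c

theorem iSup_forms : ⨆ k, forms O k = ⊤ := by
  rw [eq_top_iff]
  rintro ω -
  induction ω using form_induction with
  | hf b => exact Submodule.mem_iSup_of_mem 0 (functionForm_mem b)
  | hd b => exact Submodule.mem_iSup_of_mem 1 (diffForm_mem b)
  | hadd ω η h1 h2 => exact add_mem h1 h2
  | hmul ω η h1 h2 =>
    induction h1 using Submodule.iSup_induction' with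
    | zero => simp
    | add x y _ _ hx hy => rw [add_mul]; exact add_mem hx hy
    | mem i x hx =>
      induction h2 using Submodule.iSup_induction' with
      | zero => simp
      | add x y _ _ hx hy => rw [mul_add]; exact add_mem hx hy
      | mem j y hy => exact Submodule.mem_iSup_of_mem _ (mul_mem_forms hx hy)

theorem oneForm_anticomm {ω η : Form O} (hω : ω ∈ forms O 1) (hη : η ∈ forms O 1) :
    ω * η = -(η * ω) := by
  refine oneForm_induction (p := fun ω => ω * η = -(η * ω)) (by simp)
    (fun _ _ h h' => by rw [add_mul, mul_add, h, h', neg_add]) (fun b c => ?_) hω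
  refine oneForm_induction (p := fun η => _ * η = -(η * _)) (by simp)
    (fun _ _ h h' => by rw [add_mul, mul_add, h, h', neg_add]) (fun b' c' => ?_) hη
  rw [mul_assoc, ← mul_assoc (diffForm c), functionForm_mul_comm, mul_assoc _ _ (diffForm c'),
    mul_assoc (functionForm b'), ← mul_assoc (diffForm c'), functionForm_mul_comm,
    mul_assoc _ _ (diffForm c), diffForm_anticomm c c', ← mul_assoc, ← mul_assoc,
    ← map_mul functionForm, ← map_mul functionForm, mul_comm b', mul_neg]

variable [IsDomain O] [Algebra.Smooth ℝ O]

/-- The grading of differential forms, as a homomorphism to polynomials over the forms. -/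
theorem exists_grading_hom (x₀ : RealPoint O) : ∃ G : Form O →ₐ[ℂ] Polynomial (Form O),
    ∀ k, ∀ ω ∈ forms O k, G ω = Polynomial.monomial k ω := by
  let φ : ℂ ⊗[ℝ] O →ₐ[ℂ] Polynomial (Form O) := Polynomial.CAlgHom.comp functionForm
  -- Differentials receive the weight of one polynomial variable and functions weight zero. The
  -- relations are homogeneous for these weights, so they persist.
  let D : ℂ ⊗[ℝ] O →ₗ[ℂ] Polynomial (Form O) :=
    (Polynomial.monomial 1).restrictScalars ℂ ∘ₗ diffForm
  have hφ : ∀ b, φ b = Polynomial.monomial 0 (functionForm b) := fun _ => rfl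
  have hD : ∀ b, D b = Polynomial.monomial 1 (diffForm b) := fun _ => rfl
  obtain ⟨G, hG₁, hG₂⟩ := exists_form_algHom x₀ (φ := φ) (D := D)
    ⟨fun b c => by
      simp only [hφ, hD, Polynomial.monomial_mul_monomial, zero_add, ← map_add, diffForm_mul],
    fun b c => by
      simp only [hφ, hD, Polynomial.monomial_mul_monomial, zero_add, add_zero,
        functionForm_mul_comm],
    fun b => by simp only [hD, Polynomial.monomial_mul_monomial, diffForm_sq, map_zero]⟩
  refine ⟨G, fun k ω hω => ?_⟩
  refine forms_induction (p := fun ω => G ω = Polynomial.monomial k ω) (by simp)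
    (fun _ _ h h' => by rw [map_add, h, h', map_add])
    (fun z _ h => by rw [map_smul, h, Polynomial.smul_monomial]) (fun b l hl => ?_) hω
  subst hl
  rw [map_mul, hG₁, hφ]
  have : ∀ l : List (ℂ ⊗[ℝ] O), G (l.map diffForm).prod =
      Polynomial.monomial l.length (l.map diffForm).prod := by
    intro l
    induction l with
    | nil => simp
    | cons c l ih =>
      rw [List.map_cons, List.prod_cons, map_mul, ih, hG₂, hD, Polynomial.monomial_mul_monomial,
        List.length_cons, add_comm]
  rw [this, Polynomial.monomial_mul_monomial, zero_add]

/-- The homomorphism to polynomials reads off the component of degree `k` as the coefficient of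
degree `k`; hence the components of a form are unique. -/
theorem isInternal_forms (x₀ : RealPoint O) : DirectSum.IsInternal (forms O) := by
  obtain ⟨G, hG⟩ := exists_grading_hom x₀
  have hcoeff : ∀ (x : DirectSum ℕ fun k => forms O k) (k : ℕ),
      (G (DirectSum.coeAddMonoidHom (forms O) x)).coeff k = x k := by
    intro x k
    induction x using DirectSum.induction_on with
    | zero => simp
    | add x y hx hy => simp only [map_add, Polynomial.coeff_add, hx, hy, DirectSum.add_apply,
        Submodule.coe_add]
    | of i ω =>
      rw [DirectSum.coeAddMonoidHom_of, hG i ω ω.2, Polynomial.coeff_monomial]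
      split_ifs with h
      · subst h; rw [DirectSum.of_eq_same]
      · rw [DirectSum.of_eq_of_ne _ _ _ (Ne.symm h)]; rfl
  constructor
  · rw [injective_iff_map_eq_zero]
    intro x hx
    ext k
    rw [← hcoeff, hx]
    simp
  · intro ω
    have hω : ω ∈ ⨆ k, forms O k := by rw [iSup_forms]; trivial
    induction hω using Submodule.iSup_induction' with
    | mem i x hx => exact ⟨DirectSum.of _ i ⟨x, hx⟩, DirectSum.coeAddMonoidHom_of _ _ _⟩
    | zero => exact ⟨0, map_zero _⟩
    | add x y _ _ hx hy =>
      obtain ⟨x, rfl⟩ := hx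
      obtain ⟨y, rfl⟩ := hy
      exact ⟨x + y, map_add _ _ _⟩

/-- The grading involution. -/
theorem exists_grading_involution (x₀ : RealPoint O) : ∃ σ : Form O →ₐ[ℂ] Form O,
    (∀ b, σ (functionForm b) = functionForm b) ∧ (∀ b, σ (diffForm b) = -diffForm b) ∧
    ∀ k, ∀ ω ∈ forms O k, σ ω = (-1 : ℂ) ^ k • ω := by
  obtain ⟨σ, h₁, h₂⟩ := exists_form_algHom x₀ (φ := functionForm (O := O)) (D := -diffForm)
    ⟨fun b c => by simp only [LinearMap.neg_apply, diffForm_mul, mul_neg]; abel,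
    fun b c => functionForm_mul_comm _ _,
    fun b => by simp only [LinearMap.neg_apply, neg_mul_neg, diffForm_sq]⟩
  refine ⟨σ, h₁, h₂, fun k ω hω => ?_⟩
  refine forms_induction (p := fun ω => σ ω = (-1 : ℂ) ^ k • ω) (by simp)
    (fun _ _ h h' => by rw [map_add, h, h', smul_add])
    (fun z _ h => by rw [map_smul, h, smul_comm]) (fun b l hl => ?_) hω
  subst hl
  rw [map_mul, h₁, ← mul_smul_comm]
  congr 1
  clear hω
  induction l with
  | nil => simp
  | cons c l ih =>
    rw [List.map_cons, List.prod_cons, map_mul, ih, h₂, List.length_cons, pow_succ,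
      LinearMap.neg_apply, mul_neg_one, neg_smul, mul_smul_comm, neg_mul, smul_neg]

/-- Odd derivations of the algebra of forms are determined by, and can be prescribed on, functions
and their differentials. -/
theorem exists_odd_derivation (x₀ : RealPoint O) (p q : ℂ ⊗[ℝ] O →ₗ[ℂ] Form O)
    (hp : ∀ b c, p (b * c) = functionForm b * p c + p b * functionForm c)
    (hq : ∀ b c, q (b * c) =
      functionForm b * q c + p b * diffForm c + (functionForm c * q b + p c * diffForm b))
    (hpd : ∀ b c, p b * diffForm c = -(diffForm c * p b))
    (hqd : ∀ b, q b * diffForm b = diffForm b * q b) :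
    ∃ T : Form O →ₗ[ℂ] Form O, (∀ b, T (functionForm b) = p b) ∧ (∀ b, T (diffForm b) = q b) ∧
      ∀ k, ∀ ω ∈ forms O k, ∀ η, T (ω * η) = T ω * η + (-1 : ℂ) ^ k • (ω * T η) := by
  obtain ⟨σ, hσ₁, hσ₂, hσ⟩ := exists_grading_involution x₀
  have hp1 : p 1 = 0 := by
    have := hp 1 1
    simpa using this
  -- For upper triangular matrices with diagonal entries `σ ω`, `ω` and corner `T ω`, where `σ` is
  -- the grading involution, multiplicativity of the corner is the graded Leibniz rule. So an odd
  -- derivation is the corner of an algebra homomorphism, and the hypotheses on `p` and `q` are the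
  -- relations for the matrices.
  let φ : ℂ ⊗[ℝ] O →ₐ[ℂ] Matrix (Fin 2) (Fin 2) (Form O) := AlgHom.ofLinearMap
    { toFun := fun b => !![functionForm b, p b; 0, functionForm b]
      map_add' := fun b c => by simp
      map_smul' := fun z b => by simp }
    (by simp [hp1, Matrix.one_fin_two]) (fun b c => by simp [hp])
  let D : ℂ ⊗[ℝ] O →ₗ[ℂ] Matrix (Fin 2) (Fin 2) (Form O) :=
    { toFun := fun b => !![-diffForm b, q b; 0, diffForm b]
      map_add' := fun b c => by simp [add_comm]
      map_smul' := fun z b => by simp }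
  have hφ : ∀ b, φ b = !![functionForm b, p b; 0, functionForm b] := fun _ => rfl
  have hD : ∀ b, D b = !![-diffForm b, q b; 0, diffForm b] := fun _ => rfl
  obtain ⟨F, hF₁, hF₂⟩ := exists_form_algHom x₀ (φ := φ) (D := D)
    ⟨fun b c => by
      simp [hφ, hD, hq, diffForm_mul, add_comm],
    fun b c => by
      simp [hφ, hD, hpd, functionForm_mul_comm, add_comm],
    fun b => by
      ext i j
      fin_cases i <;> fin_cases j <;> simp [hD, hqd, diffForm_sq]⟩
  have hF : ∀ ω, F ω 0 0 = σ ω ∧ F ω 1 0 = 0 ∧ F ω 1 1 = ω := by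
    intro ω
    induction ω using form_induction with
    | hf b => simp [hF₁, hφ, hσ₁]
    | hd b => simp [hF₂, hD, hσ₂]
    | hadd ω η h1 h2 => simp [h1, h2]
    | hmul ω η h1 h2 => simp [Matrix.mul_apply, Fin.sum_univ_two, h1, h2]
  refine ⟨{ toFun := fun ω => F ω 0 1, map_add' := fun _ _ => by simp,
            map_smul' := fun _ _ => by simp }, fun b => by simp [hF₁, hφ], fun b => by
              simp [hF₂, hD], fun k ω hω η => ?_⟩
  have : F (ω * η) 0 1 = F ω 0 0 * F η 0 1 + F ω 0 1 * F η 1 1 := by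
    simp [Matrix.mul_apply, Fin.sum_univ_two]
  change F (ω * η) 0 1 = F ω 0 1 * η + _ • (ω * F η 0 1)
  rw [this, (hF ω).1, (hF η).2.2, hσ k ω hω, smul_mul_assoc, add_comm]

/-- The de Rham differential. -/
theorem exists_deRham_differential (x₀ : RealPoint O) : ∃ d : Form O →ₗ[ℂ] Form O,
    (∀ b, d (functionForm b) = diffForm b) ∧ (∀ b, d (diffForm b) = 0) ∧
    ∀ k, ∀ ω ∈ forms O k, ∀ η, d (ω * η) = d ω * η + (-1 : ℂ) ^ k • (ω * d η) :=
  exists_odd_derivation x₀ diffForm 0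
    (fun b c => by rw [diffForm_mul, functionForm_mul_comm])
    (fun b c => by simp [diffForm_anticomm b c]) diffForm_anticomm (by simp)

/-- The contraction with a vector field. -/
theorem exists_contraction (x₀ : RealPoint O) (D : Derivation ℂ (ℂ ⊗[ℝ] O) (ℂ ⊗[ℝ] O)) :
    ∃ T : Form O →ₗ[ℂ] Form O, (∀ b, T (functionForm b) = 0) ∧
    (∀ b, T (diffForm b) = functionForm (D b)) ∧
    ∀ k, ∀ ω ∈ forms O k, ∀ η, T (ω * η) = T ω * η + (-1 : ℂ) ^ k • (ω * T η) :=
  exists_odd_derivation x₀ 0 (functionForm.toLinearMap ∘ₗ D.toLinearMap) (by simp)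
    (fun b c => by simp) (by simp) (fun b => (functionForm_mul_comm _ _).symm)

/-- This is density again: the value at `x` of a function, viewed in the exterior algebra there,
determines the scalar. -/
theorem functionForm_injective (x₀ : RealPoint O) :
    Function.Injective (functionForm (O := O)) := by
  rw [injective_iff_map_eq_zero]
  intro b hb
  refine eq_zero_of_forall_evalAt x₀ fun x => ?_
  have h1 : evalForm x (functionForm b) = 0 := by rw [hb, map_zero]
  change algebraMap ℂ (ExteriorAlgebra ℂ (Cotangent x)) (evalAt x b) = 0 at h1
  exact (map_eq_zero_iff _ (ExteriorAlgebra.algebraMap_leftInverse (R := ℂ) _).injective).1 h1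

/-- A dual basis of the one-forms, together with the contractions that compute it. -/
theorem exists_oneForm_dual_basis (x₀ : RealPoint O) :
    ∃ (n : ℕ) (y : Fin n → ℂ ⊗[ℝ] O) (f : Fin n → forms O 1 →ₗ[ℂ] ℂ ⊗[ℝ] O)
      (T : Fin n → Form O →ₗ[ℂ] Form O),
      (∀ l (b : ℂ ⊗[ℝ] O) (ω η : forms O 1), (η : Form O) = functionForm b * ω →
        f l η = b * f l ω) ∧
      (∀ ω : forms O 1, (ω : Form O) = ∑ l, functionForm (f l ω) * diffForm (y l)) ∧
      ∀ l (ω η : forms O 1), T l (ω * η) =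
        functionForm (f l ω) * η - functionForm (f l η) * ω := by
  obtain ⟨n, y, i, hi⟩ := exists_kaehler_dual_basis ℂ (ℂ ⊗[ℝ] O)
  let D : Fin n → Derivation ℂ (ℂ ⊗[ℝ] O) (ℂ ⊗[ℝ] O) := fun l =>
      ((LinearMap.proj l).comp i).compDer (KaehlerDifferential.D ℂ _)
  choose T hT₁ hT₂ hT using fun l => exists_contraction x₀ (D l)
  have hfun : ∀ l b ω, T l (functionForm b * ω) = functionForm b * T l ω := fun l b ω => by
    rw [hT l 0 _ (functionForm_mem b), hT₁, zero_mul, zero_add, pow_zero, one_smul]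
  have hmem : ∀ l, ∀ ω : forms O 1, T l ω ∈ LinearMap.range (functionForm (O := O)).toLinearMap := by
    intro l ω
    refine oneForm_induction (p := fun ω => T l ω ∈ LinearMap.range
      (functionForm (O := O)).toLinearMap) (by rw [map_zero]; exact zero_mem _)
      (fun _ _ h h' => by rw [map_add]; exact add_mem h h') (fun b c => ?_) ω.2
    exact ⟨b * D l c, by rw [hfun, hT₂]; exact map_mul functionForm b (D l c)⟩
  -- The contraction of a one-form is a function of degree zero, and functions embed in the forms;
  -- so the contraction can be read back as an element of `ℂ ⊗ O`.
  let f : Fin n → forms O 1 →ₗ[ℂ] ℂ ⊗[ℝ] O := fun l =>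
    (LinearEquiv.ofInjective (functionForm (O := O)).toLinearMap
      (functionForm_injective x₀)).symm.toLinearMap ∘ₗ
      (T l ∘ₗ (forms O 1).subtype).codRestrict _ (hmem l)
  have hf : ∀ l ω, functionForm (f l ω) = T l ω := fun l ω =>
    congrArg Subtype.val (LinearEquiv.apply_symm_apply
      (LinearEquiv.ofInjective (functionForm (O := O)).toLinearMap (functionForm_injective x₀))
      ((T l ∘ₗ (forms O 1).subtype).codRestrict _ (hmem l) ω))
  refine ⟨n, y, f, T, fun l b ω η h => ?_, fun ω => ?_, fun l ω η => ?_⟩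
  · apply functionForm_injective x₀
    rw [hf, h, hfun, map_mul, hf]
  · simp only [hf]
    refine oneForm_induction (p := fun ω => ω = ∑ l, T l ω * diffForm (y l)) (by simp)
      (fun _ _ h h' => by
        simp only [map_add, add_mul, Finset.sum_add_distrib]; rw [← h, ← h'])
      (fun b c => ?_) ω.2
    simp only [hfun, hT₂, mul_assoc, ← Finset.mul_sum]
    congr 1
    -- The expansion of an exact form in the dual basis is transported from the Kähler
    -- differentials.
    obtain ⟨Ψ, hΨ₁, hΨ₂⟩ := exists_ringEquiv_form x₀
    have := congrArg (fun ω => Ψ (ExteriorAlgebra.ι _ ω)) (hi (KaehlerDifferential.D ℂ _ c))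
    simp only [hΨ₂, map_sum, exteriorAlgebra_ι_smul, map_mul, hΨ₁] at this
    exact this
  · rw [hT l 1 _ ω.2, pow_one, neg_smul, one_smul, ← sub_eq_add_neg, hf, hf]
    congr 1
    rw [← hf, functionForm_mul_comm]

end FormOperations

end CocycleCalculus

end

noncomputable section

namespace CocycleCalculus

/-! ### The classical calculus -/

section Antipode

variable {A : Type*} [CommRing A] [HopfAlgebra ℂ A]

/-- Commutativity makes `S` an algebra homomorphism. Applied to `S * id = 1` it shows that `S ∘ S`
is a left convolution inverse of `S`; since `id` is a right inverse, the two agree. -/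
theorem antipode_antipode (a : A) : HopfAlgebra.antipode ℂ (HopfAlgebra.antipode ℂ a) = a := by
  have h1 : WithConv.toConv (HopfAlgebra.antipode ℂ ∘ₗ HopfAlgebra.antipode ℂ (A := A)) *
      WithConv.toConv (HopfAlgebra.antipode ℂ (A := A)) = 1 := by
    have := LinearMap.algHom_comp_convMul_distrib (HopfAlgebra.antipodeAlgHom ℂ A)
      (WithConv.toConv (HopfAlgebra.antipode ℂ (A := A))) (WithConv.toConv LinearMap.id)
    rw [LinearMap.antipode_mul_id] at this
    refine WithConv.ofConv_injective (this.symm.trans ?_)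
    ext a
    exact (HopfAlgebra.antipodeAlgHom ℂ A).commutes _
  have h2 := left_inv_eq_right_inv h1 LinearMap.antipode_mul_id
  exact LinearMap.congr_fun (congrArg WithConv.ofConv h2) a

theorem antipode_bijective : Function.Bijective (HopfAlgebra.antipode ℂ (A := A)) :=
  Function.Involutive.bijective antipode_antipode

theorem map₂_mul_eq {R S : Type*} [Ring R] [Algebra ℂ R] [Ring S] [Algebra ℂ S] (x y : R ⊗[ℂ] S) :
    TensorProduct.map₂ (LinearMap.mul ℂ R) (LinearMap.mul ℂ S) x y = x * y := by
  induction x with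
  | zero => simp
  | add x x' hx hx' => rw [map_add, LinearMap.add_apply, hx, hx', add_mul]
  | tmul a b =>
    induction y with
    | zero => simp
    | add y y' hy hy' => rw [map_add, hy, hy', mul_add]
    | tmul c d => simp

theorem isHopfAlgebra_mul : IsHopfAlgebra (LinearMap.mul ℂ A) 1 where
  algebra := ⟨mul_assoc, one_mul, mul_one⟩
  comul_one := Bialgebra.comul_one
  comul_mul a b := (Bialgebra.comul_mul a b).trans (map₂_mul_eq _ _).symm
  counit_one := Bialgebra.counit_one
  counit_mul := Bialgebra.counit_mul
  exists_antipode := ⟨HopfAlgebra.antipode ℂ, antipode_bijective,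
    fun a => by
      rw [← Algebra.algebraMap_eq_smul_one]
      exact HopfAlgebra.mul_antipode_rTensor_comul_apply a,
    fun a => by
      rw [← Algebra.algebraMap_eq_smul_one]
      exact HopfAlgebra.mul_antipode_lTensor_comul_apply a⟩

end Antipode

/-! ### The coaction on forms and the axioms of the classical calculus -/

section FormCoaction

/-- Because `A` is commutative, the relations between functions and differentials pass to `A ⊗ E`. A
square of a general tensor is not a sum of squares, so anticommutation is proved first and then
specialized. This is the input for the coaction on forms. -/
theorem IsFormRelations.lTensor {A B C E : Type*} [CommRing A] [Algebra ℂ A] [CommRing B]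
    [Algebra ℂ B] [CommRing C] [Algebra ℂ C] [Ring E] [Algebra ℂ E] {f : B →ₐ[ℂ] E}
    {D : B →ₗ[ℂ] E} (h : IsFormRelations f D) (φ : C →ₐ[ℂ] A ⊗[ℂ] B) :
    IsFormRelations ((Algebra.TensorProduct.map (AlgHom.id ℂ A) f).comp φ)
      (D.lTensor A ∘ₗ φ.toLinearMap) := by
  have hmul : ∀ x y : A ⊗[ℂ] B, D.lTensor A (x * y) =
      Algebra.TensorProduct.map (AlgHom.id ℂ A) f x * D.lTensor A y +
      Algebra.TensorProduct.map (AlgHom.id ℂ A) f y * D.lTensor A x := by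
    intro x y
    induction x with
    | zero => simp
    | add x x' hx hx' => simp only [add_mul, mul_add, map_add, hx, hx']; abel
    | tmul a b =>
      induction y with
      | zero => simp
      | add y y' hy hy' => simp only [add_mul, mul_add, map_add, hy, hy']; abel
      | tmul a' b' => simp [h.leibniz, TensorProduct.tmul_add, mul_comm a']
  have hcomm : ∀ x y : A ⊗[ℂ] B,
      D.lTensor A y * Algebra.TensorProduct.map (AlgHom.id ℂ A) f x =
      Algebra.TensorProduct.map (AlgHom.id ℂ A) f x * D.lTensor A y := by
    intro x y
    induction x with
    | zero => simp
    | add x x' hx hx' => simp only [add_mul, mul_add, map_add, hx, hx']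
    | tmul a b =>
      induction y with
      | zero => simp
      | add y y' hy hy' => simp only [add_mul, mul_add, map_add, hy, hy']
      | tmul a' b' => simp [h.comm, mul_comm a']
  have hDD : ∀ b c, D b * D c = -(D c * D b) := by
    intro b c
    have := h.sq (b + c)
    rw [map_add, add_mul, mul_add, mul_add, h.sq, h.sq, zero_add, add_zero] at this
    exact eq_neg_of_add_eq_zero_left this
  have hanti : ∀ x y : A ⊗[ℂ] B,
      D.lTensor A x * D.lTensor A y = -(D.lTensor A y * D.lTensor A x) := by
    intro x y
    induction x with
    | zero => simp
    | add x x' hx hx' => simp only [add_mul, mul_add, map_add, hx, hx', neg_add]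
    | tmul a b =>
      induction y with
      | zero => simp
      | add y y' hy hy' => simp only [add_mul, mul_add, map_add, hy, hy', neg_add]
      | tmul a' b' =>
        simp [hDD b b', mul_comm a', TensorProduct.tmul_neg]
  refine ⟨fun b c => ?_, fun b c => hcomm _ _, fun b => ?_⟩
  · change D.lTensor A (φ (b * c)) = _
    rw [map_mul, hmul]
    rfl
  · have h1 := hanti (φ b) (φ b)
    have h2 : (2 : ℂ) • (D.lTensor A (φ b) * D.lTensor A (φ b)) = 0 := by
      rw [two_smul]; nth_rewrite 1 [h1]; exact neg_add_cancel _
    exact (smul_eq_zero.1 h2).resolve_left two_ne_zero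

section Naturality

variable {A M N : Type*} [AddCommGroup A] [Module ℂ A] [Coalgebra ℂ A] [AddCommGroup M]
  [Module ℂ M] [AddCommGroup N] [Module ℂ N]

theorem assoc_comul_lTensor (g : M →ₗ[ℂ] N) (x : A ⊗[ℂ] M) :
    TensorProduct.assoc ℂ A A N ((Coalgebra.comul (R := ℂ)).rTensor N (g.lTensor A x)) =
      (g.lTensor A).lTensor A
        (TensorProduct.assoc ℂ A A M ((Coalgebra.comul (R := ℂ)).rTensor M x)) := by
  induction x with
  | zero => simp
  | add x y hx hy => simp only [map_add, hx, hy]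
  | tmul a c =>
    simp only [LinearMap.lTensor_tmul, LinearMap.rTensor_tmul]
    induction Coalgebra.comul (R := ℂ) a with
    | zero => simp
    | add x y hx hy => simp only [map_add, TensorProduct.add_tmul, hx, hy]
    | tmul a₁ a₂ => simp

theorem lid_counit_lTensor (g : M →ₗ[ℂ] N) (x : A ⊗[ℂ] M) :
    TensorProduct.lid ℂ N ((Coalgebra.counit (R := ℂ)).rTensor N (g.lTensor A x)) =
      g (TensorProduct.lid ℂ M ((Coalgebra.counit (R := ℂ)).rTensor M x)) := by
  induction x with
  | zero => simp
  | add x y hx hy => simp only [map_add, hx, hy]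
  | tmul a c => simp

theorem lTensor_lTensor_of_colinear {δM : M →ₗ[ℂ] A ⊗[ℂ] M} {δN : N →ₗ[ℂ] A ⊗[ℂ] N}
    {g : M →ₗ[ℂ] N} (hg : ∀ m, δN (g m) = g.lTensor A (δM m)) (x : A ⊗[ℂ] M) :
    δN.lTensor A (g.lTensor A x) = (g.lTensor A).lTensor A (δM.lTensor A x) := by
  induction x with
  | zero => simp
  | add x y hx hy => simp only [map_add, hx, hy]
  | tmul a c => simp [hg]

end Naturality

variable {A O : Type*} [CommRing A] [HopfAlgebra ℂ A] [CommRing O] [Algebra ℝ O]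
  [IsDomain O] [Algebra.Smooth ℝ O]

theorem exists_form_coaction (x₀ : RealPoint O) (ρ : ℂ ⊗[ℝ] O →ₐ[ℂ] A ⊗[ℂ] (ℂ ⊗[ℝ] O)) :
    ∃ δ : Form O →ₐ[ℂ] A ⊗[ℂ] Form O,
      (∀ b, δ (functionForm b) = (functionForm (O := O)).toLinearMap.lTensor A (ρ b)) ∧
      ∀ b, δ (diffForm b) = (diffForm (O := O)).lTensor A (ρ b) :=
  exists_form_algHom x₀ (isFormRelations_form.lTensor ρ)

/-- The operations of the classical calculus for an arbitrary coaction on regular functions. -/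
@[reducible] def classicalData (ρ : ℂ ⊗[ℝ] O →ₗ[ℂ] A ⊗[ℂ] (ℂ ⊗[ℝ] O)) (d : Form O →ₗ[ℂ] Form O)
    (δ : Form O →ₗ[ℂ] A ⊗[ℂ] Form O) : CalculusData A (ℂ ⊗[ℝ] O) (Form O) where
  mulA := LinearMap.mul ℂ _
  oneA := 1
  mulB := LinearMap.mul ℂ _
  oneB := 1
  coactB := ρ
  wedge := LinearMap.mul ℂ _
  ι := functionForm.toLinearMap
  Ω := forms O
  d := d
  coact := δ

-- Counitality and coassociativity are equalities of algebra homomorphisms out of the forms, so it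
-- suffices to check functions and exact forms, where they are inherited from `ρ`. The axioms that
-- involve `d` are checked on the spanning products.
set_option maxHeartbeats 1000000 in
theorem exists_classicalData_isCovariantCalculus (x₀ : RealPoint O)
    (ρ : ℂ ⊗[ℝ] O →ₐ[ℂ] A ⊗[ℂ] (ℂ ⊗[ℝ] O)) (hρ : IsComodule ρ.toLinearMap) :
    ∃ (d : Form O →ₗ[ℂ] Form O) (δ : Form O →ₗ[ℂ] A ⊗[ℂ] Form O),
      (∀ b (l : List (ℂ ⊗[ℝ] O)), d (functionForm b * (l.map diffForm).prod) =
        diffForm b * (l.map diffForm).prod) ∧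
      (∀ ω η, δ (ω * η) = δ ω * δ η) ∧
      (∀ b, δ (functionForm b) = (functionForm (O := O)).toLinearMap.lTensor A (ρ b)) ∧
      (∀ b, δ (diffForm b) = (diffForm (O := O)).lTensor A (ρ b)) ∧
      (classicalData ρ.toLinearMap d δ).IsCovariantCalculus := by
  have hρ₁ : ρ 1 = 1 := ρ.map_one'
  obtain ⟨d, hd₁, hd₂, hd⟩ := exists_deRham_differential x₀
  obtain ⟨δ, hδ₁, hδ₂⟩ := exists_form_coaction x₀ ρ
  have hcounit : ∀ ω, TensorProduct.lid ℂ _ ((Coalgebra.counit (R := ℂ)).rTensor (Form O) (δ ω)) =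
      ω := by
    let F : Form O →ₐ[ℂ] Form O := (Algebra.TensorProduct.lid ℂ _).toAlgHom.comp
      ((Algebra.TensorProduct.map (Bialgebra.counitAlgHom ℂ A) (AlgHom.id ℂ _)).comp δ)
    have hnat : ∀ (g : ℂ ⊗[ℝ] O →ₗ[ℂ] Form O) b, TensorProduct.lid ℂ _
        ((Coalgebra.counit (R := ℂ)).rTensor (Form O) (g.lTensor A (ρ b))) = g b := by
      intro g b
      exact (lid_counit_lTensor g (ρ b)).trans (congrArg g (hρ.counit b))
    have hF : F = AlgHom.id ℂ _ := by
      refine form_algHom_ext (fun b => ?_) (fun b => ?_)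
      · refine Eq.trans ?_ (hnat functionForm.toLinearMap b)
        rw [← hδ₁]
        rfl
      · refine Eq.trans ?_ (hnat diffForm b)
        rw [← hδ₂]
        rfl
    exact fun ω => AlgHom.congr_fun hF ω
  have hcoassoc : ∀ ω, TensorProduct.assoc ℂ _ _ _
      ((Coalgebra.comul (R := ℂ)).rTensor (Form O) (δ ω)) =
      δ.toLinearMap.lTensor A (δ ω) := by
    let F : Form O →ₐ[ℂ] _ := (Algebra.TensorProduct.assoc ℂ ℂ ℂ A A
      (Form O)).toAlgHom.comp ((Algebra.TensorProduct.map (Bialgebra.comulAlgHom ℂ A)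
        (AlgHom.id ℂ _)).comp δ)
    let G : Form O →ₐ[ℂ] _ := (Algebra.TensorProduct.map (AlgHom.id ℂ A) δ).comp δ
    have hnat : ∀ (g : ℂ ⊗[ℝ] O →ₗ[ℂ] Form O)
        (hg : ∀ b, δ (g b) = g.lTensor A (ρ.toLinearMap b)) b, F (g b) = G (g b) := by
      intro g hg b
      change TensorProduct.assoc ℂ _ _ _
        ((Coalgebra.comul (R := ℂ)).rTensor (Form O) (δ (g b))) =
        δ.toLinearMap.lTensor A (δ (g b))
      rw [hg]
      rw [assoc_comul_lTensor, lTensor_lTensor_of_colinear (δM := ρ.toLinearMap) hg]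
      exact congrArg _ (hρ.coassoc b)
    have hFG : F = G := form_algHom_ext (hnat functionForm.toLinearMap hδ₁) (hnat diffForm hδ₂)
    exact fun ω => AlgHom.congr_fun hFG ω
  -- Products of exact forms are closed. The empty product requires that the differential of `1`
  -- vanish, which follows from the Leibniz rule.
  have hdprod : ∀ l : List (ℂ ⊗[ℝ] O), d (l.map diffForm).prod = 0 := by
    intro l
    induction l with
    | nil =>
      have := hd₁ 1
      simp only [map_one] at this
      have h1 := diffForm_mul (1 : ℂ ⊗[ℝ] O) 1
      simp only [mul_one, map_one, one_mul, left_eq_add] at h1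
      simpa [h1] using this
    | cons c l ih => rw [List.map_cons, List.prod_cons, hd 1 _ (diffForm_mem c), hd₂, ih]; simp
  have hdapp : ∀ b (l : List (ℂ ⊗[ℝ] O)), d (functionForm b * (l.map diffForm).prod) =
      diffForm b * (l.map diffForm).prod := fun b l => by
    rw [hd 0 _ (functionForm_mem b), hd₁, hdprod]; simp
  have hsup : ∀ {p : Form O → Prop}, p 0 → (∀ ω η, p ω → p η → p (ω + η)) →
      (∀ (z : ℂ) ω, p ω → p (z • ω)) → (∀ (b : ℂ ⊗[ℝ] O) (l : List (ℂ ⊗[ℝ] O)),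
      p (functionForm b * (l.map diffForm).prod)) → ∀ ω, p ω := by
    intro p h0 hadd hsmul hgen ω
    have hω : ω ∈ ⨆ k, forms O k := by rw [iSup_forms]; trivial
    induction hω using Submodule.iSup_induction' with
    | mem i x hx => exact forms_induction h0 hadd hsmul (fun b l _ => hgen b l) hx
    | zero => exact h0
    | add x y _ _ hx hy => exact hadd x y hx hy
  have hδmem : ∀ (k : ℕ), ∀ ω ∈ forms O k, δ ω ∈
      LinearMap.range ((forms O k).subtype.lTensor A) := by
    have hfun : ∀ (g : ℂ ⊗[ℝ] O →ₗ[ℂ] Form O) (i : ℕ) (hg : ∀ b, g b ∈ forms O i) x,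
        g.lTensor A x ∈
          LinearMap.range ((forms O i).subtype.lTensor A) := by
      intro g i hg x
      refine ⟨(g.codRestrict _ hg).lTensor _ x, ?_⟩
      rw [← LinearMap.comp_apply, ← LinearMap.lTensor_comp]
      rfl
    have hmul : ∀ (i j : ℕ) x y, x ∈ LinearMap.range ((forms O i).subtype.lTensor A) →
        y ∈ LinearMap.range ((forms O j).subtype.lTensor A) →
        x * y ∈ LinearMap.range ((forms O (i + j)).subtype.lTensor A) := by
      rintro i j _ _ ⟨x, rfl⟩ ⟨y, rfl⟩
      induction x with
      | zero => rw [map_zero, zero_mul]; exact zero_mem _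
      | add x x' hx hx' => rw [map_add, add_mul]; exact add_mem hx hx'
      | tmul a ω =>
        induction y with
        | zero => rw [map_zero, mul_zero]; exact zero_mem _
        | add y y' hy hy' => rw [map_add, mul_add]; exact add_mem hy hy'
        | tmul a' η =>
          exact ⟨(a * a') ⊗ₜ ⟨ω * η, mul_mem_forms ω.2 η.2⟩, by simp⟩
    intro k ω hω
    refine forms_induction (p := fun ω => δ ω ∈ _) (by rw [map_zero]; exact zero_mem _)
      (fun _ _ h h' => by rw [map_add]; exact add_mem h h')
      (fun z _ h => by rw [map_smul]; exact Submodule.smul_mem _ z h) (fun b l hl => ?_) hω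
    subst hl
    clear hω
    induction l using List.reverseRecOn with
    | nil =>
      rw [List.map_nil, List.prod_nil, mul_one, hδ₁]
      exact hfun _ 0 functionForm_mem _
    | append_singleton l c ih =>
      rw [List.map_append, List.prod_append, ← mul_assoc, map_mul, List.length_append]
      refine hmul _ _ _ _ (ih) ?_
      rw [List.map_singleton, List.prod_singleton, hδ₂]
      exact hfun _ 1 diffForm_mem _
  have hδd : ∀ ω, δ (d ω) = d.lTensor A (δ ω) := by
    have hδprod : ∀ (l : List (ℂ ⊗[ℝ] O)) x,
        d.lTensor A ((Algebra.TensorProduct.map (AlgHom.id ℂ A) (functionForm (O := O))) x * δ (l.map diffForm).prod) =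
        (diffForm (O := O)).lTensor A x * δ (l.map diffForm).prod := by
      intro l
      -- The coaction of a product of exact forms again involves only products of exact forms in the
      -- second factor. These are closed, so `d` only differentiates the function in front.
      have hl : δ (l.map diffForm).prod ∈ Submodule.span ℂ
          {z | ∃ (a : A) (m : List (ℂ ⊗[ℝ] O)), z = a ⊗ₜ (m.map diffForm).prod} := by
        induction l with
        | nil => exact Submodule.subset_span ⟨1, [], by simp; rfl⟩
        | cons c l ih =>
          rw [List.map_cons, List.prod_cons, map_mul, hδ₂]
          generalize ρ c = x
          generalize δ (l.map diffForm).prod = w at ih ⊢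
          induction x with
          | zero => simp
          | add x y hx hy => rw [map_add, add_mul]; exact add_mem hx hy
          | tmul a' c' =>
            induction ih using Submodule.span_induction with
            | zero => simp
            | add x y _ _ hx hy => rw [mul_add]; exact add_mem hx hy
            | smul z x _ hx => rw [mul_smul_comm]; exact Submodule.smul_mem _ z hx
            | mem _ h =>
              obtain ⟨a, m, rfl⟩ := h
              exact Submodule.subset_span ⟨a' * a, c' :: m, by simp⟩
      intro x
      generalize δ (l.map diffForm).prod = w at hl ⊢
      induction hl using Submodule.span_induction with
      | zero => simp
      | add y y' _ _ hy hy' => rw [mul_add, mul_add, map_add, hy, hy']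
      | smul z y _ hy => rw [mul_smul_comm, mul_smul_comm, map_smul, hy]
      | mem _ h =>
        obtain ⟨a, m, rfl⟩ := h
        induction x with
        | zero => simp
        | add x y hx hy => simp only [map_add, add_mul, hx, hy]
        | tmul a' c' => simp [hdapp]
    refine hsup (by simp) (fun _ _ h h' => by simp only [map_add, h, h'])
      (fun z _ h => by simp only [map_smul, h]) fun b l => ?_
    rw [hdapp, map_mul, map_mul, hδ₁, hδ₂]
    exact (hδprod l (ρ.toLinearMap b)).symm
  refine ⟨d, δ.toLinearMap, hdapp, fun ω η => map_mul δ ω η, hδ₁, hδ₂, ?_⟩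
  refine
    { hopf := isHopfAlgebra_mul
      base := ⟨⟨mul_assoc, one_mul, mul_one⟩, hρ, hρ₁,
        fun x y => (map_mul ρ x y).trans (map₂_mul_eq _ _).symm⟩
      total := ⟨⟨mul_assoc, fun x => ?_, fun x => ?_⟩, ⟨hcoassoc, hcounit⟩, ?_, fun x y => ?_⟩
      ι_injective := functionForm_injective x₀
      ι_mul := fun b c => map_mul functionForm b c
      range_ι := forms_zero.symm
      isInternal := isInternal_forms x₀
      wedge_mem := mul_mem_forms
      d_mem := fun {i ω} hω => ?_
      d_d := ?_
      leibniz := fun {i ω} hω η => hd i ω hω η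
      generated := fun W hι hdι hmul => ?_
      coact_ι := hδ₁
      coact_mem := fun k ω => hδmem k ω ω.2
      coact_d := hδd }
  · change functionForm 1 * x = x
    rw [map_one, one_mul]
  · change x * functionForm 1 = x
    rw [map_one, mul_one]
  · change δ (functionForm 1) = 1 ⊗ₜ functionForm 1
    rw [map_one, map_one]
    rfl
  · exact (map_mul δ x y).trans (map₂_mul_eq _ _).symm
  · refine forms_induction (p := fun ω => d ω ∈ forms O (i + 1))
      (by rw [map_zero]; exact zero_mem _)
      (fun _ _ h h' => by rw [map_add]; exact add_mem h h')
      (fun z _ h => by rw [map_smul]; exact Submodule.smul_mem _ z h) (fun b l hl => ?_) hω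
    rw [hdapp, ← hl]
    simpa using function_mul_prod_mem_forms 1 (b :: l)
  · refine hsup (by simp) (fun _ _ h h' => by simp only [map_add, h, h', add_zero])
      (fun z _ h => by simp only [map_smul, h, smul_zero]) fun b l => ?_
    change d (d _) = 0
    rw [hdapp]
    exact hdprod (b :: l)
  · rw [eq_top_iff]
    rintro ω -
    induction ω using form_induction with
    | hf b => exact hι b
    | hd b => have := hdι b; change d (functionForm b) ∈ W at this; rwa [hd₁] at this
    | hadd ω η h1 h2 => exact add_mem h1 h2
    | hmul ω η h1 h2 => exact hmul ω h1 η h2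

end FormCoaction

end CocycleCalculus

end

noncomputable section
set_option maxHeartbeats 2000000
set_option synthInstance.maxHeartbeats 400000

namespace CocycleCalculus

/-! ### Complexification of an action of the real group -/

section Action

variable {OG OX : Type*} [CommRing OG] [HopfAlgebra ℝ OG] [CommRing OX] [Algebra ℝ OX]

open TensorProduct.AlgebraTensorModule (distribBaseChange)

/-- The map `O(G) ⊗ O(X) → (ℂ ⊗ O(G)) ⊗ (ℂ ⊗ O(X))`. -/
def complexify (OG OX : Type*) [CommRing OG] [Algebra ℝ OG] [CommRing OX] [Algebra ℝ OX] :
    OG ⊗[ℝ] OX →ₐ[ℝ] (ℂ ⊗[ℝ] OG) ⊗[ℂ] (ℂ ⊗[ℝ] OX) :=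
  Algebra.TensorProduct.lift
    ((Algebra.TensorProduct.includeLeft (R := ℂ) (S := ℂ) (A := ℂ ⊗[ℝ] OG)
      (B := ℂ ⊗[ℝ] OX)).restrictScalars ℝ |>.comp Algebra.TensorProduct.includeRight)
    ((Algebra.TensorProduct.includeRight (R := ℂ) (A := ℂ ⊗[ℝ] OG)
      (B := ℂ ⊗[ℝ] OX)).restrictScalars ℝ |>.comp Algebra.TensorProduct.includeRight)
    fun _ _ => by simp [commute_iff_eq]

theorem complexify_tmul (g : OG) (f : OX) :
    complexify OG OX (g ⊗ₜ f) = (1 ⊗ₜ g) ⊗ₜ (1 ⊗ₜ f) := by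
  change ((1 : ℂ) ⊗ₜ[ℝ] g) ⊗ₜ[ℂ] (1 : ℂ ⊗[ℝ] OX) * (1 : ℂ ⊗[ℝ] OG) ⊗ₜ[ℂ] ((1 : ℂ) ⊗ₜ[ℝ] f) = _
  exact (Algebra.TensorProduct.tmul_mul_tmul _ _ _ _).trans (by rw [mul_one, one_mul])

/-- The base change isomorphism is only a linear map, whereas `complexify` is multiplicative; this
comparison shows that the complexified coaction is an algebra homomorphism. -/
theorem distribBaseChange_eq (z : ℂ) (t : OG ⊗[ℝ] OX) :
    distribBaseChange ℝ ℂ OG OX (z ⊗ₜ t) = z • complexify OG OX t := by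
  induction t with
  | zero => simp
  | add t t' ht ht' => rw [TensorProduct.tmul_add, map_add, ht, ht', map_add, smul_add]
  | tmul g f =>
    rw [TensorProduct.AlgebraTensorModule.distribBaseChange_tmul, complexify_tmul,
      TensorProduct.smul_tmul', TensorProduct.smul_tmul', smul_eq_mul, mul_one]

namespace VarietyAction

variable (α : VarietyAction OG OX)

theorem coact_tmul (z : ℂ) (f : OX) :
    α.coact (z ⊗ₜ f) = distribBaseChange ℝ ℂ OG OX (z ⊗ₜ α.hom f) := rfl

/-- The coaction on complex regular functions, as an algebra homomorphism. -/
def coactAlgHom : ℂ ⊗[ℝ] OX →ₐ[ℂ] (ℂ ⊗[ℝ] OG) ⊗[ℂ] (ℂ ⊗[ℝ] OX) :=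
  Algebra.TensorProduct.lift (Algebra.ofId ℂ _) ((complexify OG OX).comp α.hom)
    fun z _ => Algebra.commutes z _

theorem coactAlgHom_apply (b : ℂ ⊗[ℝ] OX) : α.coactAlgHom b = α.coact b := by
  induction b with
  | zero => rw [LinearMap.map_zero]; exact α.coactAlgHom.toLinearMap.map_zero
  | add b b' hb hb' =>
    rw [LinearMap.map_add, ← hb, ← hb']; exact α.coactAlgHom.toLinearMap.map_add b b'
  | tmul z f =>
    refine Eq.trans ?_ (distribBaseChange_eq z (α.hom f)).symm
    exact (Algebra.smul_def z (complexify OG OX (α.hom f))).symm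

theorem coactAlgHom_toLinearMap : α.coactAlgHom.toLinearMap = α.coact :=
  LinearMap.ext α.coactAlgHom_apply

theorem isComodule_coact : IsComodule α.coact where
  coassoc b := by
    -- The complexification of a threefold real tensor. Both sides of coassociativity at `1 ⊗ f` are
    -- images under `J` of the two sides of the real identity.
    let J : OG ⊗[ℝ] (OG ⊗[ℝ] OX) →ₗ[ℝ] (ℂ ⊗[ℝ] OG) ⊗[ℂ] ((ℂ ⊗[ℝ] OG) ⊗[ℂ] (ℂ ⊗[ℝ] OX)) :=
      ((distribBaseChange ℝ ℂ OG OX).toLinearMap.lTensor (ℂ ⊗[ℝ] OG) ∘ₗ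
        (distribBaseChange ℝ ℂ OG (OG ⊗[ℝ] OX)).toLinearMap).restrictScalars ℝ ∘ₗ
        TensorProduct.mk ℝ ℂ _ 1
    have h1 : ∀ t, TensorProduct.assoc ℂ _ _ _ ((Coalgebra.comul (R := ℂ)).rTensor (ℂ ⊗[ℝ] OX)
        (distribBaseChange ℝ ℂ OG OX (1 ⊗ₜ t))) =
        J (TensorProduct.assoc ℝ OG OG OX ((Coalgebra.comul (R := ℝ)).rTensor OX t)) := by
      intro t
      induction t with
      | zero => simp
      | add t t' ht ht' => rw [TensorProduct.tmul_add]; simp only [map_add, ht, ht']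
      | tmul g f =>
        simp only [TensorProduct.AlgebraTensorModule.distribBaseChange_tmul,
          LinearMap.rTensor_tmul, TensorProduct.comul_tmul]
        induction Coalgebra.comul (R := ℝ) g with
        | zero => simp
        | add t t' ht ht' =>
          simp only [TensorProduct.tmul_add, TensorProduct.add_tmul, map_add, ht, ht']
        | tmul g₁ g₂ => simp [J]
    have h2 : ∀ t, α.coact.lTensor (ℂ ⊗[ℝ] OG) (distribBaseChange ℝ ℂ OG OX (1 ⊗ₜ t)) =
        J (α.hom.toLinearMap.lTensor OG t) := by
      intro t
      induction t with
      | zero => simp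
      | add t t' ht ht' => rw [TensorProduct.tmul_add]; simp only [map_add, ht, ht']
      | tmul g f => simp [J, coact_tmul]
    induction b with
    | zero => simp
    | add b b' hb hb' => simp only [map_add, hb, hb']
    | tmul z f =>
      have hz : z ⊗ₜ[ℝ] f = z • ((1 : ℂ) ⊗ₜ[ℝ] f) := by
        rw [TensorProduct.smul_tmul', smul_eq_mul, mul_one]
      rw [hz, map_smul, map_smul, map_smul, map_smul, coact_tmul, h1, h2, α.coassoc]
  counit b := by
    have h1 : ∀ t, TensorProduct.lid ℂ _ ((Coalgebra.counit (R := ℂ)).rTensor (ℂ ⊗[ℝ] OX)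
        (distribBaseChange ℝ ℂ OG OX (1 ⊗ₜ t))) =
        1 ⊗ₜ TensorProduct.lid ℝ OX ((Coalgebra.counit (R := ℝ)).rTensor OX t) := by
      intro t
      induction t with
      | zero => simp
      | add t t' ht ht' => rw [TensorProduct.tmul_add]; simp only [map_add, ht, ht',
          TensorProduct.tmul_add]
      | tmul g f => simp; rfl
    induction b with
    | zero => simp
    | add b b' hb hb' => simp only [map_add, hb, hb']
    | tmul z f =>
      have hz : z ⊗ₜ[ℝ] f = z • ((1 : ℂ) ⊗ₜ[ℝ] f) := by
        rw [TensorProduct.smul_tmul', smul_eq_mul, mul_one]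
      rw [hz, map_smul, map_smul, map_smul, coact_tmul, h1, α.counit]

theorem exists_isDeRham [IsDomain OX] [Algebra.Smooth ℝ OX] (x₀ : RealPoint OX) :
    ∃ (d : Form OX →ₗ[ℂ] Form OX) (δ : Form OX →ₗ[ℂ] (ℂ ⊗[ℝ] OG) ⊗[ℂ] Form OX),
      α.IsDeRham d δ ∧ (α.deRhamData d δ).IsCovariantCalculus := by
  obtain ⟨d, δ, hd, hmul, hf, hdf, h⟩ := exists_classicalData_isCovariantCalculus x₀ α.coactAlgHom
    (α.coactAlgHom_toLinearMap ▸ α.isComodule_coact)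
  refine ⟨d, δ, ⟨fun k b₀ b => ?_, hmul, fun b => ?_, fun b => ?_⟩, ?_⟩
  · have := hd b₀ (List.ofFn b)
    rwa [List.map_ofFn] at this
  · rw [← α.coactAlgHom_apply]; exact hf b
  · rw [← α.coactAlgHom_apply]; exact hdf b
  · rw [α.coactAlgHom_toLinearMap] at h
    exact h

end VarietyAction

end Action

end CocycleCalculus

end

noncomputable section

namespace CocycleCalculus

/-! ### Functionals on a coalgebra acting on comodules -/

section Act

open Coalgebra TensorProduct

variable {C C' M M' N : Type*} [AddCommGroup C] [Module ℂ C] [AddCommGroup C'] [Module ℂ C']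
  [AddCommGroup M] [Module ℂ M] [AddCommGroup M'] [Module ℂ M'] [AddCommGroup N] [Module ℂ N]

/-- The operator `m ↦ φ(m₍₋₁₎) m₍₀₎` of a functional on a comodule. -/
def act (ρ : M →ₗ[ℂ] C ⊗[ℂ] M) (φ : C →ₗ[ℂ] ℂ) : M →ₗ[ℂ] M :=
  (TensorProduct.lid ℂ M).toLinearMap ∘ₗ φ.rTensor M ∘ₗ ρ

/-- The tensor product of a `C`-comodule and a `C'`-comodule. -/
def coactTensor (ρ : M →ₗ[ℂ] C ⊗[ℂ] M) (ρ' : N →ₗ[ℂ] C' ⊗[ℂ] N) :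
    M ⊗[ℂ] N →ₗ[ℂ] (C ⊗[ℂ] C') ⊗[ℂ] (M ⊗[ℂ] N) :=
  (tensorTensorTensorComm ℂ C M C' N).toLinearMap ∘ₗ TensorProduct.map ρ ρ'

theorem act_apply (ρ : M →ₗ[ℂ] C ⊗[ℂ] M) (φ : C →ₗ[ℂ] ℂ) (m : M) :
    act ρ φ m = TensorProduct.lid ℂ M (φ.rTensor M (ρ m)) := rfl

theorem act_rTensor_comp (ρ : M →ₗ[ℂ] C ⊗[ℂ] M) (π : C →ₗ[ℂ] C') (φ : C' →ₗ[ℂ] ℂ) :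
    act (π.rTensor M ∘ₗ ρ) φ = act ρ (φ ∘ₗ π) := by
  ext m
  simp only [act_apply, LinearMap.comp_apply, LinearMap.rTensor_comp]

theorem lid_rTensor_lTensor (φ : C →ₗ[ℂ] ℂ) (g : M →ₗ[ℂ] N) (x : C ⊗[ℂ] M) :
    TensorProduct.lid ℂ N (φ.rTensor N (g.lTensor C x)) =
      g (TensorProduct.lid ℂ M (φ.rTensor M x)) := by
  induction x with
  | zero => simp only [map_zero]
  | add x y hx hy => simp only [map_add, hx, hy]
  | tmul c m => simp

/-- Functionals act naturally with respect to colinear maps. -/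
theorem map_act {ρ : M →ₗ[ℂ] C ⊗[ℂ] M} {ρ' : N →ₗ[ℂ] C ⊗[ℂ] N} {g : M →ₗ[ℂ] N}
    (hg : ∀ m, ρ' (g m) = g.lTensor C (ρ m)) (φ : C →ₗ[ℂ] ℂ) (m : M) :
    g (act ρ φ m) = act ρ' φ (g m) := by
  rw [act_apply, act_apply, hg, lid_rTensor_lTensor]

theorem coactTensor_map {ρ : M →ₗ[ℂ] C ⊗[ℂ] M} {ρ' : N →ₗ[ℂ] C' ⊗[ℂ] N}
    {σ : M' →ₗ[ℂ] C ⊗[ℂ] M'} {N' : Type*} [AddCommGroup N'] [Module ℂ N']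
    {σ' : N' →ₗ[ℂ] C' ⊗[ℂ] N'} {f : M →ₗ[ℂ] M'} {g : N →ₗ[ℂ] N'}
    (hf : ∀ m, σ (f m) = f.lTensor C (ρ m)) (hg : ∀ n, σ' (g n) = g.lTensor C' (ρ' n))
    (x : M ⊗[ℂ] N) :
    coactTensor σ σ' (TensorProduct.map f g x) =
      (TensorProduct.map f g).lTensor (C ⊗[ℂ] C') (coactTensor ρ ρ' x) := by
  have key : (tensorTensorTensorComm ℂ C M' C' N').toLinearMap ∘ₗ
      TensorProduct.map (f.lTensor C) (g.lTensor C') =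
      (TensorProduct.map f g).lTensor (C ⊗[ℂ] C') ∘ₗ
        (tensorTensorTensorComm ℂ C M C' N).toLinearMap := by
    ext; simp
  induction x with
  | zero => simp only [map_zero]
  | add x y hx hy => simp only [map_add, hx, hy]
  | tmul m n =>
    simp only [coactTensor, LinearMap.comp_apply, TensorProduct.map_tmul, hf, hg]
    exact LinearMap.congr_fun key (ρ m ⊗ₜ ρ' n)

/-- The scalars produced by `φ` and `ψ` come from different legs, so the product functional acts
factor by factor. -/
theorem act_coactTensor (ρ : M →ₗ[ℂ] C ⊗[ℂ] M) (ρ' : N →ₗ[ℂ] C' ⊗[ℂ] N) (φ : C →ₗ[ℂ] ℂ)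
    (ψ : C' →ₗ[ℂ] ℂ) :
    act (coactTensor ρ ρ') (LinearMap.mul' ℂ ℂ ∘ₗ TensorProduct.map φ ψ) =
      TensorProduct.map (act ρ φ) (act ρ' ψ) := by
  have key : (TensorProduct.lid ℂ (M ⊗[ℂ] N)).toLinearMap ∘ₗ
      (LinearMap.mul' ℂ ℂ ∘ₗ TensorProduct.map φ ψ).rTensor (M ⊗[ℂ] N) ∘ₗ
        (tensorTensorTensorComm ℂ C M C' N).toLinearMap =
      TensorProduct.map ((TensorProduct.lid ℂ M).toLinearMap ∘ₗ φ.rTensor M)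
        ((TensorProduct.lid ℂ N).toLinearMap ∘ₗ ψ.rTensor N) := by
    ext c m c' n
    simp [TensorProduct.smul_tmul', smul_smul, mul_comm]
  refine TensorProduct.ext' fun m n => ?_
  exact LinearMap.congr_fun key (ρ m ⊗ₜ ρ' n)

variable [Coalgebra ℂ C] [Coalgebra ℂ C']

theorem isComodule_comul : IsComodule (Coalgebra.comul (R := ℂ) (A := C)) where
  coassoc x := Coalgebra.coassoc_apply x
  counit x := by rw [Coalgebra.rTensor_counit_comul]; simp

theorem comul_eq_coactTensor : Coalgebra.comul (R := ℂ) (A := C ⊗[ℂ] C') =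
    coactTensor Coalgebra.comul Coalgebra.comul := rfl

theorem IsComodule.coactTensor {ρ : M →ₗ[ℂ] C ⊗[ℂ] M} {ρ' : N →ₗ[ℂ] C' ⊗[ℂ] N}
    (hρ : IsComodule ρ) (hρ' : IsComodule ρ') : IsComodule (coactTensor ρ ρ') where
  coassoc x := by
    induction x with
    | zero => simp only [map_zero]
    | add x y hx hy => simp only [map_add, hx, hy]
    | tmul m n =>
      let J : (C ⊗[ℂ] (C ⊗[ℂ] M)) ⊗[ℂ] (C' ⊗[ℂ] (C' ⊗[ℂ] N)) →ₗ[ℂ]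
          (C ⊗[ℂ] C') ⊗[ℂ] ((C ⊗[ℂ] C') ⊗[ℂ] (M ⊗[ℂ] N)) :=
        (tensorTensorTensorComm ℂ C M C' N).toLinearMap.lTensor (C ⊗[ℂ] C') ∘ₗ
          (tensorTensorTensorComm ℂ C (C ⊗[ℂ] M) C' (C' ⊗[ℂ] N)).toLinearMap
      have h1 : (TensorProduct.assoc ℂ _ _ _).toLinearMap ∘ₗ
          (tensorTensorTensorComm ℂ C C C' C').toLinearMap.rTensor (M ⊗[ℂ] N) ∘ₗ
          (tensorTensorTensorComm ℂ (C ⊗[ℂ] C) M (C' ⊗[ℂ] C') N).toLinearMap =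
          J ∘ₗ TensorProduct.map (TensorProduct.assoc ℂ C C M).toLinearMap
            (TensorProduct.assoc ℂ C' C' N).toLinearMap := by
        ext; simp [J]
      have h2 : (Coalgebra.comul (R := ℂ) (A := C ⊗[ℂ] C')).rTensor (M ⊗[ℂ] N) ∘ₗ
          (tensorTensorTensorComm ℂ C M C' N).toLinearMap =
          (tensorTensorTensorComm ℂ C C C' C').toLinearMap.rTensor (M ⊗[ℂ] N) ∘ₗ
          (tensorTensorTensorComm ℂ (C ⊗[ℂ] C) M (C' ⊗[ℂ] C') N).toLinearMap ∘ₗ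
          TensorProduct.map (Coalgebra.comul.rTensor M) (Coalgebra.comul.rTensor N) := by
        ext; simp [comul_eq_coactTensor, CocycleCalculus.coactTensor]
      have h3 : (CocycleCalculus.coactTensor ρ ρ').lTensor (C ⊗[ℂ] C') ∘ₗ
          (tensorTensorTensorComm ℂ C M C' N).toLinearMap =
          J ∘ₗ TensorProduct.map (ρ.lTensor C) (ρ'.lTensor C') := by
        ext; simp [J, CocycleCalculus.coactTensor]
      have e1 := LinearMap.congr_fun h2 (ρ m ⊗ₜ ρ' n)
      have e2 := LinearMap.congr_fun h3 (ρ m ⊗ₜ ρ' n)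
      have e3 := LinearMap.congr_fun h1
        (Coalgebra.comul.rTensor M (ρ m) ⊗ₜ Coalgebra.comul.rTensor N (ρ' n))
      simp only [LinearMap.comp_apply, TensorProduct.map_tmul, LinearEquiv.coe_coe] at e1 e2 e3
      simp only [CocycleCalculus.coactTensor, LinearMap.comp_apply, TensorProduct.map_tmul,
        LinearEquiv.coe_coe] at e2 ⊢
      rw [e1, e2, e3, hρ.coassoc, hρ'.coassoc]
  counit x := by
    have := act_coactTensor ρ ρ' (Coalgebra.counit (R := ℂ)) (Coalgebra.counit (R := ℂ))
    have h1 : act ρ (Coalgebra.counit (R := ℂ)) = LinearMap.id := LinearMap.ext hρ.counit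
    have h2 : act ρ' (Coalgebra.counit (R := ℂ)) = LinearMap.id := LinearMap.ext hρ'.counit
    rw [h1, h2, TensorProduct.map_id] at this
    refine Eq.trans ?_ (LinearMap.congr_fun this x)
    rw [act_apply]
    congr 3
    ext
    simp [mul_comm]

theorem IsComodule.act_counit {ρ : M →ₗ[ℂ] C ⊗[ℂ] M} (hρ : IsComodule ρ) :
    act ρ (Coalgebra.counit (R := ℂ)) = LinearMap.id :=
  LinearMap.ext hρ.counit

/-- The right action `c ↦ c₍₁₎ φ(c₍₂₎)` of a functional on the coalgebra. -/
def ract (φ : C →ₗ[ℂ] ℂ) : C →ₗ[ℂ] C :=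
  (TensorProduct.rid ℂ C).toLinearMap ∘ₗ φ.lTensor C ∘ₗ Coalgebra.comul

/-- The left action `c ↦ φ(c₍₁₎) c₍₂₎` of a functional on the coalgebra. -/
def lact (φ : C →ₗ[ℂ] ℂ) : C →ₗ[ℂ] C := act Coalgebra.comul φ

theorem ract_apply (φ : C →ₗ[ℂ] ℂ) (c : C) :
    ract φ c = TensorProduct.rid ℂ C (φ.lTensor C (Coalgebra.comul c)) := rfl

/-- The coaction is colinear: acting before a coaction acts on the outer leg. -/
theorem IsComodule.coact_act {ρ : M →ₗ[ℂ] C ⊗[ℂ] M} (hρ : IsComodule ρ) (φ : C →ₗ[ℂ] ℂ) (m : M) :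
    ρ (act ρ φ m) = (lact φ).rTensor M (ρ m) := by
  have key : (TensorProduct.lid ℂ (C ⊗[ℂ] M)).toLinearMap ∘ₗ φ.rTensor (C ⊗[ℂ] M) ∘ₗ
      (TensorProduct.assoc ℂ C C M).toLinearMap =
      ((TensorProduct.lid ℂ C).toLinearMap ∘ₗ φ.rTensor C).rTensor M := by
    ext; simp [TensorProduct.smul_tmul']
  rw [act_apply, ← lid_rTensor_lTensor, ← hρ.coassoc]
  refine (LinearMap.congr_fun key _).trans ?_
  rw [← LinearMap.comp_apply, ← LinearMap.rTensor_comp]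
  rfl

/-- By coassociativity, a functional on the inner leg of the coaction can be moved to the right side
of the outer leg. Together with `IsComodule.coact_act` it lets functionals move across a coaction.
-/
theorem IsComodule.lTensor_act {ρ : M →ₗ[ℂ] C ⊗[ℂ] M} (hρ : IsComodule ρ) (φ : C →ₗ[ℂ] ℂ)
    (m : M) : (act ρ φ).lTensor C (ρ m) = (ract φ).rTensor M (ρ m) := by
  have key : ((TensorProduct.lid ℂ M).toLinearMap ∘ₗ φ.rTensor M).lTensor C ∘ₗ
      (TensorProduct.assoc ℂ C C M).toLinearMap =
      ((TensorProduct.rid ℂ C).toLinearMap ∘ₗ φ.lTensor C).rTensor M := by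
    ext; simp [TensorProduct.smul_tmul]
  have h := LinearMap.congr_fun key (Coalgebra.comul.rTensor M (ρ m))
  rw [LinearMap.comp_apply, LinearEquiv.coe_coe, hρ.coassoc] at h
  rw [act, ract, ← LinearMap.comp_assoc, ← LinearMap.comp_assoc, LinearMap.lTensor_comp,
    LinearMap.rTensor_comp]
  exact h

/-- The order is reversed: the functional `φ ∘ₗ lact ψ` is `c ↦ ψ(c₍₁₎) φ(c₍₂₎)`, so the functional
that acts first takes the outermost leg. -/
theorem IsComodule.act_act {ρ : M →ₗ[ℂ] C ⊗[ℂ] M} (hρ : IsComodule ρ) (φ ψ : C →ₗ[ℂ] ℂ) (m : M) :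
    act ρ φ (act ρ ψ m) = act ρ (φ ∘ₗ lact ψ) m := by
  rw [act_apply, hρ.coact_act, act_apply, LinearMap.rTensor_comp, LinearMap.comp_apply]

/-- `φ(c₍₁₎) ψ(c₍₂₎)` in two forms. -/
theorem apply_lact (φ ψ : C →ₗ[ℂ] ℂ) (c : C) : ψ (lact φ c) = φ (ract ψ c) := by
  rw [lact, act_apply, ract_apply]
  induction Coalgebra.comul (R := ℂ) c with
  | zero => simp only [map_zero]
  | add x y hx hy => simp only [map_add, hx, hy]
  | tmul c c' => simp [mul_comm]

theorem apply_lact_eq (φ ψ : C →ₗ[ℂ] ℂ) (c : C) : ψ (lact φ c) =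
    TensorProduct.lid ℂ ℂ (TensorProduct.map φ ψ (Coalgebra.comul (R := ℂ) c)) := by
  rw [lact, act_apply]
  induction Coalgebra.comul (R := ℂ) c with
  | zero => simp only [map_zero]
  | add x y hx hy => simp only [map_add, hx, hy]
  | tmul c c' => simp

theorem comul_lact (φ : C →ₗ[ℂ] ℂ) (c : C) :
    Coalgebra.comul (R := ℂ) (lact φ c) = (lact φ).rTensor C (Coalgebra.comul (R := ℂ) c) :=
  isComodule_comul.coact_act φ c

theorem lTensor_lact (φ : C →ₗ[ℂ] ℂ) (c : C) :
    (lact φ).lTensor C (Coalgebra.comul (R := ℂ) c) =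
      (ract φ).rTensor C (Coalgebra.comul (R := ℂ) c) :=
  isComodule_comul.lTensor_act φ c

theorem comul_ract (φ : C →ₗ[ℂ] ℂ) (c : C) :
    Coalgebra.comul (R := ℂ) (ract φ c) = (ract φ).lTensor C (Coalgebra.comul (R := ℂ) c) := by
  have key : (TensorProduct.rid ℂ (C ⊗[ℂ] C)).toLinearMap ∘ₗ φ.lTensor (C ⊗[ℂ] C) ∘ₗ
      (TensorProduct.assoc ℂ C C C).symm.toLinearMap =
      ((TensorProduct.rid ℂ C).toLinearMap ∘ₗ φ.lTensor C).lTensor C := by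
    ext; simp
  have nat : Coalgebra.comul (R := ℂ) ∘ₗ (TensorProduct.rid ℂ C).toLinearMap ∘ₗ φ.lTensor C =
      (TensorProduct.rid ℂ (C ⊗[ℂ] C)).toLinearMap ∘ₗ φ.lTensor (C ⊗[ℂ] C) ∘ₗ
        (Coalgebra.comul (R := ℂ)).rTensor C := by
    ext; simp
  have h1 := LinearMap.congr_fun nat (Coalgebra.comul (R := ℂ) c)
  have h2 := LinearMap.congr_fun key ((Coalgebra.comul (R := ℂ)).lTensor C
    (Coalgebra.comul (R := ℂ) c))
  simp only [LinearMap.comp_apply, LinearEquiv.coe_coe] at h1 h2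
  rw [ract_apply, h1, ← Coalgebra.coassoc_symm_apply, h2, ← LinearMap.comp_apply,
    ← LinearMap.lTensor_comp]
  rfl

theorem ract_ract (φ ψ : C →ₗ[ℂ] ℂ) (c : C) : ract φ (ract ψ c) = ract (φ ∘ₗ ract ψ) c := by
  rw [ract_apply, comul_ract, ract_apply, LinearMap.lTensor_comp, LinearMap.comp_apply]

theorem lact_ract (φ ψ : C →ₗ[ℂ] ℂ) (c : C) : lact φ (ract ψ c) = ract ψ (lact φ c) := by
  rw [lact, act_apply, comul_ract, lid_rTensor_lTensor, act_apply]

theorem ract_counit (c : C) : ract (Coalgebra.counit (R := ℂ)) c = c := by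
  rw [ract_apply, Coalgebra.lTensor_counit_comul]; simp

theorem lact_counit (c : C) : lact (Coalgebra.counit (R := ℂ)) c = c :=
  isComodule_comul.counit c

theorem lact_lact (φ ψ : C →ₗ[ℂ] ℂ) (c : C) : lact φ (lact ψ c) = lact (φ ∘ₗ lact ψ) c :=
  isComodule_comul.act_act φ ψ c

/-- A functional is recovered from its operator by the counit; identities between functionals can
thus be proved for the operators, where convolution is composition. -/
theorem counit_lact (φ : C →ₗ[ℂ] ℂ) (c : C) : Coalgebra.counit (R := ℂ) (lact φ c) = φ c := by
  rw [apply_lact, ract_counit]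

/-! ### Functionals and coalgebra maps -/

section CoalgHom

variable {π : C →ₗ[ℂ] C'}

theorem lact_map (hπ : ∀ c, Coalgebra.comul (R := ℂ) (π c) =
    TensorProduct.map π π (Coalgebra.comul (R := ℂ) c))
    (φ : C' →ₗ[ℂ] ℂ) (c : C) : lact φ (π c) = π (lact (φ ∘ₗ π) c) := by
  rw [lact, act_apply, hπ, lact, act_apply]
  induction Coalgebra.comul (R := ℂ) c with
  | zero => simp only [map_zero]
  | add x y hx hy => simp only [map_add, hx, hy]
  | tmul c c' => simp

theorem ract_map (hπ : ∀ c, Coalgebra.comul (R := ℂ) (π c) =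
    TensorProduct.map π π (Coalgebra.comul (R := ℂ) c))
    (φ : C' →ₗ[ℂ] ℂ) (c : C) : ract φ (π c) = π (ract (φ ∘ₗ π) c) := by
  rw [ract_apply, hπ, ract_apply]
  induction Coalgebra.comul (R := ℂ) c with
  | zero => simp only [map_zero]
  | add x y hx hy => simp only [map_add, hx, hy]
  | tmul c c' => simp

theorem IsComodule.rTensor_comp (hπ : ∀ c, Coalgebra.comul (R := ℂ) (π c) =
    TensorProduct.map π π (Coalgebra.comul (R := ℂ) c))
    (hε : ∀ c, Coalgebra.counit (R := ℂ) (π c) =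
    Coalgebra.counit (R := ℂ) c) {ρ : M →ₗ[ℂ] C ⊗[ℂ] M} (hρ : IsComodule ρ) :
    IsComodule (π.rTensor M ∘ₗ ρ) where
  coassoc m := by
    have h1 : (TensorProduct.assoc ℂ C' C' M).toLinearMap ∘ₗ
        (Coalgebra.comul (R := ℂ)).rTensor M ∘ₗ π.rTensor M =
        TensorProduct.map π (π.rTensor M) ∘ₗ (TensorProduct.assoc ℂ C C M).toLinearMap ∘ₗ
        (Coalgebra.comul (R := ℂ)).rTensor M := by
      rw [← LinearMap.rTensor_comp, show Coalgebra.comul (R := ℂ) ∘ₗ π =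
        TensorProduct.map π π ∘ₗ Coalgebra.comul (R := ℂ) from LinearMap.ext hπ,
        LinearMap.rTensor_comp, ← LinearMap.comp_assoc, ← LinearMap.comp_assoc]
      congr 1
      ext; simp
    have h2 : (π.rTensor M ∘ₗ ρ).lTensor C' ∘ₗ π.rTensor M =
        TensorProduct.map π (π.rTensor M) ∘ₗ ρ.lTensor C := by
      ext; simp
    refine (LinearMap.congr_fun h1 (ρ m)).trans (Eq.trans ?_ (LinearMap.congr_fun h2 (ρ m)).symm)
    exact congrArg _ (hρ.coassoc m)
  counit m := by
    rw [LinearMap.comp_apply, ← LinearMap.comp_apply, ← LinearMap.rTensor_comp,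
      show Coalgebra.counit (R := ℂ) ∘ₗ π = Coalgebra.counit (R := ℂ) from LinearMap.ext hε]
    exact hρ.counit m

end CoalgHom

/-- The counit acts trivially on the second factor, so an operator on one leg is the operator of a
functional on the tensor coalgebra. This and its variants below bring one-leg operators into the
convolution calculus. -/
theorem ract_tmul_counit (φ : C →ₗ[ℂ] ℂ) :
    ract (LinearMap.mul' ℂ ℂ ∘ₗ TensorProduct.map φ (Coalgebra.counit (R := ℂ) (A := C'))) =
      (ract φ).rTensor C' := by
  have key : (TensorProduct.rid ℂ (C ⊗[ℂ] C')).toLinearMap ∘ₗ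
      (LinearMap.mul' ℂ ℂ ∘ₗ TensorProduct.map φ (Coalgebra.counit (R := ℂ) (A := C'))).lTensor _
        ∘ₗ (tensorTensorTensorComm ℂ C C C' C').toLinearMap =
      TensorProduct.map ((TensorProduct.rid ℂ C).toLinearMap ∘ₗ φ.lTensor C)
        ((TensorProduct.rid ℂ C').toLinearMap ∘ₗ (Coalgebra.counit (R := ℂ)).lTensor C') := by
    ext
    simp [TensorProduct.smul_tmul', smul_smul, mul_comm]
  refine TensorProduct.ext' fun c c' => ?_
  refine (LinearMap.congr_fun key (Coalgebra.comul c ⊗ₜ Coalgebra.comul c')).trans ?_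
  exact congrArg (ract φ c ⊗ₜ[ℂ] ·) (ract_counit c')

theorem ract_counit_tmul (φ : C' →ₗ[ℂ] ℂ) :
    ract (LinearMap.mul' ℂ ℂ ∘ₗ TensorProduct.map (Coalgebra.counit (R := ℂ) (A := C)) φ) =
      (ract φ).lTensor C := by
  have key : (TensorProduct.rid ℂ (C ⊗[ℂ] C')).toLinearMap ∘ₗ
      (LinearMap.mul' ℂ ℂ ∘ₗ TensorProduct.map (Coalgebra.counit (R := ℂ) (A := C)) φ).lTensor _
        ∘ₗ (tensorTensorTensorComm ℂ C C C' C').toLinearMap =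
      TensorProduct.map ((TensorProduct.rid ℂ C).toLinearMap ∘ₗ (Coalgebra.counit (R := ℂ)).lTensor C)
        ((TensorProduct.rid ℂ C').toLinearMap ∘ₗ φ.lTensor C') := by
    ext
    simp [TensorProduct.smul_tmul', smul_smul, mul_comm]
  refine TensorProduct.ext' fun c c' => ?_
  refine (LinearMap.congr_fun key (Coalgebra.comul c ⊗ₜ Coalgebra.comul c')).trans ?_
  exact congrArg (· ⊗ₜ[ℂ] ract φ c') (ract_counit c)

theorem act_tmul_counit {ρ : M →ₗ[ℂ] C ⊗[ℂ] M} {ρ' : N →ₗ[ℂ] C' ⊗[ℂ] N} (hρ' : IsComodule ρ')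
    (φ : C →ₗ[ℂ] ℂ) :
    act (coactTensor ρ ρ')
      (LinearMap.mul' ℂ ℂ ∘ₗ TensorProduct.map φ (Coalgebra.counit (R := ℂ) (A := C'))) =
      (act ρ φ).rTensor N := by
  rw [act_coactTensor, hρ'.act_counit]; rfl

theorem act_counit_tmul {ρ : M →ₗ[ℂ] C ⊗[ℂ] M} {ρ' : N →ₗ[ℂ] C' ⊗[ℂ] N} (hρ : IsComodule ρ)
    (φ : C' →ₗ[ℂ] ℂ) :
    act (coactTensor ρ ρ')
      (LinearMap.mul' ℂ ℂ ∘ₗ TensorProduct.map (Coalgebra.counit (R := ℂ) (A := C)) φ) =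
      (act ρ' φ).lTensor M := by
  rw [act_coactTensor, hρ.act_counit]; rfl

theorem lact_tmul_counit (φ : C →ₗ[ℂ] ℂ) :
    lact (LinearMap.mul' ℂ ℂ ∘ₗ TensorProduct.map φ (Coalgebra.counit (R := ℂ) (A := C'))) =
      (lact φ).rTensor C' :=
  act_tmul_counit isComodule_comul φ

theorem lact_counit_tmul (φ : C' →ₗ[ℂ] ℂ) :
    lact (LinearMap.mul' ℂ ℂ ∘ₗ TensorProduct.map (Coalgebra.counit (R := ℂ) (A := C)) φ) =
      (lact φ).lTensor C :=
  act_counit_tmul isComodule_comul φ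

end Act

end CocycleCalculus

end

noncomputable section

namespace CocycleCalculus

/-! ### Cocycle deformation of comodules and products -/

section Twist

open TensorProduct

section Assoc

variable {C C' C'' M N P : Type*} [AddCommGroup C] [Module ℂ C] [AddCommGroup C'] [Module ℂ C']
  [AddCommGroup C''] [Module ℂ C''] [AddCommGroup M] [Module ℂ M] [AddCommGroup N] [Module ℂ N]
  [AddCommGroup P] [Module ℂ P]

theorem coactTensor_assoc (ρ : M →ₗ[ℂ] C ⊗[ℂ] M) (ρ' : N →ₗ[ℂ] C' ⊗[ℂ] N)
    (ρ'' : P →ₗ[ℂ] C'' ⊗[ℂ] P) (x : (M ⊗[ℂ] N) ⊗[ℂ] P) :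
    coactTensor ρ (coactTensor ρ' ρ'') (TensorProduct.assoc ℂ M N P x) =
      TensorProduct.map (TensorProduct.assoc ℂ C C' C'').toLinearMap
        (TensorProduct.assoc ℂ M N P).toLinearMap (coactTensor (coactTensor ρ ρ') ρ'' x) := by
  have key : (tensorTensorTensorComm ℂ C M (C' ⊗[ℂ] C'') (N ⊗[ℂ] P)).toLinearMap ∘ₗ
      (tensorTensorTensorComm ℂ C' N C'' P).toLinearMap.lTensor (C ⊗[ℂ] M) ∘ₗ
      (TensorProduct.assoc ℂ _ _ _).toLinearMap =
      TensorProduct.map (TensorProduct.assoc ℂ C C' C'').toLinearMap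
        (TensorProduct.assoc ℂ M N P).toLinearMap ∘ₗ
      (tensorTensorTensorComm ℂ (C ⊗[ℂ] C') (M ⊗[ℂ] N) C'' P).toLinearMap ∘ₗ
      (tensorTensorTensorComm ℂ C M C' N).toLinearMap.rTensor (C'' ⊗[ℂ] P) := by
    ext; simp
  have : coactTensor ρ (coactTensor ρ' ρ'') ∘ₗ (TensorProduct.assoc ℂ M N P).toLinearMap =
      TensorProduct.map (TensorProduct.assoc ℂ C C' C'').toLinearMap
        (TensorProduct.assoc ℂ M N P).toLinearMap ∘ₗ coactTensor (coactTensor ρ ρ') ρ'' :=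
    TensorProduct.ext_threefold fun m n p => LinearMap.congr_fun key ((ρ m ⊗ₜ ρ' n) ⊗ₜ ρ'' p)
  exact LinearMap.congr_fun this x

theorem act_coactTensor_assoc (ρ : M →ₗ[ℂ] C ⊗[ℂ] M) (ρ' : N →ₗ[ℂ] C' ⊗[ℂ] N)
    (ρ'' : P →ₗ[ℂ] C'' ⊗[ℂ] P) (φ : C ⊗[ℂ] (C' ⊗[ℂ] C'') →ₗ[ℂ] ℂ) (x : (M ⊗[ℂ] N) ⊗[ℂ] P) :
    act (coactTensor ρ (coactTensor ρ' ρ'')) φ (TensorProduct.assoc ℂ M N P x) =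
      TensorProduct.assoc ℂ M N P (act (coactTensor (coactTensor ρ ρ') ρ'')
        (φ ∘ₗ (TensorProduct.assoc ℂ C C' C'').toLinearMap) x) := by
  rw [act_apply, coactTensor_assoc, act_apply]
  generalize coactTensor (coactTensor ρ ρ') ρ'' x = y
  induction y with
  | zero => simp only [map_zero]
  | add x y hx hy => simp only [map_add, hx, hy]
  | tmul c m => simp

theorem coactTensor_rTensor_comp_left (ρ : M →ₗ[ℂ] C ⊗[ℂ] M) (π : C →ₗ[ℂ] C')
    (ρ' : N →ₗ[ℂ] C'' ⊗[ℂ] N) : coactTensor (π.rTensor M ∘ₗ ρ) ρ' =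
      (π.rTensor C'').rTensor (M ⊗[ℂ] N) ∘ₗ coactTensor ρ ρ' := by
  have key : (tensorTensorTensorComm ℂ C' M C'' N).toLinearMap ∘ₗ
      (π.rTensor M).rTensor (C'' ⊗[ℂ] N) =
      (π.rTensor C'').rTensor (M ⊗[ℂ] N) ∘ₗ (tensorTensorTensorComm ℂ C M C'' N).toLinearMap := by
    ext; simp
  exact TensorProduct.ext' fun m n => LinearMap.congr_fun key (ρ m ⊗ₜ ρ' n)

theorem coactTensor_rTensor_comp_right (ρ : M →ₗ[ℂ] C ⊗[ℂ] M) (π : C' →ₗ[ℂ] C'')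
    (ρ' : N →ₗ[ℂ] C' ⊗[ℂ] N) : coactTensor ρ (π.rTensor N ∘ₗ ρ') =
      (π.lTensor C).rTensor (M ⊗[ℂ] N) ∘ₗ coactTensor ρ ρ' := by
  have key : (tensorTensorTensorComm ℂ C M C'' N).toLinearMap ∘ₗ
      (π.rTensor N).lTensor (C ⊗[ℂ] M) =
      (π.lTensor C).rTensor (M ⊗[ℂ] N) ∘ₗ (tensorTensorTensorComm ℂ C M C' N).toLinearMap := by
    ext; simp
  exact TensorProduct.ext' fun m n => LinearMap.congr_fun key (ρ m ⊗ₜ ρ' n)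

theorem map₂_apply_eq {A R : Type*} [AddCommGroup A] [Module ℂ A] [AddCommGroup R] [Module ℂ R]
    (m : C →ₗ[ℂ] C' →ₗ[ℂ] A) (f : M →ₗ[ℂ] N →ₗ[ℂ] R) (ρ : M →ₗ[ℂ] C ⊗[ℂ] M)
    (ρ' : N →ₗ[ℂ] C' ⊗[ℂ] N) (x : M) (y : N) :
    TensorProduct.map₂ m f (ρ x) (ρ' y) =
      TensorProduct.map (TensorProduct.lift m) (TensorProduct.lift f)
        (coactTensor ρ ρ' (x ⊗ₜ y)) := by
  have key : TensorProduct.lift (TensorProduct.map₂ m f) =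
      TensorProduct.map (TensorProduct.lift m) (TensorProduct.lift f) ∘ₗ
        (tensorTensorTensorComm ℂ C M C' N).toLinearMap := by
    ext; simp
  exact LinearMap.congr_fun key (ρ x ⊗ₜ ρ' y)

end Assoc

variable {A : Type*} [Ring A] [HopfAlgebra ℂ A] {M N P Q R : Type*}
  [AddCommGroup M] [Module ℂ M] [AddCommGroup N] [Module ℂ N] [AddCommGroup P] [Module ℂ P]
  [AddCommGroup Q] [Module ℂ Q] [AddCommGroup R] [Module ℂ R]

/-- The diagonal coaction on the tensor product of two comodules over a bialgebra. -/
def diagCoact (δM : M →ₗ[ℂ] A ⊗[ℂ] M) (δN : N →ₗ[ℂ] A ⊗[ℂ] N) :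
    M ⊗[ℂ] N →ₗ[ℂ] A ⊗[ℂ] (M ⊗[ℂ] N) :=
  (LinearMap.mul' ℂ A).rTensor (M ⊗[ℂ] N) ∘ₗ coactTensor δM δN

theorem comul_mul' (x : A ⊗[ℂ] A) : Coalgebra.comul (R := ℂ) (LinearMap.mul' ℂ A x) =
    TensorProduct.map (LinearMap.mul' ℂ A) (LinearMap.mul' ℂ A) (Coalgebra.comul (R := ℂ) x) :=
  (CoalgHomClass.map_comp_comul_apply (Bialgebra.mulCoalgHom ℂ A) x).symm

theorem counit_mul' (x : A ⊗[ℂ] A) : Coalgebra.counit (R := ℂ) (LinearMap.mul' ℂ A x) =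
    Coalgebra.counit (R := ℂ) x :=
  CoalgHomClass.counit_comp_apply (Bialgebra.mulCoalgHom ℂ A) x

variable {δM : M →ₗ[ℂ] A ⊗[ℂ] M} {δN : N →ₗ[ℂ] A ⊗[ℂ] N} {δP : P →ₗ[ℂ] A ⊗[ℂ] P}

theorem IsComodule.diagCoact (hM : IsComodule δM) (hN : IsComodule δN) :
    IsComodule (diagCoact δM δN) :=
  IsComodule.rTensor_comp comul_mul' counit_mul' (hM.coactTensor hN)

theorem map₂_mul_apply_eq (f : M →ₗ[ℂ] N →ₗ[ℂ] R) (x : M) (y : N) :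
    TensorProduct.map₂ (LinearMap.mul ℂ A) f (δM x) (δN y) =
      (TensorProduct.lift f).lTensor A (diagCoact δM δN (x ⊗ₜ y)) := by
  rw [map₂_apply_eq]
  exact (LinearMap.congr_fun (LinearMap.lTensor_comp_rTensor _ (LinearMap.mul' ℂ A)
    (TensorProduct.lift f)) (coactTensor δM δN (x ⊗ₜ y))).symm

namespace UnitaryTwoCocycle

variable {star : A → A} (c : UnitaryTwoCocycle star)

theorem γinv_lact (x : A ⊗[ℂ] A) : c.γinv (lact c.γ x) = Coalgebra.counit (R := ℂ) x := by
  rw [apply_lact_eq, c.convolution_inv]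

theorem γ_lact (x : A ⊗[ℂ] A) : c.γ (lact c.γinv x) = Coalgebra.counit (R := ℂ) x := by
  rw [apply_lact_eq, c.inv_convolution]

theorem leftTwist_eq (φ : A ⊗[ℂ] A →ₗ[ℂ] ℂ) : leftTwist φ = LinearMap.mul' ℂ A ∘ₗ lact φ := by
  ext a b
  simp only [leftTwist, lact, act, LinearMap.comp_apply, AlgebraTensorModule.curry_apply,
    TensorProduct.curry_apply, LinearMap.restrictScalars_apply, LinearEquiv.coe_coe]
  induction Coalgebra.comul (R := ℂ) (a ⊗ₜ[ℂ] b) with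
  | zero => simp only [map_zero]
  | add x y hx hy => simp only [map_add, hx, hy]
  | tmul x y => simp

/-- The deformed product is the old one after the left action of `γ` and the right action of `γ⁻¹`.
All computations in `A_γ` are done in this form. -/
theorem lift_mulA (x : A ⊗[ℂ] A) : TensorProduct.lift c.mulA x =
    LinearMap.mul' ℂ A (lact c.γ (ract c.γinv x)) := by
  have h : TensorProduct.lift c.mulA = TensorProduct.rid ℂ A ∘ₗ
      TensorProduct.map (leftTwist c.γ) c.γinv ∘ₗ Coalgebra.comul :=
    TensorProduct.ext' fun a b => rfl
  rw [h, leftTwist_eq]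
  simp only [LinearMap.comp_apply, LinearEquiv.coe_coe]
  rw [ract_apply]
  induction Coalgebra.comul (R := ℂ) x with
  | zero => simp only [map_zero]
  | add x y hx hy => simp only [map_add, hx, hy]
  | tmul x y => simp

theorem lact_lact_inv (x : A ⊗[ℂ] A) : lact c.γ (lact c.γinv x) = x := by
  rw [lact_lact]
  conv_rhs => rw [← lact_counit x]
  congr 2
  exact LinearMap.ext c.γ_lact

theorem ract_inv_ract (x : A ⊗[ℂ] A) : ract c.γinv (ract c.γ x) = x := by
  rw [ract_ract]
  conv_rhs => rw [← ract_counit x]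
  congr 2
  refine LinearMap.ext fun y => ?_
  rw [LinearMap.comp_apply, ← apply_lact]
  exact c.γ_lact y

/-- The twist `m ⊗ n ↦ γ(m₍₋₁₎ ⊗ n₍₋₁₎) m₍₀₎ ⊗ n₍₀₎`. -/
def twist (δM : M →ₗ[ℂ] A ⊗[ℂ] M) (δN : N →ₗ[ℂ] A ⊗[ℂ] N) : M ⊗[ℂ] N →ₗ[ℂ] M ⊗[ℂ] N :=
  act (coactTensor δM δN) c.γ

/-- The deformation only precomposes with an operator that does not depend on the bilinear map; this
separates the cocycle from the algebra. -/
theorem lift_deform (δM : M →ₗ[ℂ] A ⊗[ℂ] M) (δN : N →ₗ[ℂ] A ⊗[ℂ] N) (f : M →ₗ[ℂ] N →ₗ[ℂ] R)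
    (x : M ⊗[ℂ] N) :
    TensorProduct.lift (c.deform δM δN f) x = TensorProduct.lift f (c.twist δM δN x) := by
  have h : TensorProduct.lift (c.deform δM δN f) = TensorProduct.lid ℂ R ∘ₗ
      TensorProduct.map c.γ (TensorProduct.lift f) ∘ₗ coactTensor δM δN :=
    TensorProduct.ext' fun a b => rfl
  rw [h, twist, act_apply]
  simp only [LinearMap.comp_apply, LinearEquiv.coe_coe]
  induction coactTensor δM δN x with
  | zero => simp only [map_zero]
  | add x y hx hy => simp only [map_add, hx, hy]
  | tmul x y => simp

theorem deform_apply (δM : M →ₗ[ℂ] A ⊗[ℂ] M) (δN : N →ₗ[ℂ] A ⊗[ℂ] N) (f : M →ₗ[ℂ] N →ₗ[ℂ] R)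
    (x : M) (y : N) :
    c.deform δM δN f x y = TensorProduct.lift f (c.twist δM δN (x ⊗ₜ y)) :=
  c.lift_deform δM δN f (x ⊗ₜ y)

/-- The twist as a linear automorphism. -/
def twistEquiv (hM : IsComodule δM) (hN : IsComodule δN) : M ⊗[ℂ] N ≃ₗ[ℂ] M ⊗[ℂ] N :=
  LinearEquiv.ofLinearMap (c.twist δM δN) (act (coactTensor δM δN) c.γinv)
    (LinearMap.ext fun x => by
      rw [LinearMap.comp_apply, twist, (hM.coactTensor hN).act_act,
        show c.γ ∘ₗ lact c.γinv = Coalgebra.counit from LinearMap.ext c.γ_lact,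
        (hM.coactTensor hN).act_counit])
    (LinearMap.ext fun x => by
      rw [LinearMap.comp_apply, twist, (hM.coactTensor hN).act_act,
        show c.γinv ∘ₗ lact c.γ = Coalgebra.counit from LinearMap.ext c.γinv_lact,
        (hM.coactTensor hN).act_counit])

theorem twistEquiv_apply (hM : IsComodule δM) (hN : IsComodule δN) (x : M ⊗[ℂ] N) :
    c.twistEquiv hM hN x = c.twist δM δN x := rfl

theorem twist_map {M' N' : Type*} [AddCommGroup M'] [Module ℂ M'] [AddCommGroup N'] [Module ℂ N']
    {δM' : M' →ₗ[ℂ] A ⊗[ℂ] M'} {δN' : N' →ₗ[ℂ] A ⊗[ℂ] N'} {f : M →ₗ[ℂ] M'} {g : N →ₗ[ℂ] N'}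
    (hf : ∀ m, δM' (f m) = f.lTensor A (δM m)) (hg : ∀ n, δN' (g n) = g.lTensor A (δN n))
    (x : M ⊗[ℂ] N) :
    c.twist δM' δN' (TensorProduct.map f g x) = TensorProduct.map f g (c.twist δM δN x) :=
  (map_act (coactTensor_map hf hg) c.γ x).symm

/-- The twist intertwines the diagonal coactions of the deformed and of the original algebra. -/
theorem diagCoact_twist (hM : IsComodule δM) (hN : IsComodule δN) (x : M ⊗[ℂ] N) :
    diagCoact δM δN (c.twist δM δN x) = TensorProduct.map (TensorProduct.lift c.mulA)
      (c.twist δM δN) (coactTensor δM δN x) := by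
  have h1 : TensorProduct.lift c.mulA ∘ₗ ract c.γ = LinearMap.mul' ℂ A ∘ₗ lact c.γ :=
    LinearMap.ext fun y => by
      rw [LinearMap.comp_apply, lift_mulA, c.ract_inv_ract, LinearMap.comp_apply]
  rw [← LinearMap.rTensor_comp_lTensor, LinearMap.comp_apply, twist,
    (hM.coactTensor hN).lTensor_act, ← LinearMap.rTensor_comp_apply, h1,
    LinearMap.rTensor_comp_apply, ← (hM.coactTensor hN).coact_act]
  rfl

/-- Two successive twists are one action on the threefold tensor product, by the functional of the
left side of the cocycle identity. The companion below gives the right side. -/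
theorem twist_diagCoact_left (hM : IsComodule δM) (hN : IsComodule δN) (hP : IsComodule δP)
    (x : (M ⊗[ℂ] N) ⊗[ℂ] P) :
    c.twist (diagCoact δM δN) δP ((c.twist δM δN).rTensor P x) =
      act (coactTensor (coactTensor δM δN) δP) (c.γ ∘ₗ (leftTwist c.γ).rTensor A) x := by
  rw [twist, diagCoact, coactTensor_rTensor_comp_left, act_rTensor_comp, twist,
    ← act_tmul_counit hP, ((hM.coactTensor hN).coactTensor hP).act_act, LinearMap.comp_assoc,
    lact_tmul_counit, leftTwist_eq, LinearMap.rTensor_comp]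

theorem twist_diagCoact_right (hM : IsComodule δM) (hN : IsComodule δN) (hP : IsComodule δP)
    (x : M ⊗[ℂ] (N ⊗[ℂ] P)) :
    c.twist δM (diagCoact δN δP) ((c.twist δN δP).lTensor M x) =
      act (coactTensor δM (coactTensor δN δP)) (c.γ ∘ₗ (leftTwist c.γ).lTensor A) x := by
  rw [twist, diagCoact, coactTensor_rTensor_comp_right, act_rTensor_comp, twist,
    ← act_counit_tmul hM, (hM.coactTensor (hN.coactTensor hP)).act_act, LinearMap.comp_assoc,
    lact_counit_tmul, leftTwist_eq, LinearMap.lTensor_comp]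

theorem cocycle_comp_assoc : (c.γ ∘ₗ (leftTwist c.γ).lTensor A) ∘ₗ
    (TensorProduct.assoc ℂ A A A).toLinearMap = c.γ ∘ₗ (leftTwist c.γ).rTensor A :=
  TensorProduct.ext_threefold fun g h k => (c.cocycle g h k).symm

/-- Both orders of twisting are actions of a single functional on the threefold tensor product, and
the cocycle identity says that the two functionals agree. -/
theorem twist_assoc (hM : IsComodule δM) (hN : IsComodule δN) (hP : IsComodule δP)
    (x : (M ⊗[ℂ] N) ⊗[ℂ] P) :
    TensorProduct.assoc ℂ M N P
        (c.twist (diagCoact δM δN) δP ((c.twist δM δN).rTensor P x)) =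
      c.twist δM (diagCoact δN δP) ((c.twist δN δP).lTensor M (TensorProduct.assoc ℂ M N P x)) := by
  rw [c.twist_diagCoact_left hM hN hP, c.twist_diagCoact_right hM hN hP, act_coactTensor_assoc,
    cocycle_comp_assoc]

/-- Deformation preserves associativity relations between colinear products. -/
theorem deform_assoc {S T : Type*} [AddCommGroup S] [Module ℂ S] [AddCommGroup T] [Module ℂ T]
    {δS : S →ₗ[ℂ] A ⊗[ℂ] S} {δT : T →ₗ[ℂ] A ⊗[ℂ] T}
    (hM : IsComodule δM) (hN : IsComodule δN) (hP : IsComodule δP)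
    {f : M →ₗ[ℂ] N →ₗ[ℂ] S} {g : S →ₗ[ℂ] P →ₗ[ℂ] R} {f' : N →ₗ[ℂ] P →ₗ[ℂ] T}
    {g' : M →ₗ[ℂ] T →ₗ[ℂ] R}
    (hf : ∀ x y, δS (f x y) = TensorProduct.map₂ (LinearMap.mul ℂ A) f (δM x) (δN y))
    (hf' : ∀ x y, δT (f' x y) = TensorProduct.map₂ (LinearMap.mul ℂ A) f' (δN x) (δP y))
    (h : ∀ x y z, g (f x y) z = g' x (f' y z)) (x : M) (y : N) (z : P) :
    c.deform δS δP g (c.deform δM δN f x y) z = c.deform δM δT g' x (c.deform δN δP f' y z) := by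
  have hf₁ : ∀ w, δS (TensorProduct.lift f w) =
      (TensorProduct.lift f).lTensor A (diagCoact δM δN w) := by
    have : δS ∘ₗ TensorProduct.lift f = (TensorProduct.lift f).lTensor A ∘ₗ diagCoact δM δN :=
      TensorProduct.ext' fun x y => (hf x y).trans (map₂_mul_apply_eq f x y)
    exact LinearMap.congr_fun this
  have hf₂ : ∀ w, δT (TensorProduct.lift f' w) =
      (TensorProduct.lift f').lTensor A (diagCoact δN δP w) := by
    have : δT ∘ₗ TensorProduct.lift f' = (TensorProduct.lift f').lTensor A ∘ₗ diagCoact δN δP :=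
      TensorProduct.ext' fun x y => (hf' x y).trans (map₂_mul_apply_eq f' x y)
    exact LinearMap.congr_fun this
  have hassoc : ∀ w, TensorProduct.lift g (TensorProduct.map (TensorProduct.lift f) LinearMap.id w)
      = TensorProduct.lift g' (TensorProduct.map LinearMap.id (TensorProduct.lift f')
        (TensorProduct.assoc ℂ M N P w)) := by
    have : TensorProduct.lift g ∘ₗ TensorProduct.map (TensorProduct.lift f) LinearMap.id =
        TensorProduct.lift g' ∘ₗ TensorProduct.map LinearMap.id (TensorProduct.lift f') ∘ₗ
        (TensorProduct.assoc ℂ M N P).toLinearMap :=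
      TensorProduct.ext_threefold h
    exact LinearMap.congr_fun this
  have e1 : c.deform δS δP g (c.deform δM δN f x y) z = TensorProduct.lift g
      (TensorProduct.map (TensorProduct.lift f) LinearMap.id
        (c.twist (diagCoact δM δN) δP ((c.twist δM δN).rTensor P ((x ⊗ₜ y) ⊗ₜ z)))) := by
    -- Colinearity of the first product moves the outer twist in front of it, so that both twists
    -- act before any multiplication.
    rw [← c.twist_map hf₁ (by intro n; rw [LinearMap.lTensor_id]; rfl), deform_apply, deform_apply]
    rfl
  have e2 : c.deform δM δT g' x (c.deform δN δP f' y z) = TensorProduct.lift g'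
      (TensorProduct.map LinearMap.id (TensorProduct.lift f')
        (c.twist δM (diagCoact δN δP) ((c.twist δN δP).lTensor M (x ⊗ₜ (y ⊗ₜ z))))) := by
    rw [← c.twist_map (by intro n; rw [LinearMap.lTensor_id]; rfl) hf₂, deform_apply, deform_apply]
    rfl
  rw [e1, e2, hassoc, c.twist_assoc hM hN hP]
  rfl

/-- Colinearity of a deformed product. -/
theorem coact_deform {δR : R →ₗ[ℂ] A ⊗[ℂ] R} (hM : IsComodule δM) (hN : IsComodule δN)
    {f : M →ₗ[ℂ] N →ₗ[ℂ] R}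
    (hf : ∀ x y, δR (f x y) = TensorProduct.map₂ (LinearMap.mul ℂ A) f (δM x) (δN y))
    (x : M) (y : N) : δR (c.deform δM δN f x y) =
      TensorProduct.map₂ c.mulA (c.deform δM δN f) (δM x) (δN y) := by
  have hf₁ : δR ∘ₗ TensorProduct.lift f = (TensorProduct.lift f).lTensor A ∘ₗ diagCoact δM δN :=
    TensorProduct.ext' fun x y => (hf x y).trans (map₂_mul_apply_eq f x y)
  have h2 : TensorProduct.lift (c.deform δM δN f) = TensorProduct.lift f ∘ₗ c.twist δM δN :=
    LinearMap.ext (c.lift_deform δM δN f)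
  rw [deform_apply, map₂_apply_eq, h2]
  refine (LinearMap.congr_fun hf₁ _).trans ?_
  rw [LinearMap.comp_apply, c.diagCoact_twist hM hN, ← LinearMap.comp_apply, LinearMap.lTensor,
    ← TensorProduct.map_comp, LinearMap.id_comp]

/-- For a coinvariant `e` the normalization of `γ` turns the twist into the counit. This keeps the
unit of every deformed algebra. -/
theorem twist_one_tmul {e : M} (he : δM e = 1 ⊗ₜ e) (hN : IsComodule δN) (n : N) :
    c.twist δM δN (e ⊗ₜ n) = e ⊗ₜ n := by
  have key : ∀ y : A ⊗[ℂ] N, TensorProduct.lid ℂ _ (c.γ.rTensor (M ⊗[ℂ] N)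
      (tensorTensorTensorComm ℂ A M A N ((1 ⊗ₜ e) ⊗ₜ y))) =
      e ⊗ₜ TensorProduct.lid ℂ N (Coalgebra.counit.rTensor N y) := by
    intro y
    induction y with
    | zero => simp only [map_zero, TensorProduct.tmul_zero]
    | add x y hx hy => simp only [map_add, TensorProduct.tmul_add, hx, hy]
    | tmul a n => simp [c.one_apply]
  rw [twist, act_apply]
  conv_rhs => rw [← hN.counit n]
  rw [← key, ← he]
  rfl

theorem twist_tmul_one {e : N} (he : δN e = 1 ⊗ₜ e) (hM : IsComodule δM) (m : M) :
    c.twist δM δN (m ⊗ₜ e) = m ⊗ₜ e := by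
  have key : ∀ y : A ⊗[ℂ] M, TensorProduct.lid ℂ _ (c.γ.rTensor (M ⊗[ℂ] N)
      (tensorTensorTensorComm ℂ A M A N (y ⊗ₜ (1 ⊗ₜ e)))) =
      TensorProduct.lid ℂ M (Coalgebra.counit.rTensor M y) ⊗ₜ e := by
    intro y
    induction y with
    | zero => simp only [map_zero, TensorProduct.zero_tmul]
    | add x y hx hy => simp only [map_add, TensorProduct.add_tmul, hx, hy]
    | tmul a n => simp [c.apply_one, TensorProduct.smul_tmul']
  rw [twist, act_apply]
  conv_rhs => rw [← hM.counit m]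
  rw [← key, ← he]
  rfl

/-- The deformation of a comodule algebra. -/
theorem isComoduleAlgebra_deform {f : M →ₗ[ℂ] M →ₗ[ℂ] M} {e : M}
    (h : IsComoduleAlgebra (LinearMap.mul ℂ A) 1 f e δM) :
    IsComoduleAlgebra c.mulA 1 (c.deform δM δM f) e δM where
  algebra :=
    { assoc := c.deform_assoc h.comodule h.comodule h.comodule h.map_mul h.map_mul h.algebra.assoc
      one_mul := fun x => by
        rw [deform_apply, c.twist_one_tmul h.map_one h.comodule]; exact h.algebra.one_mul x
      mul_one := fun x => by
        rw [deform_apply, c.twist_tmul_one h.map_one h.comodule]; exact h.algebra.mul_one x }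
  comodule := h.comodule
  map_one := h.map_one
  map_mul := c.coact_deform h.comodule h.comodule h.map_mul

end UnitaryTwoCocycle

end Twist

end CocycleCalculus

end

noncomputable section

namespace CocycleCalculus

/-! ### The co-opposite of a commutative Hopf algebra -/

section Cop

open TensorProduct

/-- The co-opposite of a commutative Hopf algebra. -/
def Cop (A : Type*) : Type _ := A

variable {A : Type*} [CommRing A] [HopfAlgebra ℂ A]

instance : CommRing (Cop A) := inferInstanceAs (CommRing A)

instance : Algebra ℂ (Cop A) := inferInstanceAs (Algebra ℂ A)

variable (A) in
/-- The identity, as a map to the co-opposite. -/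
def toCop : A ≃ₐ[ℂ] Cop A := AlgEquiv.refl

/-- Reversing the three legs exchanges the two bracketings of the flipped coproduct, so
coassociativity of `A` gives coassociativity of the co-opposite. -/
theorem comm_comul_assoc (a : A) : TensorProduct.assoc ℂ A A A
    ((TensorProduct.comm ℂ A A ∘ₗ Coalgebra.comul (R := ℂ)).rTensor A
      (TensorProduct.comm ℂ A A (Coalgebra.comul (R := ℂ) a))) =
    (TensorProduct.comm ℂ A A ∘ₗ Coalgebra.comul (R := ℂ)).lTensor A
      (TensorProduct.comm ℂ A A (Coalgebra.comul (R := ℂ) a)) := by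
  let rev : A ⊗[ℂ] (A ⊗[ℂ] A) →ₗ[ℂ] A ⊗[ℂ] (A ⊗[ℂ] A) :=
    (TensorProduct.assoc ℂ A A A).toLinearMap ∘ₗ
      (TensorProduct.comm ℂ A (A ⊗[ℂ] A)).toLinearMap ∘ₗ
      (TensorProduct.comm ℂ A A).toLinearMap.lTensor A
  have h1 : (TensorProduct.assoc ℂ A A A).toLinearMap ∘ₗ
      (TensorProduct.comm ℂ A A).toLinearMap.rTensor A ∘ₗ
        (TensorProduct.comm ℂ A (A ⊗[ℂ] A)).toLinearMap = rev := by
    ext; simp [rev]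
  have h2 : (TensorProduct.comm ℂ A A).toLinearMap.lTensor A ∘ₗ
      (TensorProduct.comm ℂ (A ⊗[ℂ] A) A).toLinearMap =
        rev ∘ₗ (TensorProduct.assoc ℂ A A A).toLinearMap := by
    ext; simp [rev]
  have h3 : ∀ x : A ⊗[ℂ] A, (Coalgebra.comul (R := ℂ)).rTensor A (TensorProduct.comm ℂ A A x) =
      TensorProduct.comm ℂ A (A ⊗[ℂ] A) ((Coalgebra.comul (R := ℂ)).lTensor A x) := by
    intro x
    induction x with
    | zero => simp only [map_zero]
    | add x y hx hy => simp only [map_add, hx, hy]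
    | tmul a c => simp
  have h4 : ∀ x : A ⊗[ℂ] A, (Coalgebra.comul (R := ℂ)).lTensor A (TensorProduct.comm ℂ A A x) =
      TensorProduct.comm ℂ (A ⊗[ℂ] A) A ((Coalgebra.comul (R := ℂ)).rTensor A x) := by
    intro x
    induction x with
    | zero => simp only [map_zero]
    | add x y hx hy => simp only [map_add, hx, hy]
    | tmul a c => simp
  rw [LinearMap.rTensor_comp_apply, LinearMap.lTensor_comp_apply, h3, h4]
  refine Eq.trans ?_ (LinearMap.congr_fun h2 _).symm
  rw [LinearMap.comp_apply, LinearEquiv.coe_coe, Coalgebra.coassoc_apply, ← h1]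
  rfl

/-- The coproduct of the co-opposite. -/
def comulAlgHomCop (A : Type*) [CommRing A] [HopfAlgebra ℂ A] :
    Cop A →ₐ[ℂ] Cop A ⊗[ℂ] Cop A :=
  (Algebra.TensorProduct.map (toCop A).toAlgHom (toCop A).toAlgHom).comp
    ((Algebra.TensorProduct.comm ℂ A A).toAlgHom.comp
      ((Bialgebra.comulAlgHom ℂ A).comp (toCop A).symm.toAlgHom))

/-- The counit of the co-opposite. -/
def counitAlgHomCop (A : Type*) [CommRing A] [HopfAlgebra ℂ A] : Cop A →ₐ[ℂ] ℂ :=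
  (Bialgebra.counitAlgHom ℂ A).comp (toCop A).symm.toAlgHom

theorem comulAlgHomCop_apply (a : A) :
    comulAlgHomCop A (toCop A a) =
      TensorProduct.map (toCop A).toLinearMap (toCop A).toLinearMap
        (TensorProduct.comm ℂ A A (CoalgebraStruct.comul a)) :=
  rfl

theorem counitAlgHomCop_apply (a : A) :
    counitAlgHomCop A (toCop A a) = CoalgebraStruct.counit a :=
  rfl

instance : Coalgebra ℂ (Cop A) where
  comul := (comulAlgHomCop A).toLinearMap
  counit := (counitAlgHomCop A).toLinearMap
  coassoc := by
    refine LinearMap.ext fun c => ?_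
    obtain ⟨a, rfl⟩ := (toCop A).surjective c
    have h1 : (TensorProduct.assoc ℂ (Cop A) (Cop A) (Cop A)).toLinearMap ∘ₗ
        (comulAlgHomCop A).toLinearMap.rTensor (Cop A) ∘ₗ
        TensorProduct.map (toCop A).toLinearMap (toCop A).toLinearMap =
        TensorProduct.map (toCop A).toLinearMap
          (TensorProduct.map (toCop A).toLinearMap (toCop A).toLinearMap) ∘ₗ
        (TensorProduct.assoc ℂ A A A).toLinearMap ∘ₗ
          (TensorProduct.comm ℂ A A ∘ₗ Coalgebra.comul (R := ℂ)).rTensor A := by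
      refine TensorProduct.ext' fun a b => ?_
      simp only [LinearMap.comp_apply, TensorProduct.map_tmul, LinearMap.rTensor_tmul,
        AlgHom.toLinearMap_apply, AlgEquiv.toLinearMap_apply, comulAlgHomCop_apply,
        LinearEquiv.coe_coe]
      induction TensorProduct.comm ℂ A A (Coalgebra.comul (R := ℂ) a) with
      | zero => simp only [map_zero, TensorProduct.zero_tmul]
      | add x y hx hy => simp only [map_add, TensorProduct.add_tmul, hx, hy]
      | tmul a c => simp
    have h2 : (comulAlgHomCop A).toLinearMap.lTensor (Cop A) ∘ₗ
        TensorProduct.map (toCop A).toLinearMap (toCop A).toLinearMap =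
        TensorProduct.map (toCop A).toLinearMap
          (TensorProduct.map (toCop A).toLinearMap (toCop A).toLinearMap) ∘ₗ
          (TensorProduct.comm ℂ A A ∘ₗ Coalgebra.comul (R := ℂ)).lTensor A := by
      refine TensorProduct.ext' fun a b => ?_
      simp only [LinearMap.comp_apply, TensorProduct.map_tmul, LinearMap.lTensor_tmul,
        AlgHom.toLinearMap_apply, AlgEquiv.toLinearMap_apply, comulAlgHomCop_apply,
        LinearEquiv.coe_coe]
    refine (LinearMap.congr_fun h1 _).trans
      (Eq.trans ?_ (LinearMap.congr_fun h2 (TensorProduct.comm ℂ A A (Coalgebra.comul a))).symm)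
    exact congrArg _ (comm_comul_assoc a)
  rTensor_counit_comp_comul := by
    refine LinearMap.ext fun c => ?_
    obtain ⟨a, rfl⟩ := (toCop A).surjective c
    have : (counitAlgHomCop A).toLinearMap.rTensor (Cop A) ∘ₗ
        TensorProduct.map (toCop A).toLinearMap (toCop A).toLinearMap ∘ₗ
        (TensorProduct.comm ℂ A A).toLinearMap =
        (toCop A).toLinearMap.lTensor ℂ ∘ₗ (TensorProduct.comm ℂ A ℂ).toLinearMap ∘ₗ
          (Coalgebra.counit (R := ℂ)).lTensor A := by
      refine TensorProduct.ext' fun a b => ?_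
      simp [counitAlgHomCop_apply]
    refine (LinearMap.congr_fun this (Coalgebra.comul a)).trans ?_
    rw [LinearMap.comp_apply, LinearMap.comp_apply, Coalgebra.lTensor_counit_comul]
    simp
  lTensor_counit_comp_comul := by
    refine LinearMap.ext fun c => ?_
    obtain ⟨a, rfl⟩ := (toCop A).surjective c
    have : (counitAlgHomCop A).toLinearMap.lTensor (Cop A) ∘ₗ
        TensorProduct.map (toCop A).toLinearMap (toCop A).toLinearMap ∘ₗ
        (TensorProduct.comm ℂ A A).toLinearMap =
        (toCop A).toLinearMap.rTensor ℂ ∘ₗ (TensorProduct.comm ℂ ℂ A).toLinearMap ∘ₗ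
          (Coalgebra.counit (R := ℂ)).rTensor A := by
      refine TensorProduct.ext' fun a b => ?_
      simp [counitAlgHomCop_apply]
    refine (LinearMap.congr_fun this (Coalgebra.comul a)).trans ?_
    rw [LinearMap.comp_apply, LinearMap.comp_apply, Coalgebra.rTensor_counit_comul]
    simp

theorem comul_toCop (a : A) : Coalgebra.comul (R := ℂ) (toCop A a) =
    TensorProduct.map (toCop A).toLinearMap (toCop A).toLinearMap
      (TensorProduct.comm ℂ A A (Coalgebra.comul (R := ℂ) a)) := rfl

theorem counit_toCop (a : A) : Coalgebra.counit (R := ℂ) (toCop A a) =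
    Coalgebra.counit (R := ℂ) a := rfl

instance : Bialgebra ℂ (Cop A) :=
  Bialgebra.mk' ℂ (Cop A) (map_one (counitAlgHomCop A)) (map_mul (counitAlgHomCop A) _ _)
    (map_one (comulAlgHomCop A)) (map_mul (comulAlgHomCop A) _ _)

instance : HopfAlgebra ℂ (Cop A) where
  antipode := (toCop A).toLinearMap ∘ₗ HopfAlgebra.antipode ℂ ∘ₗ (toCop A).symm.toLinearMap
  mul_antipode_rTensor_comul := by
    refine LinearMap.ext fun c => ?_
    obtain ⟨a, rfl⟩ := (toCop A).surjective c
    refine Eq.trans ?_ (congrArg (toCop A) (HopfAlgebra.mul_antipode_lTensor_comul_apply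
      (R := ℂ) a))
    rw [LinearMap.comp_apply, LinearMap.comp_apply, comul_toCop]
    induction Coalgebra.comul (R := ℂ) a with
    | zero => simp only [map_zero]
    | add x y hx hy => simp only [map_add, hx, hy]
    | tmul a c => simp [mul_comm]
  mul_antipode_lTensor_comul := by
    refine LinearMap.ext fun c => ?_
    obtain ⟨a, rfl⟩ := (toCop A).surjective c
    refine Eq.trans ?_ (congrArg (toCop A) (HopfAlgebra.mul_antipode_rTensor_comul_apply
      (R := ℂ) a))
    rw [LinearMap.comp_apply, LinearMap.comp_apply, comul_toCop]
    induction Coalgebra.comul (R := ℂ) a with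
    | zero => simp only [map_zero]
    | add x y hx hy => simp only [map_add, hx, hy]
    | tmul a c => simp [mul_comm]

theorem antipode_toCop (a : A) : HopfAlgebra.antipode ℂ (toCop A a) =
    toCop A (HopfAlgebra.antipode ℂ a) := rfl

theorem lact_toCop (φ : Cop A →ₗ[ℂ] ℂ) (a : A) :
    lact φ (toCop A a) = toCop A (ract (φ ∘ₗ (toCop A).toLinearMap) a) := by
  rw [lact, act_apply, ract_apply, comul_toCop]
  induction Coalgebra.comul (R := ℂ) a with
  | zero => simp only [map_zero]
  | add x y hx hy => simp only [map_add, hx, hy]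
  | tmul a c => simp

theorem ract_toCop (φ : Cop A →ₗ[ℂ] ℂ) (a : A) :
    ract φ (toCop A a) = toCop A (lact (φ ∘ₗ (toCop A).toLinearMap) a) := by
  rw [lact, act_apply, ract_apply, comul_toCop]
  induction Coalgebra.comul (R := ℂ) a with
  | zero => simp only [map_zero]
  | add x y hx hy => simp only [map_add, hx, hy]
  | tmul a c => simp

/-- Both sides are `a₍₁₎ ⊗ a₍₂₎ ⊗ a₍₃₎ ⊗ a₍₄₎`; on the right the inner legs `a₍₂₎`, `a₍₃₎` are
exposed as a coproduct. -/
theorem comul_comul_nested {C : Type*} [AddCommGroup C] [Module ℂ C] [Coalgebra ℂ C] (a : C) :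
    TensorProduct.assoc ℂ C C (C ⊗[ℂ] C) (TensorProduct.map (Coalgebra.comul (R := ℂ))
      (Coalgebra.comul (R := ℂ)) (Coalgebra.comul (R := ℂ) a)) =
    ((TensorProduct.assoc ℂ C C C).toLinearMap ∘ₗ (Coalgebra.comul (R := ℂ)).rTensor C ∘ₗ
      Coalgebra.comul (R := ℂ)).lTensor C (Coalgebra.comul (R := ℂ) a) := by
  have h1 : (TensorProduct.assoc ℂ C C (C ⊗[ℂ] C)).toLinearMap ∘ₗ
      (Coalgebra.comul (R := ℂ)).lTensor (C ⊗[ℂ] C) =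
      ((Coalgebra.comul (R := ℂ)).lTensor C).lTensor C ∘ₗ
        (TensorProduct.assoc ℂ C C C).toLinearMap := by
    ext; simp
  rw [Coalgebra.coassoc, LinearMap.lTensor_comp_apply, ← Coalgebra.coassoc_apply,
    ← LinearMap.lTensor_comp_rTensor, LinearMap.comp_apply]
  exact LinearMap.congr_fun h1 _

/-- The coproduct of `A`, as a map to `A^cop ⊗ A`. -/
def comulCop (A : Type*) [CommRing A] [HopfAlgebra ℂ A] : A →ₗ[ℂ] Cop A ⊗[ℂ] A :=
  (toCop A).toLinearMap.rTensor A ∘ₗ Coalgebra.comul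

theorem comul_rTensor_toCop (x : A ⊗[ℂ] A) :
    Coalgebra.comul (R := ℂ) ((toCop A).toLinearMap.rTensor A x) =
      TensorProduct.map ((toCop A).toLinearMap.rTensor A) ((toCop A).toLinearMap.rTensor A)
        (TensorProduct.leftComm ℂ A (A ⊗[ℂ] A) A
        ((TensorProduct.assoc ℂ A A A).symm.toLinearMap.lTensor A
          (TensorProduct.assoc ℂ A A (A ⊗[ℂ] A)
          (TensorProduct.map (Coalgebra.comul (R := ℂ)) (Coalgebra.comul (R := ℂ)) x)))) := by
  have key : (tensorTensorTensorComm ℂ (Cop A) (Cop A) A A).toLinearMap ∘ₗ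
      (TensorProduct.map (toCop A).toLinearMap (toCop A).toLinearMap ∘ₗ
        (TensorProduct.comm ℂ A A).toLinearMap).rTensor (A ⊗[ℂ] A) =
      TensorProduct.map ((toCop A).toLinearMap.rTensor A) ((toCop A).toLinearMap.rTensor A) ∘ₗ
      (TensorProduct.leftComm ℂ A (A ⊗[ℂ] A) A).toLinearMap ∘ₗ
      (TensorProduct.assoc ℂ A A A).symm.toLinearMap.lTensor A ∘ₗ
        (TensorProduct.assoc ℂ A A (A ⊗[ℂ] A)).toLinearMap := by
    ext; simp
  induction x with
  | zero => simp only [map_zero]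
  | add x y hx hy => simp only [map_add, hx, hy]
  | tmul a b => exact LinearMap.congr_fun key (Coalgebra.comul a ⊗ₜ Coalgebra.comul b)

/-- The expression `Σ X(a₍₂₎ ⊗ a₍₃₎) ⊗ (a₍₁₎ ⊗ a₍₄₎)`. -/
theorem rTensor_comul_comulCop {V : Type*} [AddCommGroup V] [Module ℂ V]
    (X : Cop A ⊗[ℂ] A →ₗ[ℂ] V) (a : A) :
    X.rTensor (Cop A ⊗[ℂ] A) (Coalgebra.comul (R := ℂ) (comulCop A a)) =
      ((toCop A).toLinearMap.rTensor A).lTensor V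
        (TensorProduct.leftComm ℂ A V A (((X ∘ₗ comulCop A).rTensor A ∘ₗ
        Coalgebra.comul (R := ℂ)).lTensor A (Coalgebra.comul (R := ℂ) a))) := by
  have h2 : X.rTensor (Cop A ⊗[ℂ] A) ∘ₗ
      TensorProduct.map ((toCop A).toLinearMap.rTensor A) ((toCop A).toLinearMap.rTensor A) ∘ₗ
      (TensorProduct.leftComm ℂ A (A ⊗[ℂ] A) A).toLinearMap =
      ((toCop A).toLinearMap.rTensor A).lTensor V ∘ₗ
      (TensorProduct.leftComm ℂ A V A).toLinearMap ∘ₗ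
        ((X ∘ₗ (toCop A).toLinearMap.rTensor A).rTensor A).lTensor A := by
    ext; simp
  have h3 : (TensorProduct.assoc ℂ A A A).symm.toLinearMap ∘ₗ
      (TensorProduct.assoc ℂ A A A).toLinearMap ∘ₗ (Coalgebra.comul (R := ℂ)).rTensor A ∘ₗ
      Coalgebra.comul (R := ℂ) = (Coalgebra.comul (R := ℂ)).rTensor A ∘ₗ
      Coalgebra.comul (R := ℂ) := by
    rw [← LinearMap.comp_assoc, LinearEquiv.symm_comp, LinearMap.id_comp]
  rw [comulCop, LinearMap.comp_apply, comul_rTensor_toCop, comul_comul_nested,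
    ← LinearMap.lTensor_comp_apply, h3]
  refine (LinearMap.congr_fun h2 _).trans ?_
  rw [LinearMap.comp_apply, LinearMap.comp_apply, ← LinearMap.lTensor_comp_apply,
    ← LinearMap.comp_assoc, ← LinearMap.rTensor_comp]
  rfl

variable (A) in
/-- The map `a ⊗ b ↦ S(a) b` on `A^cop ⊗ A`. -/
def antipodeMul : Cop A ⊗[ℂ] A →ₗ[ℂ] A :=
  LinearMap.mul' ℂ A ∘ₗ (HopfAlgebra.antipode ℂ ∘ₗ (toCop A).symm.toLinearMap).rTensor A

theorem antipodeMul_comulCop (a : A) :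
    antipodeMul A (comulCop A a) = Coalgebra.counit (R := ℂ) a • (1 : A) := by
  rw [← Algebra.algebraMap_eq_smul_one, ← HopfAlgebra.mul_antipode_rTensor_comul_apply, antipodeMul,
    comulCop, LinearMap.comp_apply, LinearMap.comp_apply, ← LinearMap.rTensor_comp_apply]
  rfl

/-- In `Σ S(a₍₂₎) a₍₃₎ ⊗ (a₍₁₎ ⊗ a₍₄₎)` the inner legs cancel. -/
theorem rTensor_antipodeMul (a : A) :
    (antipodeMul A).rTensor (Cop A ⊗[ℂ] A) (Coalgebra.comul (R := ℂ) (comulCop A a)) =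
      1 ⊗ₜ comulCop A a := by
  have h1 : antipodeMul A ∘ₗ comulCop A = (LinearMap.toSpanSingleton ℂ A 1) ∘ₗ
      Coalgebra.counit (R := ℂ) := LinearMap.ext antipodeMul_comulCop
  have h2 : (antipodeMul A ∘ₗ comulCop A).rTensor A ∘ₗ Coalgebra.comul (R := ℂ) =
      (TensorProduct.mk ℂ A A 1) := by
    rw [h1, LinearMap.rTensor_comp, LinearMap.comp_assoc, Coalgebra.rTensor_counit_comp_comul]
    ext; simp
  rw [rTensor_comul_comulCop, h2, comulCop, LinearMap.comp_apply]
  generalize Coalgebra.comul (R := ℂ) a = x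
  induction x with
  | zero => simp only [map_zero, TensorProduct.tmul_zero]
  | add x y hx hy => simp only [map_add, TensorProduct.tmul_add, hx, hy]
  | tmul a c => simp

/-- In the coproduct of `A^cop ⊗ A` the first factor of the image of `a` carries the inner legs. A
functional on them is a functional of one leg of `a`, which acts on the right of its neighbour. -/
theorem lact_comulCop (φ : Cop A ⊗[ℂ] A →ₗ[ℂ] ℂ) (a : A) :
    lact φ (comulCop A a) = (toCop A).toLinearMap.rTensor A
      ((ract (φ ∘ₗ comulCop A)).rTensor A (Coalgebra.comul (R := ℂ) a)) := by
  rw [lact, act_apply, rTensor_comul_comulCop, ← lTensor_lact, LinearMap.lTensor_comp_apply]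
  have key : (TensorProduct.lid ℂ (Cop A ⊗[ℂ] A)).toLinearMap ∘ₗ
      ((toCop A).toLinearMap.rTensor A).lTensor ℂ ∘ₗ
      (TensorProduct.leftComm ℂ A ℂ A).toLinearMap =
      (toCop A).toLinearMap.rTensor A ∘ₗ (TensorProduct.lid ℂ A).toLinearMap.lTensor A := by
    ext; simp
  refine (LinearMap.congr_fun key _).trans ?_
  rw [LinearMap.comp_apply, ← LinearMap.lTensor_comp_apply, ← LinearMap.lTensor_comp_apply]
  rfl

/-- The functional takes the outer legs and the inner ones cancel by the antipode. -/
theorem antipodeMul_ract (φ : Cop A ⊗[ℂ] A →ₗ[ℂ] ℂ) (a : A) :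
    antipodeMul A (ract φ (comulCop A a)) = φ (comulCop A a) • (1 : A) := by
  have h := congrArg (fun x => TensorProduct.rid ℂ A (φ.lTensor A x)) (rTensor_antipodeMul a)
  simp only [LinearMap.lTensor_tmul, TensorProduct.rid_tmul] at h
  rw [← h, ract_apply]
  generalize Coalgebra.comul (R := ℂ) (comulCop A a) = x
  induction x with
  | zero => simp only [map_zero]
  | add x y hx hy => simp only [map_add, hx, hy]
  | tmul a c => simp

/-- The antipode is anticomultiplicative. -/
theorem comul_antipode (a : A) : Coalgebra.comul (R := ℂ) (HopfAlgebra.antipode ℂ a) =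
    TensorProduct.map (HopfAlgebra.antipode ℂ) (HopfAlgebra.antipode ℂ)
      (TensorProduct.comm ℂ A A (Coalgebra.comul (R := ℂ) a)) := by
  -- `G` is a left convolution inverse of the coproduct by two cancellations of nested legs, and the
  -- coproduct of the antipode is a right inverse.
  let G : A →ₗ[ℂ] A ⊗[ℂ] A := TensorProduct.map (HopfAlgebra.antipode ℂ) (HopfAlgebra.antipode ℂ)
    ∘ₗ TensorProduct.comm ℂ A A ∘ₗ Coalgebra.comul (R := ℂ)
  have h1 : WithConv.toConv G * WithConv.toConv (Coalgebra.comul (R := ℂ) (A := A)) = 1 := by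
    refine WithConv.ofConv_injective (LinearMap.ext fun a => ?_)
    have key : ∀ x : A ⊗[ℂ] A, LinearMap.mul' ℂ (A ⊗[ℂ] A)
        (TensorProduct.map G (Coalgebra.comul (R := ℂ) (A := A)) x) =
        TensorProduct.map (antipodeMul A) (antipodeMul A) (Coalgebra.comul (R := ℂ)
          ((toCop A).toLinearMap.rTensor A x)) := by
      intro x
      induction x with
      | zero => simp only [map_zero]
      | add x y hx hy => simp only [map_add, hx, hy]
      | tmul a b =>
        have k : LinearMap.mul' ℂ (A ⊗[ℂ] A) ∘ₗ (TensorProduct.map (HopfAlgebra.antipode ℂ)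
          (HopfAlgebra.antipode ℂ)).rTensor (A ⊗[ℂ] A) =
            TensorProduct.map (antipodeMul A) (antipodeMul A) ∘ₗ
              (tensorTensorTensorComm ℂ (Cop A) (Cop A) A A).toLinearMap ∘ₗ
              (TensorProduct.map (toCop A).toLinearMap (toCop A).toLinearMap).rTensor _ := by
          ext; simp [antipodeMul]
        exact LinearMap.congr_fun k
          (TensorProduct.comm ℂ A A (Coalgebra.comul a) ⊗ₜ Coalgebra.comul b)
    refine (key _).trans ?_
    have := congrArg ((antipodeMul A).lTensor A) (rTensor_antipodeMul a)
    rw [← LinearMap.comp_apply, LinearMap.lTensor_comp_rTensor, LinearMap.lTensor_tmul,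
      antipodeMul_comulCop] at this
    refine this.trans ?_
    rw [TensorProduct.tmul_smul, ← Algebra.TensorProduct.one_def, ← Algebra.algebraMap_eq_smul_one]
    rfl
  have h2 := left_inv_eq_right_inv h1 LinearMap.comul_right_inv
  exact (LinearMap.congr_fun (congrArg WithConv.ofConv h2) a).symm

end Cop

end CocycleCalculus

end

noncomputable section

namespace CocycleCalculus

/-! ### Two-cocycles and the deformed bialgebra -/

section TwoCocycle

open TensorProduct

theorem comul_map {C C' D D' : Type*} [AddCommGroup C] [Module ℂ C] [Coalgebra ℂ C]
    [AddCommGroup C'] [Module ℂ C'] [Coalgebra ℂ C'] [AddCommGroup D] [Module ℂ D]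
    [Coalgebra ℂ D] [AddCommGroup D'] [Module ℂ D'] [Coalgebra ℂ D'] {f : C →ₗ[ℂ] D}
    {g : C' →ₗ[ℂ] D'}
    (hf : ∀ c, Coalgebra.comul (R := ℂ) (f c) = TensorProduct.map f f (Coalgebra.comul (R := ℂ) c))
    (hg : ∀ c, Coalgebra.comul (R := ℂ) (g c) = TensorProduct.map g g (Coalgebra.comul (R := ℂ) c))
    (x : C ⊗[ℂ] C') : Coalgebra.comul (R := ℂ) (TensorProduct.map f g x) =
      TensorProduct.map (TensorProduct.map f g) (TensorProduct.map f g)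
        (Coalgebra.comul (R := ℂ) x) := by
  have key : (tensorTensorTensorComm ℂ D D D' D').toLinearMap ∘ₗ
      TensorProduct.map (TensorProduct.map f f) (TensorProduct.map g g) =
      TensorProduct.map (TensorProduct.map f g) (TensorProduct.map f g) ∘ₗ
      (tensorTensorTensorComm ℂ C C C' C').toLinearMap := by
    ext; simp
  induction x with
  | zero => simp only [map_zero]
  | add x y hx hy => simp only [map_add, hx, hy]
  | tmul a b =>
    refine Eq.trans ?_ (LinearMap.congr_fun key (Coalgebra.comul a ⊗ₜ Coalgebra.comul b))
    change tensorTensorTensorComm ℂ D D D' D' (Coalgebra.comul (f a) ⊗ₜ Coalgebra.comul (g b)) = _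
    rw [hf, hg]
    rfl

theorem comul_id {C : Type*} [AddCommGroup C] [Module ℂ C] [Coalgebra ℂ C] (c : C) :
    Coalgebra.comul (R := ℂ) (LinearMap.id (R := ℂ) c) =
      TensorProduct.map LinearMap.id LinearMap.id (Coalgebra.comul (R := ℂ) c) := by
  rw [TensorProduct.map_id]; rfl

theorem comul_assoc {C C' C'' : Type*} [AddCommGroup C] [Module ℂ C] [Coalgebra ℂ C]
    [AddCommGroup C'] [Module ℂ C'] [Coalgebra ℂ C'] [AddCommGroup C''] [Module ℂ C'']
    [Coalgebra ℂ C''] (x : (C ⊗[ℂ] C') ⊗[ℂ] C'') :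
    Coalgebra.comul (R := ℂ) ((TensorProduct.assoc ℂ C C' C'').toLinearMap x) =
      TensorProduct.map (TensorProduct.assoc ℂ C C' C'').toLinearMap
        (TensorProduct.assoc ℂ C C' C'').toLinearMap (Coalgebra.comul (R := ℂ) x) :=
  coactTensor_assoc Coalgebra.comul Coalgebra.comul Coalgebra.comul x

variable {A : Type*} [Ring A] [HopfAlgebra ℂ A]

theorem comul_rTensor_mul' (x : (A ⊗[ℂ] A) ⊗[ℂ] A) :
    Coalgebra.comul (R := ℂ) ((LinearMap.mul' ℂ A).rTensor A x) =
      TensorProduct.map ((LinearMap.mul' ℂ A).rTensor A) ((LinearMap.mul' ℂ A).rTensor A)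
        (Coalgebra.comul (R := ℂ) x) :=
  comul_map comul_mul' comul_id x

theorem comul_lTensor_mul' (x : A ⊗[ℂ] (A ⊗[ℂ] A)) :
    Coalgebra.comul (R := ℂ) ((LinearMap.mul' ℂ A).lTensor A x) =
      TensorProduct.map ((LinearMap.mul' ℂ A).lTensor A) ((LinearMap.mul' ℂ A).lTensor A)
        (Coalgebra.comul (R := ℂ) x) :=
  comul_map comul_id comul_mul' x

/-- `γ` and `γ'` are mutually inverse normalized 2-cocycles on `A`; the equations for `γ'` are
consequences of those for `γ`. -/
structure TwoCocycle (γ γ' : A ⊗[ℂ] A →ₗ[ℂ] ℂ) : Prop where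
  inv_lact : ∀ x, γ' (lact γ x) = Coalgebra.counit (R := ℂ) x
  lact_inv : ∀ x, γ (lact γ' x) = Coalgebra.counit (R := ℂ) x
  cocycle : ∀ g h k, γ (LinearMap.mul' ℂ A (lact γ (g ⊗ₜ h)) ⊗ₜ k) =
    γ (g ⊗ₜ LinearMap.mul' ℂ A (lact γ (h ⊗ₜ k)))
  cocycle_inv : ∀ g h k, γ' (LinearMap.mul' ℂ A (ract γ' (g ⊗ₜ h)) ⊗ₜ k) =
    γ' (g ⊗ₜ LinearMap.mul' ℂ A (ract γ' (h ⊗ₜ k)))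
  apply_one : ∀ h, γ (h ⊗ₜ 1) = Coalgebra.counit (R := ℂ) h
  one_apply : ∀ h, γ (1 ⊗ₜ h) = Coalgebra.counit (R := ℂ) h
  inv_apply_one : ∀ h, γ' (h ⊗ₜ 1) = Coalgebra.counit (R := ℂ) h
  inv_one_apply : ∀ h, γ' (1 ⊗ₜ h) = Coalgebra.counit (R := ℂ) h

theorem lact_lact_eq_id {C : Type*} [AddCommGroup C] [Module ℂ C] [Coalgebra ℂ C]
    {φ ψ : C →ₗ[ℂ] ℂ} (h : ∀ x, φ (lact ψ x) = Coalgebra.counit (R := ℂ) x) (x : C) :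
    lact φ (lact ψ x) = x := by
  rw [lact_lact, show φ ∘ₗ lact ψ = Coalgebra.counit from LinearMap.ext h, lact_counit]

theorem ract_ract_eq_id {C : Type*} [AddCommGroup C] [Module ℂ C] [Coalgebra ℂ C]
    {φ ψ : C →ₗ[ℂ] ℂ} (h : ∀ x, φ (lact ψ x) = Coalgebra.counit (R := ℂ) x) (x : C) :
    ract ψ (ract φ x) = x := by
  rw [ract_ract, show ψ ∘ₗ ract φ = Coalgebra.counit from
    LinearMap.ext fun y => (apply_lact ψ φ y).symm.trans (h y), ract_counit]

/-- The pull-back of a convolution inverse along a coalgebra map. -/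
theorem apply_lact_comp {C D : Type*} [AddCommGroup C] [Module ℂ C] [Coalgebra ℂ C]
    [AddCommGroup D] [Module ℂ D] [Coalgebra ℂ D] {π : C →ₗ[ℂ] D}
    (hπ : ∀ c, Coalgebra.comul (R := ℂ) (π c) = TensorProduct.map π π (Coalgebra.comul (R := ℂ) c))
    (hε : ∀ c, Coalgebra.counit (R := ℂ) (π c) = Coalgebra.counit (R := ℂ) c)
    {φ ψ : D →ₗ[ℂ] ℂ} (h : ∀ x, φ (lact ψ x) = Coalgebra.counit (R := ℂ) x) (x : C) :
    (φ ∘ₗ π) (lact (ψ ∘ₗ π) x) = Coalgebra.counit (R := ℂ) x := by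
  rw [LinearMap.comp_apply, ← lact_map hπ, h, hε]

theorem counit_rTensor_mul' (x : (A ⊗[ℂ] A) ⊗[ℂ] A) :
    Coalgebra.counit (R := ℂ) ((LinearMap.mul' ℂ A).rTensor A x) =
      Coalgebra.counit (R := ℂ) x := by
  induction x with
  | zero => simp only [map_zero]
  | add x y hx hy => simp only [map_add, hx, hy]
  | tmul a b => rw [LinearMap.rTensor_tmul, TensorProduct.counit_tmul, counit_mul',
      TensorProduct.counit_tmul]

theorem counit_lTensor_mul' (x : A ⊗[ℂ] (A ⊗[ℂ] A)) :
    Coalgebra.counit (R := ℂ) ((LinearMap.mul' ℂ A).lTensor A x) =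
      Coalgebra.counit (R := ℂ) x := by
  induction x with
  | zero => simp only [map_zero]
  | add x y hx hy => simp only [map_add, hx, hy]
  | tmul a b => rw [LinearMap.lTensor_tmul, TensorProduct.counit_tmul, counit_mul',
      TensorProduct.counit_tmul]

namespace UnitaryTwoCocycle

variable {star : A → A} (c : UnitaryTwoCocycle star)

/-- The operator of one side of the cocycle identity factors into the operators of `φ` on two legs
and of `φ` pulled back along the multiplication. Each factor is invertible for `φ = γ`. -/
theorem lact_leftTwist_rTensor (φ : A ⊗[ℂ] A →ₗ[ℂ] ℂ) (x : (A ⊗[ℂ] A) ⊗[ℂ] A) :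
    lact (φ ∘ₗ (leftTwist φ).rTensor A) x =
      lact (φ ∘ₗ (LinearMap.mul' ℂ A).rTensor A) ((lact φ).rTensor A x) := by
  rw [← lact_tmul_counit, lact_lact, lact_tmul_counit, leftTwist_eq, LinearMap.rTensor_comp,
    LinearMap.comp_assoc]

theorem lact_leftTwist_lTensor (φ : A ⊗[ℂ] A →ₗ[ℂ] ℂ) (x : A ⊗[ℂ] (A ⊗[ℂ] A)) :
    lact (φ ∘ₗ (leftTwist φ).lTensor A) x =
      lact (φ ∘ₗ (LinearMap.mul' ℂ A).lTensor A) ((lact φ).lTensor A x) := by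
  rw [← lact_counit_tmul, lact_lact, lact_counit_tmul, leftTwist_eq, LinearMap.lTensor_comp,
    LinearMap.comp_assoc]

/-- The map `a ⊗ b ↦ a₍₁₎ b₍₁₎ φ(a₍₂₎ ⊗ b₍₂₎)`. -/
def rightTwist (φ : A ⊗[ℂ] A →ₗ[ℂ] ℂ) : A ⊗[ℂ] A →ₗ[ℂ] A := LinearMap.mul' ℂ A ∘ₗ ract φ

/-- For the inverse cocycle the same factors occur in the opposite order, as befits an inverse. -/
theorem lact_rightTwist_rTensor (φ : A ⊗[ℂ] A →ₗ[ℂ] ℂ) (x : (A ⊗[ℂ] A) ⊗[ℂ] A) :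
    lact (φ ∘ₗ (rightTwist φ).rTensor A) x =
      (lact φ).rTensor A (lact (φ ∘ₗ (LinearMap.mul' ℂ A).rTensor A) x) := by
  rw [← lact_tmul_counit, lact_lact]
  congr 2
  refine LinearMap.ext fun y => ?_
  rw [LinearMap.comp_apply _ (lact _), apply_lact, ract_tmul_counit, rightTwist,
    LinearMap.rTensor_comp]
  rfl

theorem lact_rightTwist_lTensor (φ : A ⊗[ℂ] A →ₗ[ℂ] ℂ) (x : A ⊗[ℂ] (A ⊗[ℂ] A)) :
    lact (φ ∘ₗ (rightTwist φ).lTensor A) x =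
      (lact φ).lTensor A (lact (φ ∘ₗ (LinearMap.mul' ℂ A).lTensor A) x) := by
  rw [← lact_counit_tmul, lact_lact]
  congr 2
  refine LinearMap.ext fun y => ?_
  rw [LinearMap.comp_apply _ (lact _), apply_lact, ract_counit_tmul, rightTwist,
    LinearMap.lTensor_comp]
  rfl

theorem inv_lact_lact (x : A ⊗[ℂ] A) : lact c.γinv (lact c.γ x) = x :=
  lact_lact_eq_id c.γinv_lact x

theorem ract_ract_inv (x : A ⊗[ℂ] A) : ract c.γ (ract c.γinv x) = x :=
  ract_ract_eq_id c.γinv_lact x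

/-- The two triple functionals built from `γ⁻¹` are convolution inverses of the two built from `γ`.
The latter agree, hence so do the former. -/
theorem inv_cocycle : (c.γinv ∘ₗ (rightTwist c.γinv).lTensor A) ∘ₗ
    (TensorProduct.assoc ℂ A A A).toLinearMap = c.γinv ∘ₗ (rightTwist c.γinv).rTensor A := by
  have h1 : ∀ x, lact (c.γinv ∘ₗ (rightTwist c.γinv).rTensor A)
      (lact (c.γ ∘ₗ (leftTwist c.γ).rTensor A) x) = x := fun x => by
    rw [lact_rightTwist_rTensor, lact_leftTwist_rTensor, lact_lact_eq_id
      (apply_lact_comp comul_rTensor_mul' counit_rTensor_mul' c.γinv_lact),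
      ← LinearMap.rTensor_comp_apply, show lact c.γinv ∘ₗ lact c.γ = LinearMap.id from
      LinearMap.ext c.inv_lact_lact, LinearMap.rTensor_id]
    rfl
  have h2 : ∀ x, lact (c.γ ∘ₗ (leftTwist c.γ).lTensor A)
      (lact (c.γinv ∘ₗ (rightTwist c.γinv).lTensor A) x) = x := fun x => by
    rw [lact_leftTwist_lTensor, lact_rightTwist_lTensor,
      ← LinearMap.lTensor_comp_apply, show lact c.γ ∘ₗ lact c.γinv = LinearMap.id from
      LinearMap.ext c.lact_lact_inv, LinearMap.lTensor_id, LinearMap.id_apply, lact_lact_eq_id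
      (apply_lact_comp comul_lTensor_mul' counit_lTensor_mul' c.γ_lact)]
  have h3 : ∀ x, lact (c.γ ∘ₗ (leftTwist c.γ).rTensor A)
      (lact ((c.γinv ∘ₗ (rightTwist c.γinv).lTensor A) ∘ₗ
        (TensorProduct.assoc ℂ A A A).toLinearMap) x) = x := fun x => by
    apply (TensorProduct.assoc ℂ A A A).injective
    rw [← c.cocycle_comp_assoc]
    refine (lact_map comul_assoc _ _).symm.trans ?_
    rw [← lact_map comul_assoc, h2]
    rfl
  refine LinearMap.ext fun x => ?_
  -- The functionals are compared through their operators: a left and a right inverse of the same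
  -- operator coincide.
  rw [← counit_lact, ← counit_lact (c.γinv ∘ₗ (rightTwist c.γinv).rTensor A), ← h1 (lact _ x), h3]

theorem lact_one_tmul (a : A) : lact c.γ (1 ⊗ₜ a) = 1 ⊗ₜ a :=
  c.twist_one_tmul (e := (1 : A)) (δM := Coalgebra.comul (R := ℂ) (A := A))
    (δN := Coalgebra.comul (R := ℂ) (A := A))
    (Bialgebra.comul_one.trans Algebra.TensorProduct.one_def) isComodule_comul a

theorem lact_tmul_one (a : A) : lact c.γ (a ⊗ₜ 1) = a ⊗ₜ 1 :=
  c.twist_tmul_one (e := (1 : A)) (δM := Coalgebra.comul (R := ℂ) (A := A))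
    (δN := Coalgebra.comul (R := ℂ) (A := A))
    (Bialgebra.comul_one.trans Algebra.TensorProduct.one_def) isComodule_comul a

theorem inv_one_apply (a : A) : c.γinv (1 ⊗ₜ a) = Coalgebra.counit (R := ℂ) a := by
  rw [← c.lact_one_tmul, c.γinv_lact, TensorProduct.counit_tmul]; simp

theorem inv_apply_one (a : A) : c.γinv (a ⊗ₜ 1) = Coalgebra.counit (R := ℂ) a := by
  rw [← c.lact_tmul_one, c.γinv_lact, TensorProduct.counit_tmul]; simp

theorem twoCocycle : TwoCocycle c.γ c.γinv where
  inv_lact := c.γinv_lact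
  lact_inv := c.γ_lact
  cocycle g h k := by
    have := c.cocycle g h k
    rwa [leftTwist_eq] at this
  cocycle_inv g h k := (LinearMap.congr_fun c.inv_cocycle ((g ⊗ₜ h) ⊗ₜ k)).symm
  apply_one := c.apply_one
  one_apply := c.one_apply
  inv_apply_one := c.inv_apply_one
  inv_one_apply := c.inv_one_apply

theorem ract_inv_one_tmul (a : A) : ract c.γinv (1 ⊗ₜ a) = 1 ⊗ₜ a := by
  have key : ∀ y : A ⊗[ℂ] A, TensorProduct.rid ℂ _ (c.γinv.lTensor (A ⊗[ℂ] A)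
      (tensorTensorTensorComm ℂ A A A A ((1 ⊗ₜ 1) ⊗ₜ y))) =
      1 ⊗ₜ TensorProduct.rid ℂ A (Coalgebra.counit.lTensor A y) := by
    intro y
    induction y with
    | zero => simp only [map_zero, TensorProduct.tmul_zero]
    | add x y hx hy => simp only [map_add, TensorProduct.tmul_add, hx, hy]
    | tmul a n => simp [c.inv_one_apply]
  have := key (Coalgebra.comul a)
  rw [Coalgebra.lTensor_counit_comul, ← Algebra.TensorProduct.one_def, ← Bialgebra.comul_one] at this
  exact this.trans (by simp)

theorem ract_inv_tmul_one (a : A) : ract c.γinv (a ⊗ₜ 1) = a ⊗ₜ 1 := by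
  have key : ∀ y : A ⊗[ℂ] A, TensorProduct.rid ℂ _ (c.γinv.lTensor (A ⊗[ℂ] A)
      (tensorTensorTensorComm ℂ A A A A (y ⊗ₜ (1 ⊗ₜ 1)))) =
      TensorProduct.rid ℂ A (Coalgebra.counit.lTensor A y) ⊗ₜ 1 := by
    intro y
    induction y with
    | zero => simp only [map_zero, TensorProduct.zero_tmul]
    | add x y hx hy => simp only [map_add, TensorProduct.add_tmul, hx, hy]
    | tmul a n => simp [c.inv_apply_one, TensorProduct.smul_tmul']
  have := key (Coalgebra.comul a)
  rw [Coalgebra.lTensor_counit_comul, ← Algebra.TensorProduct.one_def, ← Bialgebra.comul_one] at this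
  exact this.trans (by simp)

theorem mulA_apply (a b : A) : c.mulA a b =
    LinearMap.mul' ℂ A (lact c.γ (ract c.γinv (a ⊗ₜ b))) := c.lift_mulA (a ⊗ₜ b)

theorem lift_mulA_ract (x : A ⊗[ℂ] A) : TensorProduct.lift c.mulA (ract c.γ x) =
    LinearMap.mul' ℂ A (lact c.γ x) := by
  rw [lift_mulA, c.ract_inv_ract]

/-- The deformed product turns a right action of `γ` into the old product after a left action
(`lift_mulA_ract`). Used once for each product, with `γ` pulled back along the multiplication, this
moves the whole triple functional from right to left. -/
theorem lift_mulA_rTensor (x : (A ⊗[ℂ] A) ⊗[ℂ] A) :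
    TensorProduct.lift c.mulA ((TensorProduct.lift c.mulA).rTensor A
      ((ract c.γ).rTensor A (ract (c.γ ∘ₗ (LinearMap.mul' ℂ A).rTensor A) x))) =
    LinearMap.mul' ℂ A ((LinearMap.mul' ℂ A).rTensor A
      (lact (c.γ ∘ₗ (leftTwist c.γ).rTensor A) x)) := by
  rw [← LinearMap.rTensor_comp_apply, show TensorProduct.lift c.mulA ∘ₗ ract c.γ =
    LinearMap.mul' ℂ A ∘ₗ lact c.γ from LinearMap.ext c.lift_mulA_ract,
    LinearMap.rTensor_comp_apply, ← lact_tmul_counit, lact_ract, ← ract_map comul_rTensor_mul',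
    lift_mulA_ract, lact_map comul_rTensor_mul', lact_tmul_counit, lact_leftTwist_rTensor]

theorem lift_mulA_lTensor (x : A ⊗[ℂ] (A ⊗[ℂ] A)) :
    TensorProduct.lift c.mulA ((TensorProduct.lift c.mulA).lTensor A
      ((ract c.γ).lTensor A (ract (c.γ ∘ₗ (LinearMap.mul' ℂ A).lTensor A) x))) =
    LinearMap.mul' ℂ A ((LinearMap.mul' ℂ A).lTensor A
      (lact (c.γ ∘ₗ (leftTwist c.γ).lTensor A) x)) := by
  rw [← LinearMap.lTensor_comp_apply, show TensorProduct.lift c.mulA ∘ₗ ract c.γ =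
    LinearMap.mul' ℂ A ∘ₗ lact c.γ from LinearMap.ext c.lift_mulA_ract,
    LinearMap.lTensor_comp_apply, ← lact_counit_tmul, lact_ract, ← ract_map comul_lTensor_mul',
    lift_mulA_ract, lact_map comul_lTensor_mul', lact_counit_tmul, lact_leftTwist_lTensor]

theorem ract_leftTwist_rTensor (x : (A ⊗[ℂ] A) ⊗[ℂ] A) :
    ract (c.γ ∘ₗ (leftTwist c.γ).rTensor A) x =
      (ract c.γ).rTensor A (ract (c.γ ∘ₗ (LinearMap.mul' ℂ A).rTensor A) x) := by
  rw [← ract_tmul_counit, ract_ract]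
  congr 2
  refine LinearMap.ext fun y => ?_
  rw [LinearMap.comp_apply _ (ract _), ← apply_lact, lact_tmul_counit, leftTwist_eq,
    LinearMap.rTensor_comp]
  rfl

theorem ract_leftTwist_lTensor (x : A ⊗[ℂ] (A ⊗[ℂ] A)) :
    ract (c.γ ∘ₗ (leftTwist c.γ).lTensor A) x =
      (ract c.γ).lTensor A (ract (c.γ ∘ₗ (LinearMap.mul' ℂ A).lTensor A) x) := by
  rw [← ract_counit_tmul, ract_ract]
  congr 2
  refine LinearMap.ext fun y => ?_
  rw [LinearMap.comp_apply _ (ract _), ← apply_lact, lact_counit_tmul, leftTwist_eq,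
    LinearMap.lTensor_comp]
  rfl

/-- After the right action of the triple functional of the cocycle identity, either bracketing of
the deformed product becomes the old triple product after the left action of that functional. The
two triple functionals agree and the right action is onto, so the bracketings agree. -/
theorem mulA_assoc (x y z : A) : c.mulA (c.mulA x y) z = c.mulA x (c.mulA y z) := by
  have hsurj : ∀ x : (A ⊗[ℂ] A) ⊗[ℂ] A, ∃ w,
      ract (c.γ ∘ₗ (leftTwist c.γ).rTensor A) w = x := fun x => by
    refine ⟨ract (c.γinv ∘ₗ (LinearMap.mul' ℂ A).rTensor A) ((ract c.γinv).rTensor A x), ?_⟩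
    rw [ract_leftTwist_rTensor, ract_ract_eq_id
      (apply_lact_comp comul_rTensor_mul' counit_rTensor_mul' c.γinv_lact),
      ← LinearMap.rTensor_comp_apply, show ract c.γ ∘ₗ ract c.γinv = LinearMap.id from
      LinearMap.ext c.ract_ract_inv, LinearMap.rTensor_id]
    rfl
  obtain ⟨w, hw⟩ := hsurj ((x ⊗ₜ y) ⊗ₜ z)
  have h1 : c.mulA (c.mulA x y) z = TensorProduct.lift c.mulA
      ((TensorProduct.lift c.mulA).rTensor A ((x ⊗ₜ y) ⊗ₜ z)) := rfl
  have h2 : c.mulA x (c.mulA y z) = TensorProduct.lift c.mulA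
      ((TensorProduct.lift c.mulA).lTensor A ((TensorProduct.assoc ℂ A A A).toLinearMap
        ((x ⊗ₜ y) ⊗ₜ z))) := rfl
  have h3 : LinearMap.mul' ℂ A ∘ₗ (LinearMap.mul' ℂ A).rTensor A =
      LinearMap.mul' ℂ A ∘ₗ (LinearMap.mul' ℂ A).lTensor A ∘ₗ
        (TensorProduct.assoc ℂ A A A).toLinearMap :=
    TensorProduct.ext_threefold fun x y z => mul_assoc x y z
  rw [h1, h2, ← hw, ract_leftTwist_rTensor, lift_mulA_rTensor, ← ract_leftTwist_rTensor,
    ← c.cocycle_comp_assoc, ← ract_map comul_assoc, ract_leftTwist_lTensor, lift_mulA_lTensor,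
    lact_map comul_assoc]
  exact LinearMap.congr_fun h3 _

/-- The coproduct of `a ·_γ b` has `γ` on the far left and `γ⁻¹` on the far right only. Inserting
`γ⁻¹ * γ = ε` between the two legs completes both of them to deformed products. -/
theorem comul_mulA (a b : A) : Coalgebra.comul (R := ℂ) (c.mulA a b) =
    TensorProduct.map₂ c.mulA c.mulA (Coalgebra.comul (R := ℂ) a) (Coalgebra.comul (R := ℂ) b) := by
  rw [map₂_apply_eq, ← comul_eq_coactTensor, mulA_apply, comul_mul', comul_lact, comul_ract]
  have h : TensorProduct.lift c.mulA = LinearMap.mul' ℂ A ∘ₗ lact c.γ ∘ₗ ract c.γinv :=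
    LinearMap.ext c.lift_mulA
  have h' : TensorProduct.lift c.mulA = (LinearMap.mul' ℂ A ∘ₗ ract c.γinv) ∘ₗ lact c.γ :=
    LinearMap.ext fun x => by
      rw [lift_mulA, lact_ract]; rfl
  generalize a ⊗ₜ[ℂ] b = x
  have e : (ract c.γinv).rTensor (A ⊗[ℂ] A) (Coalgebra.comul (R := ℂ) x) =
      (lact c.γinv).lTensor (A ⊗[ℂ] A) (Coalgebra.comul (R := ℂ) x) := (lTensor_lact _ x).symm
  calc _ = TensorProduct.map (LinearMap.mul' ℂ A ∘ₗ lact c.γ) (LinearMap.mul' ℂ A ∘ₗ ract c.γinv)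
        (Coalgebra.comul (R := ℂ) x) := by
        rw [← LinearMap.comp_apply ((lact c.γ).rTensor _), LinearMap.rTensor_comp_lTensor,
          TensorProduct.map_map]
    -- The trivial factor `γ * γ⁻¹` is inserted as left actions on the second leg. The `γ⁻¹` in it
    -- is then moved to the right of the first leg by `lTensor_lact`.
    _ = TensorProduct.map (LinearMap.mul' ℂ A ∘ₗ lact c.γ)
        ((LinearMap.mul' ℂ A ∘ₗ ract c.γinv) ∘ₗ lact c.γ)
        ((lact c.γinv).lTensor (A ⊗[ℂ] A) (Coalgebra.comul (R := ℂ) x)) := by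
        rw [LinearMap.lTensor, TensorProduct.map_map, LinearMap.comp_assoc (lact c.γinv) (lact c.γ), LinearMap.comp_id,
          show lact c.γ ∘ₗ lact c.γinv = LinearMap.id from LinearMap.ext c.lact_lact_inv,
          LinearMap.comp_id]
    _ = _ := by
        rw [← e, ← h', LinearMap.rTensor, TensorProduct.map_map,
          LinearMap.comp_id, LinearMap.comp_assoc, ← h]

theorem counit_mulA (a b : A) : Coalgebra.counit (R := ℂ) (c.mulA a b) =
    Coalgebra.counit (R := ℂ) a * Coalgebra.counit (R := ℂ) b := by
  rw [mulA_apply, counit_mul', counit_lact, ← apply_lact, c.γinv_lact, TensorProduct.counit_tmul,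
    smul_eq_mul, mul_comm]

theorem isUnitalAlgebra_mulA : IsUnitalAlgebra c.mulA 1 where
  assoc := c.mulA_assoc
  one_mul a := by rw [mulA_apply, c.ract_inv_one_tmul, c.lact_one_tmul]; simp
  mul_one a := by rw [mulA_apply, c.ract_inv_tmul_one, c.lact_tmul_one]; simp

end UnitaryTwoCocycle

end TwoCocycle

end CocycleCalculus

end

noncomputable section

namespace CocycleCalculus

/-! ### The antipode of the deformed Hopf algebra -/

section DeformedAntipode

open TensorProduct

variable {A : Type*} [CommRing A] [HopfAlgebra ℂ A]

variable (A) in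
/-- The element `a₍₁₎ ⊗ S(a₍₂₎)`. -/
def comulAntipode : A →ₗ[ℂ] A ⊗[ℂ] A := (HopfAlgebra.antipode ℂ).lTensor A ∘ₗ Coalgebra.comul

variable (A) in
/-- The map `a ⊗ b ↦ S(a) ⊗ b`, from `A^cop ⊗ A`. -/
def antipodeTensor : Cop A ⊗[ℂ] A →ₗ[ℂ] A ⊗[ℂ] A :=
  TensorProduct.map (HopfAlgebra.antipode ℂ ∘ₗ (toCop A).symm.toLinearMap) LinearMap.id

/-- The antipode reverses the coproduct, so it is a coalgebra map from the co-opposite. This is the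
reason to work on `A^cop ⊗ A`: functionals on `A ⊗ A` pull back along `S ⊗ id` together with their
convolution inverses. -/
theorem comul_antipodeTensor (x : Cop A ⊗[ℂ] A) :
    Coalgebra.comul (R := ℂ) (antipodeTensor A x) =
      TensorProduct.map (antipodeTensor A) (antipodeTensor A) (Coalgebra.comul (R := ℂ) x) := by
  refine comul_map (fun c => ?_) comul_id x
  obtain ⟨a, rfl⟩ := (toCop A).surjective c
  have key : TensorProduct.map (HopfAlgebra.antipode ℂ ∘ₗ (toCop A).symm.toLinearMap)
      (HopfAlgebra.antipode ℂ ∘ₗ (toCop A).symm.toLinearMap) ∘ₗ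
      TensorProduct.map (toCop A).toLinearMap (toCop A).toLinearMap =
      TensorProduct.map (HopfAlgebra.antipode ℂ) (HopfAlgebra.antipode ℂ) := by
    ext; simp
  rw [comul_toCop]
  refine Eq.trans ?_ (LinearMap.congr_fun key _).symm
  exact comul_antipode a

theorem counit_antipodeTensor (x : Cop A ⊗[ℂ] A) :
    Coalgebra.counit (R := ℂ) (antipodeTensor A x) = Coalgebra.counit (R := ℂ) x := by
  induction x with
  | zero => simp only [map_zero]
  | add x y hx hy => simp only [map_add, hx, hy]
  | tmul a b =>
    obtain ⟨a, rfl⟩ := (toCop A).surjective a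
    rw [TensorProduct.counit_tmul, counit_toCop]
    simp [antipodeTensor]

theorem mul'_antipodeTensor (x : Cop A ⊗[ℂ] A) :
    LinearMap.mul' ℂ A (antipodeTensor A x) = antipodeMul A x := rfl

/-- The expression `Σ (a₍₁₎ ⊗ S(a₍₃₎)) ⊗ X(a₍₂₎)`. -/
theorem lTensor_comul_comulAntipode {V : Type*} [AddCommGroup V] [Module ℂ V]
    (X : A ⊗[ℂ] A →ₗ[ℂ] V) (a : A) :
    X.lTensor (A ⊗[ℂ] A) (Coalgebra.comul (R := ℂ) (comulAntipode A a)) =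
      TensorProduct.comm ℂ V (A ⊗[ℂ] A) (((HopfAlgebra.antipode ℂ).lTensor A).lTensor V
        (TensorProduct.leftComm ℂ A V A (((X ∘ₗ comulAntipode A).rTensor A ∘ₗ
        Coalgebra.comul (R := ℂ)).lTensor A (Coalgebra.comul (R := ℂ) a)))) := by
  have key : (tensorTensorTensorComm ℂ A A A A).toLinearMap ∘ₗ
      (TensorProduct.map (HopfAlgebra.antipode ℂ) (HopfAlgebra.antipode ℂ) ∘ₗ
        (TensorProduct.comm ℂ A A).toLinearMap).lTensor (A ⊗[ℂ] A) =
      (TensorProduct.comm ℂ (A ⊗[ℂ] A) (A ⊗[ℂ] A)).toLinearMap ∘ₗ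
      TensorProduct.map ((HopfAlgebra.antipode ℂ).lTensor A)
        ((HopfAlgebra.antipode ℂ).lTensor A) ∘ₗ
      (TensorProduct.leftComm ℂ A (A ⊗[ℂ] A) A).toLinearMap ∘ₗ
      (TensorProduct.assoc ℂ A A A).symm.toLinearMap.lTensor A ∘ₗ
        (TensorProduct.assoc ℂ A A (A ⊗[ℂ] A)).toLinearMap := by
    ext; simp
  have h1 : ∀ x : A ⊗[ℂ] A, Coalgebra.comul (R := ℂ) ((HopfAlgebra.antipode ℂ).lTensor A x) =
      TensorProduct.comm ℂ (A ⊗[ℂ] A) (A ⊗[ℂ] A)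
      (TensorProduct.map ((HopfAlgebra.antipode ℂ).lTensor A)
        ((HopfAlgebra.antipode ℂ).lTensor A)
      (TensorProduct.leftComm ℂ A (A ⊗[ℂ] A) A
      ((TensorProduct.assoc ℂ A A A).symm.toLinearMap.lTensor A
        (TensorProduct.assoc ℂ A A (A ⊗[ℂ] A)
          (TensorProduct.map (Coalgebra.comul (R := ℂ)) (Coalgebra.comul (R := ℂ)) x))))) := by
    intro x
    induction x with
    | zero => simp only [map_zero]
    | add x y hx hy => simp only [map_add, hx, hy]
    | tmul a b =>
      refine Eq.trans ?_ (LinearMap.congr_fun key (Coalgebra.comul a ⊗ₜ Coalgebra.comul b))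
      change tensorTensorTensorComm ℂ A A A A (Coalgebra.comul a ⊗ₜ
        Coalgebra.comul (HopfAlgebra.antipode ℂ b)) = _
      rw [comul_antipode]
      rfl
  have h2 : X.lTensor (A ⊗[ℂ] A) ∘ₗ (TensorProduct.comm ℂ (A ⊗[ℂ] A) (A ⊗[ℂ] A)).toLinearMap ∘ₗ
      TensorProduct.map ((HopfAlgebra.antipode ℂ).lTensor A)
        ((HopfAlgebra.antipode ℂ).lTensor A) ∘ₗ
      (TensorProduct.leftComm ℂ A (A ⊗[ℂ] A) A).toLinearMap =
      (TensorProduct.comm ℂ V (A ⊗[ℂ] A)).toLinearMap ∘ₗ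
      ((HopfAlgebra.antipode ℂ).lTensor A).lTensor V ∘ₗ
      (TensorProduct.leftComm ℂ A V A).toLinearMap ∘ₗ
        ((X ∘ₗ (HopfAlgebra.antipode ℂ).lTensor A).rTensor A).lTensor A := by
    ext; simp
  have h3 : (TensorProduct.assoc ℂ A A A).symm.toLinearMap ∘ₗ
      (TensorProduct.assoc ℂ A A A).toLinearMap ∘ₗ (Coalgebra.comul (R := ℂ)).rTensor A ∘ₗ
      Coalgebra.comul (R := ℂ) = (Coalgebra.comul (R := ℂ)).rTensor A ∘ₗ
      Coalgebra.comul (R := ℂ) := by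
    rw [← LinearMap.comp_assoc, LinearEquiv.symm_comp, LinearMap.id_comp]
  rw [comulAntipode, LinearMap.comp_apply, h1, comul_comul_nested,
    ← LinearMap.lTensor_comp_apply, h3]
  refine (LinearMap.congr_fun h2 _).trans ?_
  rw [LinearMap.comp_apply, LinearMap.comp_apply, LinearMap.comp_apply,
    ← LinearMap.lTensor_comp_apply, ← LinearMap.comp_assoc, ← LinearMap.rTensor_comp]
  rfl

theorem mul'_comulAntipode (a : A) : LinearMap.mul' ℂ A (comulAntipode A a) =
    Coalgebra.counit (R := ℂ) a • (1 : A) := by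
  rw [← Algebra.algebraMap_eq_smul_one]
  exact HopfAlgebra.mul_antipode_lTensor_comul_apply a

/-- In `Σ (a₍₁₎ ⊗ S(a₍₄₎)) ⊗ a₍₂₎ S(a₍₃₎)` the inner legs cancel. -/
theorem lTensor_mul'_comul_comulAntipode (a : A) :
    (LinearMap.mul' ℂ A).lTensor (A ⊗[ℂ] A) (Coalgebra.comul (R := ℂ) (comulAntipode A a)) =
      comulAntipode A a ⊗ₜ 1 := by
  have h1 : LinearMap.mul' ℂ A ∘ₗ comulAntipode A = (LinearMap.toSpanSingleton ℂ A 1) ∘ₗ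
      Coalgebra.counit (R := ℂ) := LinearMap.ext mul'_comulAntipode
  have h2 : (LinearMap.mul' ℂ A ∘ₗ comulAntipode A).rTensor A ∘ₗ Coalgebra.comul (R := ℂ) =
      (TensorProduct.mk ℂ A A 1) := by
    rw [h1, LinearMap.rTensor_comp, LinearMap.comp_assoc, Coalgebra.rTensor_counit_comp_comul]
    ext; simp
  rw [lTensor_comul_comulAntipode, h2, comulAntipode, LinearMap.comp_apply]
  generalize Coalgebra.comul (R := ℂ) a = x
  induction x with
  | zero => simp only [map_zero, TensorProduct.zero_tmul]
  | add x y hx hy => simp only [map_add, TensorProduct.add_tmul, hx, hy]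
  | tmul a c => simp

theorem mul'_lact_comulAntipode (φ : A ⊗[ℂ] A →ₗ[ℂ] ℂ) (a : A) :
    LinearMap.mul' ℂ A (lact φ (comulAntipode A a)) = φ (comulAntipode A a) • (1 : A) := by
  have h := congrArg (fun x => TensorProduct.lid ℂ A (φ.rTensor A x))
    (lTensor_mul'_comul_comulAntipode a)
  simp only [LinearMap.rTensor_tmul, TensorProduct.lid_tmul] at h
  rw [← h, lact, act_apply]
  generalize Coalgebra.comul (R := ℂ) (comulAntipode A a) = x
  induction x with
  | zero => simp only [map_zero]
  | add x y hx hy => simp only [map_add, hx, hy]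
  | tmul a c => simp

theorem ract_comulAntipode (φ : A ⊗[ℂ] A →ₗ[ℂ] ℂ) (a : A) : ract φ (comulAntipode A a) =
    (HopfAlgebra.antipode ℂ ∘ₗ lact (φ ∘ₗ comulAntipode A)).lTensor A (Coalgebra.comul a) := by
  rw [ract_apply, lTensor_comul_comulAntipode, LinearMap.lTensor_comp_apply,
    LinearMap.lTensor_comp_apply]
  have key : (TensorProduct.rid ℂ (A ⊗[ℂ] A)).toLinearMap ∘ₗ
      (TensorProduct.comm ℂ ℂ (A ⊗[ℂ] A)).toLinearMap ∘ₗ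
      ((HopfAlgebra.antipode ℂ).lTensor A).lTensor ℂ ∘ₗ
      (TensorProduct.leftComm ℂ A ℂ A).toLinearMap =
      (HopfAlgebra.antipode ℂ).lTensor A ∘ₗ (TensorProduct.lid ℂ A).toLinearMap.lTensor A := by
    ext; simp
  refine (LinearMap.congr_fun key _).trans ?_
  simp only [LinearMap.comp_apply, lact, act, LinearMap.lTensor_comp, LinearMap.rTensor]

variable (A) in
/-- The map `a ⊗ b ↦ a ε(b)`. -/
def counitRight {C : Type*} [AddCommGroup C] [Module ℂ C] : C ⊗[ℂ] A →ₗ[ℂ] C :=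
  (TensorProduct.rid ℂ C).toLinearMap ∘ₗ (Coalgebra.counit (R := ℂ)).lTensor C

/-- The image `(S(a₍₂₎) ⊗ b) ⊗ a₍₁₎` of `a ⊗ b`. -/
theorem map_antipodeTensor_counitRight (a b : A) :
    TensorProduct.map (antipodeTensor A) ((toCop A).symm.toLinearMap ∘ₗ counitRight A)
      (Coalgebra.comul (R := ℂ) (toCop A a ⊗ₜ b)) =
    TensorProduct.map ((TensorProduct.mk ℂ A A).flip b ∘ₗ HopfAlgebra.antipode ℂ) LinearMap.id
      (TensorProduct.comm ℂ A A (Coalgebra.comul (R := ℂ) a)) := by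
  have key : ∀ (x y : A ⊗[ℂ] A), TensorProduct.map (antipodeTensor A)
      ((toCop A).symm.toLinearMap ∘ₗ counitRight A) (tensorTensorTensorComm ℂ (Cop A) (Cop A) A A
        (TensorProduct.map (toCop A).toLinearMap (toCop A).toLinearMap x ⊗ₜ y)) =
      TensorProduct.map ((TensorProduct.mk ℂ A A).flip (counitRight A y) ∘ₗ
        HopfAlgebra.antipode ℂ) LinearMap.id x := by
    intro x y
    induction x with
    | zero => simp only [map_zero, TensorProduct.zero_tmul]
    | add x x' hx hx' => simp only [map_add, TensorProduct.add_tmul, hx, hx']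
    | tmul p r =>
      induction y with
      | zero => simp only [map_zero, TensorProduct.tmul_zero, LinearMap.zero_comp,
          TensorProduct.map_zero_left, LinearMap.zero_apply]
      | add y y' hy hy' => simp only [map_add, TensorProduct.tmul_add, hy, hy',
          LinearMap.add_comp, TensorProduct.map_add_left, LinearMap.add_apply]
      | tmul b b' => simp [antipodeTensor, counitRight, TensorProduct.smul_tmul']
  have h : counitRight A (Coalgebra.comul (R := ℂ) b) = b := by
    rw [counitRight, LinearMap.comp_apply, Coalgebra.lTensor_counit_comul]; simp
  refine (key _ (Coalgebra.comul b)).trans ?_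
  rw [h]
  rfl

/-- The image `S(a₍₁₎) ⊗ (a₍₂₎ ⊗ b)` of `a ⊗ b`. -/
theorem map_counitRight_comul (a b : A) :
    (HopfAlgebra.antipode ℂ ∘ₗ counitRight A).rTensor (A ⊗[ℂ] A)
      (Coalgebra.comul (R := ℂ) (a ⊗ₜ[ℂ] b)) =
    TensorProduct.map (HopfAlgebra.antipode ℂ) ((TensorProduct.mk ℂ A A).flip b)
      (Coalgebra.comul (R := ℂ) a) := by
  have key : ∀ (x y : A ⊗[ℂ] A), (HopfAlgebra.antipode ℂ ∘ₗ counitRight A).rTensor (A ⊗[ℂ] A)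
        (tensorTensorTensorComm ℂ A A A A (x ⊗ₜ y)) =
      TensorProduct.map (HopfAlgebra.antipode ℂ) ((TensorProduct.mk ℂ A A).flip
        (TensorProduct.lid ℂ A ((Coalgebra.counit (R := ℂ)).rTensor A y))) x := by
    intro x y
    induction x with
    | zero => simp only [map_zero, TensorProduct.zero_tmul]
    | add x x' hx hx' => simp only [map_add, TensorProduct.add_tmul, hx, hx']
    | tmul p r =>
      induction y with
      | zero => simp
      | add y y' hy hy' => simp only [map_add, TensorProduct.tmul_add, hy, hy',
          TensorProduct.map_add_right, LinearMap.add_apply]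
      | tmul b b' =>
        simp [counitRight, ← TensorProduct.smul_tmul']
  refine (key _ (Coalgebra.comul b)).trans ?_
  rw [Coalgebra.rTensor_counit_comul]; simp

namespace TwoCocycle

variable {γ γ' : A ⊗[ℂ] A →ₗ[ℂ] ℂ} (h : TwoCocycle γ γ')

/-- The functional `U(a) = γ(a₍₁₎ ⊗ S(a₍₂₎))`. -/
def twistFunctional (γ : A ⊗[ℂ] A →ₗ[ℂ] ℂ) : A →ₗ[ℂ] ℂ := γ ∘ₗ comulAntipode A

/-- The functional `a ↦ γ'(S(a₍₁₎) ⊗ a₍₂₎)`, convolution inverse to `U`. -/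
def twistFunctionalInv (γ' : A ⊗[ℂ] A →ₗ[ℂ] ℂ) : A →ₗ[ℂ] ℂ :=
  γ' ∘ₗ antipodeTensor A ∘ₗ comulCop A

/-- The functional `a ⊗ b ↦ γ(a₍₁₎ ⊗ S(a₍₂₎) b)` on `A^cop ⊗ A`. -/
def auxFunctional (γ : A ⊗[ℂ] A →ₗ[ℂ] ℂ) : Cop A ⊗[ℂ] A →ₗ[ℂ] ℂ :=
  γ ∘ₗ TensorProduct.comm ℂ A A ∘ₗ
    TensorProduct.map (antipodeMul A) ((toCop A).symm.toLinearMap ∘ₗ counitRight A) ∘ₗ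
    Coalgebra.comul

/-- The value is `γ(a₍₁₎ ⊗ S(a₍₂₎) a₍₃₎) = γ(a ⊗ 1)`. -/
theorem auxFunctional_comulCop (h : TwoCocycle γ γ') (a : A) :
    auxFunctional γ (comulCop A a) = Coalgebra.counit (R := ℂ) a := by
  have h1 : TensorProduct.map (antipodeMul A) ((toCop A).symm.toLinearMap ∘ₗ counitRight A)
      (Coalgebra.comul (R := ℂ) (comulCop A a)) =
      1 ⊗ₜ (toCop A).symm (counitRight A (comulCop A a)) := by
    rw [← LinearMap.lTensor_comp_rTensor, LinearMap.comp_apply, rTensor_antipodeMul]; rfl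
  have h2 : counitRight A (comulCop A a) = toCop A a := by
    rw [counitRight, comulCop, LinearMap.comp_apply, LinearMap.comp_apply,
      ← LinearMap.comp_apply (LinearMap.lTensor _ _), LinearMap.lTensor_comp_rTensor,
      ← LinearMap.rTensor_comp_lTensor, LinearMap.comp_apply, Coalgebra.lTensor_counit_comul]
    simp
  rw [auxFunctional, LinearMap.comp_apply, LinearMap.comp_apply, LinearMap.comp_apply, h1, h2]
  simp [h.apply_one]

/-- The composite is `γ(a₍₁₎ ⊗ γ(S(a₍₃₎) ⊗ b₍₁₎) S(a₍₂₎) b₍₂₎)`, the right side of the cocycle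
identity at `a₍₁₎`, `S(a₍₂₎)`, `b`. On the left side `a₍₁₎` and `S(a₍₂₎)` multiply to a scalar,
which leaves `U(a) γ(1 ⊗ b)`. -/
theorem auxFunctional_lact (h : TwoCocycle γ γ') (x : Cop A ⊗[ℂ] A) :
    auxFunctional γ (lact (γ ∘ₗ antipodeTensor A) x) =
      (LinearMap.mul' ℂ ℂ ∘ₗ TensorProduct.map (twistFunctional γ ∘ₗ (toCop A).symm.toLinearMap)
        (Coalgebra.counit (R := ℂ) (A := A))) x := by
  induction x with
  | zero => simp only [map_zero]
  | add x y hx hy => simp only [map_add, hx, hy]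
  | tmul c b =>
    obtain ⟨a, rfl⟩ := (toCop A).surjective c
    have h1 : antipodeMul A ∘ₗ lact (γ ∘ₗ antipodeTensor A) =
        (LinearMap.mul' ℂ A ∘ₗ lact γ) ∘ₗ antipodeTensor A := LinearMap.ext fun y => by
      rw [LinearMap.comp_apply, ← mul'_antipodeTensor, ← lact_map comul_antipodeTensor]; rfl
    have h2 : ∀ x : A ⊗[ℂ] A, γ (TensorProduct.comm ℂ A A ((LinearMap.mul' ℂ A ∘ₗ lact γ).rTensor A
        (TensorProduct.map ((TensorProduct.mk ℂ A A).flip b ∘ₗ HopfAlgebra.antipode ℂ)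
          LinearMap.id (TensorProduct.comm ℂ A A x)))) =
        γ (LinearMap.mul' ℂ A (lact γ ((HopfAlgebra.antipode ℂ).lTensor A x)) ⊗ₜ b) := by
      intro x
      induction x with
      | zero => simp only [map_zero, TensorProduct.zero_tmul]
      | add x x' hx hx' => simp only [map_add, TensorProduct.add_tmul, hx, hx']
      | tmul p r =>
        refine Eq.trans ?_ (h.cocycle p (HopfAlgebra.antipode ℂ r) b).symm
        simp
    rw [auxFunctional, LinearMap.comp_apply, LinearMap.comp_apply, LinearMap.comp_apply, comul_lact,
      LinearMap.rTensor, TensorProduct.map_map, h1, LinearMap.comp_id,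
      ← LinearMap.rTensor_comp_map, LinearMap.comp_apply, map_antipodeTensor_counitRight]
    refine (h2 (Coalgebra.comul a)).trans ?_
    refine (congrArg (fun y => γ (y ⊗ₜ b)) (mul'_lact_comulAntipode γ a)).trans ?_
    rw [← TensorProduct.smul_tmul', map_smul, h.one_apply]
    simp [twistFunctional]

theorem auxFunctional_eq (h : TwoCocycle γ γ') (x : Cop A ⊗[ℂ] A) : auxFunctional γ x =
    (LinearMap.mul' ℂ ℂ ∘ₗ TensorProduct.map (twistFunctional γ ∘ₗ (toCop A).symm.toLinearMap)
        (Coalgebra.counit (R := ℂ) (A := A))) (lact (γ' ∘ₗ antipodeTensor A) x) := by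
  rw [← h.auxFunctional_lact, lact_lact_eq_id
    (apply_lact_comp comul_antipodeTensor counit_antipodeTensor h.lact_inv)]

/-- Evaluate the formula for `auxFunctional` at `a₍₁₎ ⊗ a₍₂₎`: one expression is the counit, the
other is `U` convolved with its claimed inverse. -/
theorem twistFunctional_ract (h : TwoCocycle γ γ') (a : A) :
    twistFunctional γ (ract (twistFunctionalInv γ') a) = Coalgebra.counit (R := ℂ) a := by
  rw [← h.auxFunctional_comulCop, h.auxFunctional_eq, lact_comulCop]
  have key : (LinearMap.mul' ℂ ℂ ∘ₗ TensorProduct.map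
      (twistFunctional γ ∘ₗ (toCop A).symm.toLinearMap) (Coalgebra.counit (R := ℂ) (A := A))) ∘ₗ
      (toCop A).toLinearMap.rTensor A ∘ₗ (ract (twistFunctionalInv γ')).rTensor A =
      twistFunctional γ ∘ₗ ract (twistFunctionalInv γ') ∘ₗ counitRight A := by
    ext; simp [counitRight, mul_comm]
  refine Eq.trans ?_ (LinearMap.congr_fun key (Coalgebra.comul a)).symm
  simp [counitRight]

/-- The inverse on the other side comes from the mirror argument: the cocycle identity of `γ'` is
used instead, with the functional `κ : a ⊗ b ↦ γ'(S(a₍₁₎) ⊗ a₍₂₎ b)`. -/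
theorem twistFunctionalInv_ract (h : TwoCocycle γ γ') (a : A) :
    twistFunctionalInv γ' (ract (twistFunctional γ) a) = Coalgebra.counit (R := ℂ) a := by
  let κ : A ⊗[ℂ] A →ₗ[ℂ] ℂ := γ' ∘ₗ TensorProduct.map
    (HopfAlgebra.antipode ℂ ∘ₗ counitRight A) (LinearMap.mul' ℂ A) ∘ₗ Coalgebra.comul
  have h1 : ∀ x, κ (ract γ' x) = twistFunctionalInv γ' (counitRight A x) := by
    intro x
    induction x with
    | zero => simp only [map_zero]
    | add x y hx hy => simp only [map_add, hx, hy]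
    | tmul a b =>
      have h2 : ∀ x : A ⊗[ℂ] A, γ' ((LinearMap.mul' ℂ A ∘ₗ ract γ').lTensor A
          (TensorProduct.map (HopfAlgebra.antipode ℂ) ((TensorProduct.mk ℂ A A).flip b) x)) =
          γ' (LinearMap.mul' ℂ A (ract γ' (antipodeTensor A
            ((toCop A).toLinearMap.rTensor A x))) ⊗ₜ b) := by
        intro x
        induction x with
        | zero => simp only [map_zero, TensorProduct.zero_tmul]
        | add x x' hx hx' => simp only [map_add, TensorProduct.add_tmul, hx, hx']
        | tmul p r =>
          refine Eq.trans ?_ (h.cocycle_inv (HopfAlgebra.antipode ℂ p) r b).symm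
          simp
      have e1 : κ (ract γ' (a ⊗ₜ b)) = γ' ((LinearMap.mul' ℂ A ∘ₗ ract γ').lTensor A
          (TensorProduct.map (HopfAlgebra.antipode ℂ) ((TensorProduct.mk ℂ A A).flip b)
            (Coalgebra.comul a))) := by
        rw [← map_counitRight_comul]
        change γ' (TensorProduct.map _ _ (Coalgebra.comul (ract γ' (a ⊗ₜ b)))) = _
        rw [comul_ract, LinearMap.lTensor, LinearMap.lTensor, LinearMap.rTensor,
          TensorProduct.map_map, TensorProduct.map_map, LinearMap.comp_id, LinearMap.id_comp,
          LinearMap.comp_id]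
      rw [e1, h2]
      have e2 : LinearMap.mul' ℂ A (ract γ' (antipodeTensor A (comulCop A a))) =
          twistFunctionalInv γ' a • (1 : A) := by
        rw [ract_map comul_antipodeTensor, mul'_antipodeTensor, antipodeMul_ract]; rfl
      refine (congrArg (fun y => γ' (y ⊗ₜ b)) e2).trans ?_
      rw [← TensorProduct.smul_tmul', map_smul, h.inv_one_apply]
      simp [counitRight, mul_comm]
  -- Here `κ` is `γ'(S(a₍₁₎) ⊗ a₍₂₎ S(a₍₃₎))`, whose second argument collapses to `1`.
  have h3 : κ (comulAntipode A a) = Coalgebra.counit (R := ℂ) a := by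
    have e1 : TensorProduct.map (HopfAlgebra.antipode ℂ ∘ₗ counitRight A) (LinearMap.mul' ℂ A)
        (Coalgebra.comul (R := ℂ) (comulAntipode A a)) =
        HopfAlgebra.antipode ℂ (counitRight A (comulAntipode A a)) ⊗ₜ 1 := by
      rw [← LinearMap.rTensor_comp_lTensor, LinearMap.comp_apply, lTensor_mul'_comul_comulAntipode]
      rfl
    have e2 : counitRight A (comulAntipode A a) = a := by
      rw [counitRight, comulAntipode, LinearMap.comp_apply, LinearMap.comp_apply,
        ← LinearMap.lTensor_comp_apply, HopfAlgebra.counit_comp_antipode,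
        Coalgebra.lTensor_counit_comul]
      simp
    change γ' (TensorProduct.map _ _ (Coalgebra.comul (R := ℂ) (comulAntipode A a))) = _
    rw [e1, e2, h.inv_apply_one, HopfAlgebra.counit_antipode]
  rw [← h3, ← ract_ract_eq_id h.lact_inv (comulAntipode A a), h1, ract_comulAntipode]
  have key : counitRight A ∘ₗ (HopfAlgebra.antipode ℂ ∘ₗ lact (γ ∘ₗ comulAntipode A)).lTensor A =
      (TensorProduct.rid ℂ A).toLinearMap ∘ₗ (twistFunctional γ).lTensor A := by
    have : Coalgebra.counit (R := ℂ) ∘ₗ HopfAlgebra.antipode ℂ ∘ₗ lact (γ ∘ₗ comulAntipode A) =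
        twistFunctional γ := LinearMap.ext fun y => by
      rw [LinearMap.comp_apply, LinearMap.comp_apply, HopfAlgebra.counit_antipode, counit_lact]
      rfl
    rw [counitRight, LinearMap.comp_assoc, ← LinearMap.lTensor_comp, this]
  exact congrArg _ (LinearMap.congr_fun key (Coalgebra.comul a)).symm

/-- The antipode `a ↦ γ(a₍₁₎ ⊗ S(a₍₂₎)) S(a₍₃₎) γ'(S(a₍₄₎) ⊗ a₍₅₎)` of the deformed Hopf algebra. -/
def deformedAntipode (γ γ' : A ⊗[ℂ] A →ₗ[ℂ] ℂ) : A →ₗ[ℂ] A :=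
  HopfAlgebra.antipode ℂ ∘ₗ lact (twistFunctional γ) ∘ₗ ract (twistFunctionalInv γ')

/-- It is a composite of the antipode and of two operators of convolution-invertible functionals. -/
theorem deformedAntipode_bijective (h : TwoCocycle γ γ') :
    Function.Bijective (deformedAntipode γ γ') := by
  have h1 : ∀ x, twistFunctionalInv γ' (lact (twistFunctional γ) x) =
      Coalgebra.counit (R := ℂ) x := fun x => by
    rw [apply_lact, h.twistFunctional_ract]
  have h2 : ∀ x, twistFunctional γ (lact (twistFunctionalInv γ') x) =
      Coalgebra.counit (R := ℂ) x := fun x => by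
    rw [apply_lact, h.twistFunctionalInv_ract]
  have b1 : Function.Bijective (lact (twistFunctional γ)) :=
    Function.bijective_iff_has_inverse.2 ⟨_, lact_lact_eq_id h1, lact_lact_eq_id h2⟩
  have b2 : Function.Bijective (ract (twistFunctionalInv γ')) :=
    Function.bijective_iff_has_inverse.2 ⟨_, ract_ract_eq_id h1, ract_ract_eq_id h2⟩
  exact antipode_bijective.comp (b1.comp b2)

/-- The factor `γ'(S(a₍₄₎) ⊗ a₍₅₎)` of the deformed antipode is a left action of `γ' ∘ (S ⊗ id)` on
`A^cop ⊗ A`, and the factor `U` becomes a right action because the co-opposite exchanges sides. -/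
theorem rTensor_deformedAntipode_comul (a : A) :
    (deformedAntipode γ γ').rTensor A (Coalgebra.comul (R := ℂ) a) = antipodeTensor A
      (ract (LinearMap.mul' ℂ ℂ ∘ₗ TensorProduct.map
        (twistFunctional γ ∘ₗ (toCop A).symm.toLinearMap) (Coalgebra.counit (R := ℂ) (A := A)))
        (lact (γ' ∘ₗ antipodeTensor A) (comulCop A a))) := by
  have key : antipodeTensor A ∘ₗ
      (ract (twistFunctional γ ∘ₗ (toCop A).symm.toLinearMap)).rTensor A ∘ₗ
      (toCop A).toLinearMap.rTensor A ∘ₗ (ract (twistFunctionalInv γ')).rTensor A =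
      (deformedAntipode γ γ').rTensor A := by
    ext a b
    simp only [TensorProduct.AlgebraTensorModule.curry_apply, LinearMap.restrictScalars_self,
      TensorProduct.curry_apply, LinearMap.comp_apply, LinearMap.rTensor_tmul, antipodeTensor,
      AlgEquiv.toLinearMap_apply, ract_toCop, TensorProduct.map_tmul, deformedAntipode]
    rfl
  rw [ract_tmul_counit, lact_comulCop]
  exact (LinearMap.congr_fun key (Coalgebra.comul a)).symm

/-- The actions of `γ` and `γ'` in the deformed product pass through the coalgebra map `S ⊗ id`. The
left action of `γ` cancels that of `γ'`; what remains is a right action, by a functional that equals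
`auxFunctional` and is the counit on `a₍₁₎ ⊗ a₍₂₎`. -/
theorem mul'_rTensor_deformedAntipode (h : TwoCocycle γ γ') (a : A) :
    LinearMap.mul' ℂ A (lact γ (ract γ' ((deformedAntipode γ γ').rTensor A
      (Coalgebra.comul (R := ℂ) a)))) = Coalgebra.counit (R := ℂ) a • (1 : A) := by
  rw [rTensor_deformedAntipode_comul, ract_map comul_antipodeTensor, lact_map comul_antipodeTensor,
    mul'_antipodeTensor, lact_ract, lact_ract, lact_lact_eq_id
    (apply_lact_comp comul_antipodeTensor counit_antipodeTensor h.lact_inv), ract_ract,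
    antipodeMul_ract, LinearMap.comp_apply, ← apply_lact, ← h.auxFunctional_eq,
    h.auxFunctional_comulCop]

variable (A) in
/-- The exchange of the factors, as a map from `A ⊗ A` to `A^cop ⊗ A^cop`. -/
def commCop : A ⊗[ℂ] A ≃ₗ[ℂ] Cop A ⊗[ℂ] Cop A :=
  (TensorProduct.comm ℂ A A).trans
    (TensorProduct.congr (toCop A).toLinearEquiv (toCop A).toLinearEquiv)

theorem commCop_tmul (a b : A) : commCop A (a ⊗ₜ b) = toCop A b ⊗ₜ toCop A a := rfl

theorem comul_commCop (x : A ⊗[ℂ] A) : Coalgebra.comul (R := ℂ) (commCop A x) =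
    TensorProduct.comm ℂ _ _ (TensorProduct.map (commCop A).toLinearMap (commCop A).toLinearMap
      (Coalgebra.comul (R := ℂ) x)) := by
  have key : ∀ p q : A ⊗[ℂ] A, tensorTensorTensorComm ℂ (Cop A) (Cop A) (Cop A) (Cop A)
      (TensorProduct.map (toCop A).toLinearMap (toCop A).toLinearMap (TensorProduct.comm ℂ A A q) ⊗ₜ
      TensorProduct.map (toCop A).toLinearMap (toCop A).toLinearMap (TensorProduct.comm ℂ A A p)) =
      TensorProduct.comm ℂ _ _ (TensorProduct.map (commCop A).toLinearMap (commCop A).toLinearMap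
        (tensorTensorTensorComm ℂ A A A A (p ⊗ₜ q))) := by
    intro p q
    induction p with
    | zero => simp only [map_zero, TensorProduct.zero_tmul, TensorProduct.tmul_zero]
    | add p p' hp hp' => simp only [map_add, TensorProduct.add_tmul, TensorProduct.tmul_add, hp, hp']
    | tmul p p' =>
      induction q with
      | zero => simp only [map_zero, TensorProduct.zero_tmul, TensorProduct.tmul_zero]
      | add p p' hp hp' =>
        simp only [map_add, TensorProduct.add_tmul, TensorProduct.tmul_add, hp, hp']
      | tmul q q' => rfl
  induction x with
  | zero => simp only [map_zero]
  | add x y hx hy => simp only [map_add, hx, hy]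
  | tmul a b => exact key (Coalgebra.comul a) (Coalgebra.comul b)

theorem counit_commCop (x : A ⊗[ℂ] A) : Coalgebra.counit (R := ℂ) (commCop A x) =
    Coalgebra.counit (R := ℂ) x := by
  induction x with
  | zero => simp only [map_zero]
  | add x y hx hy => simp only [map_add, hx, hy]
  | tmul a b =>
    rw [commCop_tmul, TensorProduct.counit_tmul, TensorProduct.counit_tmul, counit_toCop,
      counit_toCop, smul_eq_mul, smul_eq_mul, mul_comm]

theorem lact_commCop (φ : Cop A ⊗[ℂ] Cop A →ₗ[ℂ] ℂ) (x : A ⊗[ℂ] A) :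
    lact φ (commCop A x) = commCop A (ract (φ ∘ₗ (commCop A).toLinearMap) x) := by
  rw [lact, act_apply, ract_apply, comul_commCop]
  induction Coalgebra.comul (R := ℂ) x with
  | zero => simp only [map_zero]
  | add x y hx hy => simp only [map_add, hx, hy]
  | tmul a c => simp

theorem ract_commCop (φ : Cop A ⊗[ℂ] Cop A →ₗ[ℂ] ℂ) (x : A ⊗[ℂ] A) :
    ract φ (commCop A x) = commCop A (lact (φ ∘ₗ (commCop A).toLinearMap) x) := by
  rw [lact, act_apply, ract_apply, comul_commCop]
  induction Coalgebra.comul (R := ℂ) x with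
  | zero => simp only [map_zero]
  | add x y hx hy => simp only [map_add, hx, hy]
  | tmul a c => simp

theorem mul'_commCop (x : A ⊗[ℂ] A) :
    LinearMap.mul' ℂ (Cop A) (commCop A x) = toCop A (LinearMap.mul' ℂ A x) := by
  induction x with
  | zero => simp only [map_zero]
  | add x y hx hy => simp only [map_add, hx, hy]
  | tmul a b =>
    rw [commCop_tmul, LinearMap.mul'_apply, LinearMap.mul'_apply, ← map_mul, mul_comm]

theorem comp_commCop_symm_comp (φ : A ⊗[ℂ] A →ₗ[ℂ] ℂ) :
    (φ ∘ₗ (commCop A).symm.toLinearMap) ∘ₗ (commCop A).toLinearMap = φ := by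
  ext; simp

/-- Passing to the co-opposite and exchanging the arguments swaps left and right actions, so `γ` and
`γ⁻¹` exchange their roles. Commutativity keeps the multiplication compatible with the exchange. -/
theorem cop (h : TwoCocycle γ γ') : TwoCocycle (γ' ∘ₗ (commCop A).symm.toLinearMap)
    (γ ∘ₗ (commCop A).symm.toLinearMap) where
  inv_lact x := by
    obtain ⟨z, rfl⟩ := (commCop A).surjective x
    rw [lact_commCop, comp_commCop_symm_comp, counit_commCop, ← h.inv_lact, apply_lact]
    simp
  lact_inv x := by
    obtain ⟨z, rfl⟩ := (commCop A).surjective x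
    rw [lact_commCop, comp_commCop_symm_comp, counit_commCop, ← h.lact_inv, apply_lact]
    simp
  cocycle g k l := by
    obtain ⟨a, rfl⟩ := (toCop A).surjective g
    obtain ⟨b, rfl⟩ := (toCop A).surjective k
    obtain ⟨c, rfl⟩ := (toCop A).surjective l
    rw [← commCop_tmul, ← commCop_tmul, lact_commCop, lact_commCop, comp_commCop_symm_comp,
      mul'_commCop, mul'_commCop]
    exact (h.cocycle_inv c b a).symm
  cocycle_inv g k l := by
    obtain ⟨a, rfl⟩ := (toCop A).surjective g
    obtain ⟨b, rfl⟩ := (toCop A).surjective k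
    obtain ⟨c, rfl⟩ := (toCop A).surjective l
    rw [← commCop_tmul, ← commCop_tmul, ract_commCop, ract_commCop, comp_commCop_symm_comp,
      mul'_commCop, mul'_commCop]
    exact (h.cocycle c b a).symm
  apply_one k := by
    obtain ⟨a, rfl⟩ := (toCop A).surjective k
    exact h.inv_one_apply a
  one_apply k := by
    obtain ⟨a, rfl⟩ := (toCop A).surjective k
    exact h.inv_apply_one a
  inv_apply_one k := by
    obtain ⟨a, rfl⟩ := (toCop A).surjective k
    exact h.one_apply a
  inv_one_apply k := by
    obtain ⟨a, rfl⟩ := (toCop A).surjective k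
    exact h.apply_one a

theorem twistFunctional_cop (γ' : A ⊗[ℂ] A →ₗ[ℂ] ℂ) :
    twistFunctional (γ' ∘ₗ (commCop A).symm.toLinearMap) ∘ₗ (toCop A).toLinearMap =
      twistFunctionalInv γ' := by
  refine LinearMap.ext fun a => ?_
  have key : ∀ x : A ⊗[ℂ] A, γ' ((commCop A).symm ((HopfAlgebra.antipode ℂ).lTensor (Cop A)
      (TensorProduct.map (toCop A).toLinearMap (toCop A).toLinearMap
        (TensorProduct.comm ℂ A A x)))) =
      γ' (antipodeTensor A ((toCop A).toLinearMap.rTensor A x)) := by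
    intro x
    induction x with
    | zero => simp only [map_zero]
    | add x y hx hy => simp only [map_add, hx, hy]
    | tmul a b => rfl
  exact key (Coalgebra.comul a)

theorem twistFunctionalInv_cop (γ : A ⊗[ℂ] A →ₗ[ℂ] ℂ) :
    twistFunctionalInv (γ ∘ₗ (commCop A).symm.toLinearMap) ∘ₗ (toCop A).toLinearMap =
      twistFunctional γ := by
  refine LinearMap.ext fun a => ?_
  have key : ∀ x : A ⊗[ℂ] A, γ ((commCop A).symm (antipodeTensor (Cop A)
      ((toCop (Cop A)).toLinearMap.rTensor (Cop A)
      (TensorProduct.map (toCop A).toLinearMap (toCop A).toLinearMap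
        (TensorProduct.comm ℂ A A x))))) =
      γ ((HopfAlgebra.antipode ℂ).lTensor A x) := by
    intro x
    induction x with
    | zero => simp only [map_zero]
    | add x y hx hy => simp only [map_add, hx, hy]
    | tmul a b => rfl
  exact key (Coalgebra.comul a)

theorem deformedAntipode_toCop (a : A) :
    deformedAntipode (γ' ∘ₗ (commCop A).symm.toLinearMap) (γ ∘ₗ (commCop A).symm.toLinearMap)
      (toCop A a) = toCop A (deformedAntipode γ γ' a) := by
  rw [deformedAntipode, LinearMap.comp_apply, LinearMap.comp_apply, ract_toCop,
    twistFunctionalInv_cop, lact_toCop, twistFunctional_cop, antipode_toCop, ← lact_ract]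
  rfl

/-- The deformed antipode of the co-opposite, for the mirrored cocycle, is the same map. Hence its
left antipode identity is the right one for `A`. -/
theorem mul'_lTensor_deformedAntipode (h : TwoCocycle γ γ') (a : A) :
    LinearMap.mul' ℂ A (lact γ (ract γ' ((deformedAntipode γ γ').lTensor A
      (Coalgebra.comul (R := ℂ) a)))) = Coalgebra.counit (R := ℂ) a • (1 : A) := by
  have h1 := h.cop.mul'_rTensor_deformedAntipode (toCop A a)
  have h2 : ∀ x : A ⊗[ℂ] A, (deformedAntipode (γ' ∘ₗ (commCop A).symm.toLinearMap)
      (γ ∘ₗ (commCop A).symm.toLinearMap)).rTensor (Cop A)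
      (TensorProduct.map (toCop A).toLinearMap (toCop A).toLinearMap
        (TensorProduct.comm ℂ A A x)) = commCop A ((deformedAntipode γ γ').lTensor A x) := by
    intro x
    induction x with
    | zero => simp only [map_zero]
    | add x y hx hy => simp only [map_add, hx, hy]
    | tmul a b =>
      rw [TensorProduct.comm_tmul, TensorProduct.map_tmul, LinearMap.rTensor_tmul,
        AlgEquiv.toLinearMap_apply, deformedAntipode_toCop]
      rfl
  rw [comul_toCop, h2, ract_commCop, lact_commCop, mul'_commCop, comp_commCop_symm_comp,
    comp_commCop_symm_comp, counit_toCop, ← lact_ract] at h1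
  exact (toCop A).injective (h1.trans (by simp))

end TwoCocycle

theorem UnitaryTwoCocycle.isHopfAlgebra_mulA {star : A → A} (c : UnitaryTwoCocycle star) :
    IsHopfAlgebra c.mulA (1 : A) where
  algebra := c.isUnitalAlgebra_mulA
  comul_one := Bialgebra.comul_one.trans Algebra.TensorProduct.one_def
  comul_mul := c.comul_mulA
  counit_one := Bialgebra.counit_one
  counit_mul := c.counit_mulA
  exists_antipode := ⟨TwoCocycle.deformedAntipode c.γ c.γinv,
    c.twoCocycle.deformedAntipode_bijective,
    fun a => by rw [lift_mulA, c.twoCocycle.mul'_rTensor_deformedAntipode],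
    fun a => by rw [lift_mulA, c.twoCocycle.mul'_lTensor_deformedAntipode]⟩

end DeformedAntipode

end CocycleCalculus

end

noncomputable section

namespace CocycleCalculus

/-! ### The deformed calculus -/

section DeformedCalculus

open TensorProduct

theorem IsComodule.of_injective {A M V : Type*} [AddCommGroup A] [Module ℂ A] [Coalgebra ℂ A]
    [AddCommGroup M] [Module ℂ M] [AddCommGroup V] [Module ℂ V] {δ : M →ₗ[ℂ] A ⊗[ℂ] M}
    (hδ : IsComodule δ) {i : V →ₗ[ℂ] M} (hi : Function.Injective i) {δV : V →ₗ[ℂ] A ⊗[ℂ] V}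
    (hV : ∀ v, δ (i v) = i.lTensor A (δV v)) : IsComodule δV where
  coassoc v := by
    apply Module.Flat.lTensor_preserves_injective_linearMap (M := A) _
      (Module.Flat.lTensor_preserves_injective_linearMap (M := A) _ hi)
    rw [← assoc_comul_lTensor, ← hV, hδ.coassoc, ← lTensor_lTensor_of_colinear hV, ← hV]
  counit v := by
    apply hi
    rw [← lid_counit_lTensor, ← hV, hδ.counit]

variable {A B E : Type*} [CommRing A] [HopfAlgebra ℂ A] [AddCommGroup B] [Module ℂ B]
  [AddCommGroup E] [Module ℂ E] {D : CalculusData A B E}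

theorem CalculusData.IsCovariantCalculus.isComodule_coactForms (h : D.IsCovariantCalculus) (k : ℕ) :
    IsComodule (h.coactForms k) :=
  h.total.comodule.of_injective (Submodule.injective_subtype (D.Ω k)) fun ω =>
    (h.lTensor_coactForms k ω).symm

namespace UnitaryTwoCocycle

variable {star : A → A} (c : UnitaryTwoCocycle star) {M N P R : Type*} [AddCommGroup M]
  [Module ℂ M] [AddCommGroup N] [Module ℂ N] [AddCommGroup P] [Module ℂ P] [AddCommGroup R]
  [Module ℂ R] {δM : M →ₗ[ℂ] A ⊗[ℂ] M} {δN : N →ₗ[ℂ] A ⊗[ℂ] N}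

/-- Colinear maps may be moved inside a deformed pairing, which turns an identity of colinear maps
into the same identity for deformed products. -/
theorem deform_map {M' N' : Type*} [AddCommGroup M'] [Module ℂ M'] [AddCommGroup N'] [Module ℂ N']
    {δM' : M' →ₗ[ℂ] A ⊗[ℂ] M'} {δN' : N' →ₗ[ℂ] A ⊗[ℂ] N'} {f : M →ₗ[ℂ] M'} {g : N →ₗ[ℂ] N'}
    (hf : ∀ m, δM' (f m) = f.lTensor A (δM m)) (hg : ∀ n, δN' (g n) = g.lTensor A (δN n))
    (F : M' →ₗ[ℂ] N' →ₗ[ℂ] R) (m : M) (n : N) :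
    c.deform δM' δN' F (f m) (g n) = c.deform δM δN (F.compl₁₂ f g) m n := by
  rw [deform_apply, deform_apply, ← TensorProduct.map_tmul, c.twist_map hf hg,
    ← LinearMap.comp_apply, TensorProduct.lift_comp_map]
  rfl

theorem map_deform (φ : R →ₗ[ℂ] P) (F : M →ₗ[ℂ] N →ₗ[ℂ] R) (m : M) (n : N) :
    φ (c.deform δM δN F m n) = c.deform δM δN (F.compr₂ φ) m n := by
  rw [deform_apply, deform_apply, ← LinearMap.comp_apply, TensorProduct.lift_compr₂]

theorem deform_add (F G : M →ₗ[ℂ] N →ₗ[ℂ] R) (m : M) (n : N) :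
    c.deform δM δN (F + G) m n = c.deform δM δN F m n + c.deform δM δN G m n := by
  have : TensorProduct.lift (F + G) = TensorProduct.lift F + TensorProduct.lift G := by
    ext; simp
  rw [deform_apply, deform_apply, deform_apply, this, LinearMap.add_apply]

theorem deform_smul (z : ℂ) (F : M →ₗ[ℂ] N →ₗ[ℂ] R) (m : M) (n : N) :
    c.deform δM δN (z • F) m n = z • c.deform δM δN F m n := by
  have : TensorProduct.lift (z • F) = z • TensorProduct.lift F := by
    ext; simp
  rw [deform_apply, deform_apply, this, LinearMap.smul_apply]

theorem deform_mem {F : M →ₗ[ℂ] N →ₗ[ℂ] R} {W : Submodule ℂ R} (hW : ∀ m n, F m n ∈ W) (m : M)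
    (n : N) : c.deform δM δN F m n ∈ W := by
  rw [deform_apply]
  induction c.twist δM δN (m ⊗ₜ n) with
  | zero => rw [map_zero]; exact W.zero_mem
  | add x y hx hy => rw [map_add]; exact W.add_mem hx hy
  | tmul m n => exact hW m n

/-- A subspace that contains the values of the deformed pairing contains those of the original
one. -/
theorem mem_of_deform_mem (hM : IsComodule δM) (hN : IsComodule δN) {F : M →ₗ[ℂ] N →ₗ[ℂ] R}
    {W : Submodule ℂ R} (hW : ∀ m n, c.deform δM δN F m n ∈ W) (m : M) (n : N) : F m n ∈ W := by
  have key : ∀ y : M ⊗[ℂ] N, TensorProduct.lift (c.deform δM δN F) y ∈ W := by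
    intro y
    induction y with
    | zero => rw [map_zero]; exact W.zero_mem
    | add x y hx hy => rw [map_add]; exact W.add_mem hx hy
    | tmul m n => exact hW m n
  obtain ⟨y, hy⟩ := (c.twistEquiv hM hN).surjective (m ⊗ₜ n)
  rw [twistEquiv_apply] at hy
  have e : TensorProduct.lift F (m ⊗ₜ n) ∈ W := by
    rw [← hy, ← lift_deform]
    exact key y
  exact e

end UnitaryTwoCocycle

/-- The inclusion of `B`, the inclusions of the `Ω^k` and `d` are colinear, so every axiom is the
old one inside a deformed pairing. The sign in the Leibniz rule depends on the degree, so that rule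
is used on one `Ω^k` at a time. Only generation needs more, namely `hΩ`. -/
theorem UnitaryTwoCocycle.isCovariantCalculus_deformData {star : A → A}
    (c : UnitaryTwoCocycle star) (h : D.IsCovariantCalculus) (hm : D.mulA = LinearMap.mul ℂ A)
    (h1 : D.oneA = 1) (hΩ : ∀ (k : ℕ) (W : Submodule ℂ E),
      (∀ ω ∈ D.Ω k, ∀ b, D.wedge ω (D.d (D.ι b)) ∈ W) → D.Ω (k + 1) ≤ W) :
    (c.deformData D).IsCovariantCalculus := by
  have hB : IsComoduleAlgebra (LinearMap.mul ℂ A) 1 D.mulB D.oneB D.coactB := hm ▸ h1 ▸ h.base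
  have hE : IsComoduleAlgebra (LinearMap.mul ℂ A) 1 D.wedge (D.ι D.oneB) D.coact :=
    hm ▸ h1 ▸ h.total
  have hid : ∀ ω, D.coact (LinearMap.id (R := ℂ) ω) = LinearMap.id.lTensor A (D.coact ω) := by
    intro ω; rw [LinearMap.lTensor_id]; rfl
  have hsub : ∀ (k : ℕ) (ω : D.Ω k), D.coact ((D.Ω k).subtype ω) =
      (D.Ω k).subtype.lTensor A (h.coactForms k ω) := fun k ω => (h.lTensor_coactForms k ω).symm
  have hdι : ∀ b, D.coact ((D.d ∘ₗ D.ι) b) = (D.d ∘ₗ D.ι).lTensor A (D.coactB b) := fun b => by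
    rw [LinearMap.comp_apply, h.coact_d, h.coact_ι, LinearMap.lTensor_comp_apply]
  have hdsub : ∀ (k : ℕ) (ω : D.Ω k), D.coact ((D.d ∘ₗ (D.Ω k).subtype) ω) =
      (D.d ∘ₗ (D.Ω k).subtype).lTensor A (h.coactForms k ω) := fun k ω => by
    rw [LinearMap.comp_apply, h.coact_d, LinearMap.lTensor_comp_apply, h.lTensor_coactForms]
    rfl
  have hwedge : ∀ {i j : ℕ} {ω η : E}, ω ∈ D.Ω i → η ∈ D.Ω j →
      c.deform D.coact D.coact D.wedge ω η ∈ D.Ω (i + j) := fun {i j ω η} hω hη => by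
    have e := c.deform_map (hsub i) (hsub j) D.wedge ⟨ω, hω⟩ ⟨η, hη⟩
    rw [Submodule.subtype_apply, Submodule.subtype_apply] at e
    rw [e]
    refine c.deform_mem (F := D.wedge.compl₁₂ (D.Ω i).subtype (D.Ω j).subtype) (fun ω η => ?_) _ _
    exact h.wedge_mem ω.2 η.2
  exact
  { hopf := h1 ▸ c.isHopfAlgebra_mulA
    base := h1 ▸ c.isComoduleAlgebra_deform hB
    total := h1 ▸ c.isComoduleAlgebra_deform hE
    ι_injective := h.ι_injective
    ι_mul := fun b b' => by
      change D.ι (c.deform D.coactB D.coactB D.mulB b b') =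
        c.deform D.coact D.coact D.wedge (D.ι b) (D.ι b')
      rw [c.deform_map h.coact_ι h.coact_ι, map_deform]
      congr 3
      exact LinearMap.ext₂ h.ι_mul
    range_ι := h.range_ι
    isInternal := h.isInternal
    wedge_mem := hwedge
    d_mem := h.d_mem
    d_d := h.d_d
    leibniz := fun {i ω} hω η => by
      change D.d (c.deform D.coact D.coact D.wedge ω η) =
        c.deform D.coact D.coact D.wedge (D.d ω) η +
          (-1 : ℂ) ^ i • c.deform D.coact D.coact D.wedge ω (D.d η)
      have e1 := c.deform_map (hsub i) hid D.wedge ⟨ω, hω⟩ η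
      have e2 := c.deform_map (hdsub i) hid D.wedge ⟨ω, hω⟩ η
      have e3 := c.deform_map (hsub i) h.coact_d D.wedge ⟨ω, hω⟩ η
      simp only [LinearMap.id_apply, Submodule.subtype_apply, LinearMap.comp_apply] at e1 e2 e3
      rw [e1, e2, e3, map_deform, ← deform_smul, ← deform_add]
      congr 3
      exact LinearMap.ext₂ fun ω η => h.leibniz ω.2 η
    generated := fun W hι hd hW => by
      have hle : ∀ k, D.Ω k ≤ W := by
        intro k
        induction k with
        | zero =>
          rw [← h.range_ι]
          rintro _ ⟨b, rfl⟩
          exact hι b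
        | succ k ih =>
          refine hΩ k W fun ω hω b => ?_
          -- The closure of `W` concerns the deformed product while `hΩ` concerns the old one;
          -- invertibility of the twist transfers membership.
          refine c.mem_of_deform_mem (F := D.wedge.compl₁₂ (D.Ω k).subtype (D.d ∘ₗ D.ι))
            (h.isComodule_coactForms k) h.base.comodule (fun ω b => ?_) ⟨ω, hω⟩ b
          rw [← c.deform_map (hsub k) hdι]
          exact hW _ (ih ω.2) _ (hd b)
      rw [eq_top_iff, ← h.isInternal.submodule_iSup_eq_top]
      exact iSup_le hle
    coact_ι := h.coact_ι
    coact_mem := h.coact_mem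
    coact_d := h.coact_d }

end DeformedCalculus

end CocycleCalculus

end

noncomputable section

namespace CocycleCalculus

/-! ### Deformation of projective modules -/

section DeformedProjective

open TensorProduct

variable {A : Type*} [CommRing A] [HopfAlgebra ℂ A] {M N N' B V X Y : Type*}
  [AddCommGroup M] [Module ℂ M] [AddCommGroup N] [Module ℂ N] [AddCommGroup N'] [Module ℂ N']
  [AddCommGroup B] [Module ℂ B] [AddCommGroup V] [Module ℂ V] [AddCommGroup X] [Module ℂ X]
  [AddCommGroup Y] [Module ℂ Y]
  {δM : M →ₗ[ℂ] A ⊗[ℂ] M} {δN : N →ₗ[ℂ] A ⊗[ℂ] N} {δN' : N' →ₗ[ℂ] A ⊗[ℂ] N'}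
  {δB : B →ₗ[ℂ] A ⊗[ℂ] B} {δV : V →ₗ[ℂ] A ⊗[ℂ] V} {δX : X →ₗ[ℂ] A ⊗[ℂ] X}
  {δY : Y →ₗ[ℂ] A ⊗[ℂ] Y}

theorem rTensor_lTensor_comm {C C' : Type*} [AddCommGroup C] [Module ℂ C] [AddCommGroup C']
    [Module ℂ C'] (f : C →ₗ[ℂ] C') (g : M →ₗ[ℂ] N) (x : C ⊗[ℂ] M) :
    f.rTensor N (g.lTensor C x) = g.lTensor C' (f.rTensor M x) := by
  induction x with
  | zero => simp only [map_zero]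
  | add x y hx hy => simp only [map_add, hx, hy]
  | tmul a m => simp

/-- The map `n ⊗ a ↦ a n₍₋₁₎ ⊗ n₍₀₎` from a diagonal to a cofree comodule. -/
def toCofree (δN : N →ₗ[ℂ] A ⊗[ℂ] N) : N ⊗[ℂ] A →ₗ[ℂ] A ⊗[ℂ] N :=
  TensorProduct.lift ((LinearMap.rTensorHom N ∘ₗ LinearMap.mul ℂ A).flip ∘ₗ δN)

theorem toCofree_tmul (n : N) (a : A) :
    toCofree δN (n ⊗ₜ a) = (LinearMap.mul ℂ A a).rTensor N (δN n) := rfl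

theorem toCofree_tmul_one (n : N) : toCofree δN (n ⊗ₜ 1) = δN n := by
  have : LinearMap.mul ℂ A 1 = LinearMap.id := LinearMap.ext one_mul
  rw [toCofree_tmul, this, LinearMap.rTensor_id]; rfl

theorem toCofree_map {g : N →ₗ[ℂ] N'} (hg : ∀ n, δN' (g n) = g.lTensor A (δN n)) (z : N ⊗[ℂ] A) :
    toCofree δN' (g.rTensor A z) = g.lTensor A (toCofree δN z) := by
  induction z with
  | zero => simp only [map_zero]
  | add x y hx hy => simp only [map_add, hx, hy]
  | tmul n a =>
    rw [LinearMap.rTensor_tmul, toCofree_tmul, toCofree_tmul, hg, rTensor_lTensor_comm]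

/-- This is colinearity of `toCofree`, with the coaction on `A ⊗ N` given by the first factor alone.
The factors of `A` are reordered by commutativity. -/
theorem lTensor_toCofree (hN : IsComodule δN) (z : N ⊗[ℂ] A) :
    (toCofree δN).lTensor A (diagCoact δN Coalgebra.comul z) =
      TensorProduct.assoc ℂ A A N ((Coalgebra.comul (R := ℂ)).rTensor N (toCofree δN z)) := by
  let G := TensorProduct.map₂ (LinearMap.mul ℂ A) (LinearMap.rTensorHom N ∘ₗ LinearMap.mul ℂ A)
  have h1 : ∀ (t : A ⊗[ℂ] N) (u : A ⊗[ℂ] A), (toCofree δN).lTensor A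
      ((LinearMap.mul' ℂ A).rTensor (N ⊗[ℂ] A) (tensorTensorTensorComm ℂ A N A A (t ⊗ₜ u))) =
      G u (δN.lTensor A t) := by
    intro t u
    induction t with
    | zero => simp only [map_zero, TensorProduct.zero_tmul]
    | add x y hx hy => simp only [map_add, TensorProduct.add_tmul, hx, hy]
    | tmul x n =>
      induction u with
      | zero => simp only [map_zero, TensorProduct.tmul_zero, LinearMap.zero_apply]
      | add x y hx hy => simp only [map_add, TensorProduct.tmul_add, hx, hy, LinearMap.add_apply]
      | tmul p q => simp [G, toCofree_tmul, mul_comm]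
  have h2 : ∀ (a : A) (t : A ⊗[ℂ] N), TensorProduct.assoc ℂ A A N
      ((Coalgebra.comul (R := ℂ)).rTensor N ((LinearMap.mul ℂ A a).rTensor N t)) =
      G (Coalgebra.comul a) (TensorProduct.assoc ℂ A A N
        ((Coalgebra.comul (R := ℂ)).rTensor N t)) := by
    intro a t
    induction t with
    | zero => simp only [map_zero]
    | add x y hx hy => simp only [map_add, hx, hy]
    | tmul x n =>
      simp only [LinearMap.rTensor_tmul, LinearMap.mul_apply', Bialgebra.comul_mul]
      induction Coalgebra.comul (R := ℂ) a with
      | zero => simp only [zero_mul, map_zero, TensorProduct.zero_tmul, LinearMap.zero_apply]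
      | add u v hu hv =>
        simp only [add_mul, map_add, TensorProduct.add_tmul, LinearMap.add_apply, hu, hv]
      | tmul p q =>
        induction Coalgebra.comul (R := ℂ) x with
        | zero => simp only [mul_zero, map_zero, TensorProduct.zero_tmul]
        | add u v hu hv => simp only [mul_add, map_add, TensorProduct.add_tmul, hu, hv]
        | tmul r s => simp [G]
  induction z with
  | zero => simp only [map_zero]
  | add x y hx hy => simp only [map_add, hx, hy]
  | tmul n a =>
    rw [toCofree_tmul, h2, hN.coassoc, ← h1]
    rfl

/-- The inverse `a ⊗ n ↦ n₍₀₎ ⊗ a S(n₍₋₁₎)` of `toCofree`. -/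
def ofCofree (δN : N →ₗ[ℂ] A ⊗[ℂ] N) : A ⊗[ℂ] N →ₗ[ℂ] N ⊗[ℂ] A :=
  (TensorProduct.comm ℂ A N).toLinearMap ∘ₗ
    (LinearMap.mul' ℂ A ∘ₗ (HopfAlgebra.antipode ℂ).lTensor A).rTensor N ∘ₗ
    (TensorProduct.assoc ℂ A A N).symm.toLinearMap ∘ₗ δN.lTensor A

theorem IsComodule.counit_smul_rTensor (hN : IsComodule δN) {f : A →ₗ[ℂ] A} {a : A}
    (hf : ∀ x, f x = Coalgebra.counit (R := ℂ) x • a) (n : N) : f.rTensor N (δN n) = a ⊗ₜ n := by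
  have key : ∀ t : A ⊗[ℂ] N, f.rTensor N t =
      a ⊗ₜ TensorProduct.lid ℂ N ((Coalgebra.counit (R := ℂ)).rTensor N t) := by
    intro t
    induction t with
    | zero => simp only [map_zero, TensorProduct.tmul_zero]
    | add x y hx hy => simp only [map_add, TensorProduct.tmul_add, hx, hy]
    | tmul x n => simp [hf, TensorProduct.smul_tmul]
  rw [key, hN.counit]

theorem toCofree_ofCofree (hN : IsComodule δN) (z : A ⊗[ℂ] N) :
    toCofree δN (ofCofree δN z) = z := by
  induction z with
  | zero => simp only [map_zero]
  | add x y hx hy => simp only [map_add, hx, hy]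
  | tmul a n =>
    let f : A ⊗[ℂ] A →ₗ[ℂ] A := LinearMap.mul ℂ A a ∘ₗ LinearMap.mul' ℂ A ∘ₗ
      (HopfAlgebra.antipode ℂ).rTensor A
    have h1 : ∀ t : A ⊗[ℂ] N, toCofree δN (TensorProduct.comm ℂ A N
        ((LinearMap.mul' ℂ A ∘ₗ (HopfAlgebra.antipode ℂ).lTensor A).rTensor N
          ((TensorProduct.assoc ℂ A A N).symm (a ⊗ₜ t)))) =
        f.rTensor N ((TensorProduct.assoc ℂ A A N).symm (δN.lTensor A t)) := by
      intro t
      induction t with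
      | zero => simp only [map_zero, TensorProduct.tmul_zero]
      | add x y hx hy => simp only [map_add, TensorProduct.tmul_add, hx, hy]
      | tmul x n =>
        simp only [TensorProduct.assoc_symm_tmul, LinearMap.rTensor_tmul, LinearMap.comp_apply,
          LinearMap.lTensor_tmul, LinearMap.mul'_apply, TensorProduct.comm_tmul, toCofree_tmul]
        induction δN n with
        | zero => simp only [map_zero, TensorProduct.tmul_zero]
        | add x y hx hy => simp only [map_add, TensorProduct.tmul_add, hx, hy]
        | tmul y n => simp [f, mul_assoc]
    refine (h1 (δN n)).trans ?_
    rw [← hN.coassoc, LinearEquiv.symm_apply_apply, ← LinearMap.rTensor_comp_apply]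
    refine hN.counit_smul_rTensor (fun x => ?_) n
    simp only [f, LinearMap.comp_apply]
    rw [HopfAlgebra.mul_antipode_rTensor_comul_apply]
    simp [Algebra.algebraMap_eq_smul_one]

theorem ofCofree_toCofree (hN : IsComodule δN) (z : N ⊗[ℂ] A) :
    ofCofree δN (toCofree δN z) = z := by
  induction z with
  | zero => simp only [map_zero]
  | add x y hx hy => simp only [map_add, hx, hy]
  | tmul n a =>
    let f : A ⊗[ℂ] A →ₗ[ℂ] A := LinearMap.mul ℂ A a ∘ₗ LinearMap.mul' ℂ A ∘ₗ
      (HopfAlgebra.antipode ℂ).lTensor A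
    have h1 : ∀ t : A ⊗[ℂ] N, ofCofree δN ((LinearMap.mul ℂ A a).rTensor N t) =
        TensorProduct.comm ℂ A N (f.rTensor N ((TensorProduct.assoc ℂ A A N).symm
          (δN.lTensor A t))) := by
      intro t
      induction t with
      | zero => simp only [map_zero]
      | add x y hx hy => simp only [map_add, hx, hy]
      | tmul x n =>
        simp only [LinearMap.rTensor_tmul, LinearMap.lTensor_tmul, ofCofree, LinearMap.comp_apply,
          LinearEquiv.coe_coe]
        induction δN n with
        | zero => simp only [map_zero, TensorProduct.tmul_zero]
        | add x y hx hy => simp only [map_add, TensorProduct.tmul_add, hx, hy]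
        | tmul y n => simp [f, mul_assoc]
    rw [toCofree_tmul, h1, ← hN.coassoc, LinearEquiv.symm_apply_apply,
      ← LinearMap.rTensor_comp_apply]
    rw [hN.counit_smul_rTensor (a := a) (fun x => ?_) n, TensorProduct.comm_tmul]
    simp only [f, LinearMap.comp_apply]
    rw [HopfAlgebra.mul_antipode_lTensor_comul_apply]
    simp [Algebra.algebraMap_eq_smul_one]

/-- The isomorphism of a diagonal and a cofree comodule. -/
def cofreeEquiv (hN : IsComodule δN) : N ⊗[ℂ] A ≃ₗ[ℂ] A ⊗[ℂ] N :=
  LinearEquiv.ofLinearMap (toCofree δN) (ofCofree δN) (LinearMap.ext (toCofree_ofCofree hN))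
    (LinearMap.ext (ofCofree_toCofree hN))

theorem cofreeEquiv_apply (hN : IsComodule δN) (z : N ⊗[ℂ] A) :
    cofreeEquiv hN z = toCofree δN z := rfl

/-- An action on `X` alone becomes the diagonal action on `A ⊗ X`, because the action on `X` is
covariant. -/
theorem toCofree_act {F : B →ₗ[ℂ] X →ₗ[ℂ] X}
    (hF : ∀ b x, δX (F b x) = TensorProduct.map₂ (LinearMap.mul ℂ A) F (δB b) (δX x)) (b : B)
    (z : X ⊗[ℂ] A) : toCofree δX ((F b).rTensor A z) =
      TensorProduct.map₂ (LinearMap.mul ℂ A) F (δB b) (toCofree δX z) := by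
  induction z with
  | zero => simp only [map_zero]
  | add x y hx hy => simp only [map_add, hx, hy]
  | tmul x a =>
    rw [LinearMap.rTensor_tmul, toCofree_tmul, toCofree_tmul, hF]
    induction δB b with
    | zero => simp only [map_zero, LinearMap.zero_apply]
    | add u v hu hv => simp only [map_add, LinearMap.add_apply, hu, hv]
    | tmul p b =>
      induction δX x with
      | zero => simp only [map_zero]
      | add u v hu hv => simp only [map_add, hu, hv]
      | tmul q x => simp [mul_left_comm]

theorem diagCoact_act {F : B →ₗ[ℂ] X →ₗ[ℂ] X}
    (hF : ∀ b x, δX (F b x) = TensorProduct.map₂ (LinearMap.mul ℂ A) F (δB b) (δX x)) (b : B)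
    (z : X ⊗[ℂ] Y) : diagCoact δX δY ((LinearMap.rTensorHom Y ∘ₗ F) b z) =
      TensorProduct.map₂ (LinearMap.mul ℂ A) (LinearMap.rTensorHom Y ∘ₗ F) (δB b)
        (diagCoact δX δY z) := by
  have key : ∀ (p : A ⊗[ℂ] B) (q : A ⊗[ℂ] X) (r : A ⊗[ℂ] Y), (LinearMap.mul' ℂ A).rTensor (X ⊗[ℂ] Y)
      (tensorTensorTensorComm ℂ A X A Y (TensorProduct.map₂ (LinearMap.mul ℂ A) F p q ⊗ₜ r)) =
      TensorProduct.map₂ (LinearMap.mul ℂ A) (LinearMap.rTensorHom Y ∘ₗ F) p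
        ((LinearMap.mul' ℂ A).rTensor (X ⊗[ℂ] Y) (tensorTensorTensorComm ℂ A X A Y (q ⊗ₜ r))) := by
    intro p q r
    induction p with
    | zero => simp only [map_zero, LinearMap.zero_apply, TensorProduct.zero_tmul]
    | add u v hu hv => simp only [map_add, LinearMap.add_apply, TensorProduct.add_tmul, hu, hv]
    | tmul p b =>
      induction q with
      | zero => simp only [map_zero, TensorProduct.zero_tmul]
      | add u v hu hv => simp only [map_add, TensorProduct.add_tmul, hu, hv]
      | tmul q x =>
        induction r with
        | zero => simp only [map_zero, TensorProduct.tmul_zero]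
        | add u v hu hv => simp only [map_add, TensorProduct.tmul_add, hu, hv]
        | tmul r y => simp [mul_assoc]
  induction z with
  | zero => simp only [map_zero]
  | add x y hx hy => simp only [map_add, hx, hy]
  | tmul x y =>
    refine Eq.trans ?_ (key (δB b) (δX x) (δY y))
    rw [← hF]
    rfl

/-- The colinear map `M → (B ⊗ V) ⊗ A` associated with a linear map `j : M → B ⊗ V`. -/
def colinearLift (hN : IsComodule δN) (δM : M →ₗ[ℂ] A ⊗[ℂ] M) (j : M →ₗ[ℂ] N) : M →ₗ[ℂ] N ⊗[ℂ] A :=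
  (cofreeEquiv hN).symm.toLinearMap ∘ₗ j.lTensor A ∘ₗ δM

theorem toCofree_colinearLift (hN : IsComodule δN) (j : M →ₗ[ℂ] N) (m : M) :
    toCofree δN (colinearLift hN δM j m) = j.lTensor A (δM m) :=
  (cofreeEquiv hN).apply_symm_apply _

/-- For any linear `j`, the map `m ↦ m₍₋₁₎ ⊗ j(m₍₀₎)` is colinear into the cofree comodule; the
isomorphism transports this to the diagonal coaction. -/
theorem diagCoact_colinearLift (hM : IsComodule δM) (hN : IsComodule δN) (j : M →ₗ[ℂ] N) (m : M) :
    diagCoact δN Coalgebra.comul (colinearLift hN δM j m) =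
      (colinearLift hN δM j).lTensor A (δM m) := by
  have e : toCofree δN ∘ₗ colinearLift hN δM j = j.lTensor A ∘ₗ δM :=
    LinearMap.ext (toCofree_colinearLift hN j)
  apply Module.Flat.lTensor_preserves_injective_linearMap (M := A) (toCofree δN)
    (cofreeEquiv hN).injective
  rw [lTensor_toCofree hN, toCofree_colinearLift, assoc_comul_lTensor, hM.coassoc,
    ← LinearMap.lTensor_comp_apply, ← e, LinearMap.lTensor_comp_apply]

theorem colinearLift_act (hN : IsComodule δN) {F : B →ₗ[ℂ] N →ₗ[ℂ] N} {l : B →ₗ[ℂ] M →ₗ[ℂ] M}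
    (hF : ∀ b x, δN (F b x) = TensorProduct.map₂ (LinearMap.mul ℂ A) F (δB b) (δN x))
    (hl : ∀ b x, δM (l b x) = TensorProduct.map₂ (LinearMap.mul ℂ A) l (δB b) (δM x))
    {j : M →ₗ[ℂ] N} (hj : ∀ b m, j (l b m) = F b (j m)) (b : B) (m : M) :
    colinearLift hN δM j (l b m) = (LinearMap.rTensorHom A ∘ₗ F) b (colinearLift hN δM j m) := by
  apply (cofreeEquiv hN).injective
  rw [cofreeEquiv_apply, cofreeEquiv_apply, toCofree_colinearLift, hl]
  refine Eq.trans ?_ (toCofree_act hF b _).symm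
  rw [toCofree_colinearLift]
  induction δB b with
  | zero => simp only [map_zero, LinearMap.zero_apply]
  | add u v hu hv => simp only [map_add, LinearMap.add_apply, hu, hv]
  | tmul p b =>
    induction δM m with
    | zero => simp only [map_zero]
    | add u v hu hv => simp only [map_add, hu, hv]
    | tmul q x => simp [hj]

/-- In the cofree picture both sides become `m₍₋₁₎ ⊗ m₍₀₎`; the extra factor `A` carries only `1`
after projection. -/
theorem rTensor_colinearLift (hM : IsComodule δM) (hN : IsComodule δN) {j : M →ₗ[ℂ] N}
    {π : N →ₗ[ℂ] M} (hπ : ∀ n, δM (π n) = π.lTensor A (δN n)) (hj : ∀ m, π (j m) = m) (m : M) :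
    π.rTensor A (colinearLift hN δM j m) = m ⊗ₜ 1 := by
  apply (cofreeEquiv hM).injective
  rw [cofreeEquiv_apply, cofreeEquiv_apply, toCofree_tmul_one, toCofree_map hπ,
    toCofree_colinearLift, ← LinearMap.lTensor_comp_apply,
    show π ∘ₗ j = LinearMap.id from LinearMap.ext hj, LinearMap.lTensor_id]
  rfl

namespace UnitaryTwoCocycle

variable {star : A → A} (c : UnitaryTwoCocycle star)

/-- The twist of `X ⊗ Y` is linear over the deformed algebra. -/
theorem twist_act (hB : IsComodule δB) (hX : IsComodule δX) (hY : IsComodule δY)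
    {F : B →ₗ[ℂ] X →ₗ[ℂ] X}
    (hF : ∀ b x, δX (F b x) = TensorProduct.map₂ (LinearMap.mul ℂ A) F (δB b) (δX x)) (b : B)
    (z : X ⊗[ℂ] Y) : c.twist δX δY ((c.deform δB δX F b).rTensor Y z) =
      c.deform δB (diagCoact δX δY) (LinearMap.rTensorHom Y ∘ₗ F) b (c.twist δX δY z) := by
  have hid : ∀ y, δY (LinearMap.id (R := ℂ) y) = LinearMap.id.lTensor A (δY y) := by
    intro y; rw [LinearMap.lTensor_id]; rfl
  have hlift : ∀ y, δX (TensorProduct.lift F y) =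
      (TensorProduct.lift F).lTensor A (diagCoact δB δX y) := fun y =>
    LinearMap.congr_fun (f := δX ∘ₗ TensorProduct.lift F)
      (g := (TensorProduct.lift F).lTensor A ∘ₗ diagCoact δB δX)
      (TensorProduct.ext' fun b x => (hF b x).trans (map₂_mul_apply_eq F b x)) y
  have e : TensorProduct.lift (LinearMap.rTensorHom Y ∘ₗ F) ∘ₗ
      (TensorProduct.assoc ℂ B X Y).toLinearMap = (TensorProduct.lift F).rTensor Y := by
    ext; simp
  induction z with
  | zero => simp only [map_zero]
  | add x y hx hy => simp only [map_add, hx, hy]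
  | tmul x y =>
    have h1 := c.twist_map hlift hid ((c.twist δB δX).rTensor Y ((b ⊗ₜ x) ⊗ₜ y))
    have h2 := c.twist_assoc hB hX hY ((b ⊗ₜ x) ⊗ₜ y)
    rw [LinearMap.rTensor_tmul, deform_apply, deform_apply]
    refine h1.trans ?_
    refine (LinearMap.congr_fun e _).symm.trans ?_
    rw [LinearMap.comp_apply, LinearEquiv.coe_coe, h2]
    rfl

/-- The deformation of a splitting `M → B ⊗ V` of an equivariant surjection `B ⊗ V → M`. -/
theorem exists_deformed_section (hB : IsComodule δB) (hM : IsComodule δM) (hV : IsComodule δV)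
    {mB : B →ₗ[ℂ] B →ₗ[ℂ] B} {l : B →ₗ[ℂ] M →ₗ[ℂ] M}
    (hm : ∀ b x, δB (mB b x) = TensorProduct.map₂ (LinearMap.mul ℂ A) mB (δB b) (δB x))
    (hl : ∀ b x, δM (l b x) = TensorProduct.map₂ (LinearMap.mul ℂ A) l (δB b) (δM x))
    {i : V →ₗ[ℂ] M} (hi : ∀ v, δM (i v) = i.lTensor A (δV v)) {j : M →ₗ[ℂ] B ⊗[ℂ] V}
    (hj : ∀ b m, j (l b m) = (mB b).rTensor V (j m))
    (hij : ∀ m, TensorProduct.lift l (i.lTensor B (j m)) = m) :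
    ∃ K : M →ₗ[ℂ] B ⊗[ℂ] V,
      (∀ b m, K (c.deform δB δM l b m) = (c.deform δB δB mB b).rTensor V (K m)) ∧
      ∀ m, TensorProduct.lift (c.deform δB δM l) (i.lTensor B (K m)) = m := by
  have hid : ∀ a, Coalgebra.comul (R := ℂ) (LinearMap.id (R := ℂ) (M := A) a) =
      LinearMap.id.lTensor A (Coalgebra.comul (R := ℂ) a) := by
    intro y; rw [LinearMap.lTensor_id]; rfl
  have hidB : ∀ a, δB (LinearMap.id (R := ℂ) a) = LinearMap.id.lTensor A (δB a) := by
    intro y; rw [LinearMap.lTensor_id]; rfl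
  have hA : IsComodule (Coalgebra.comul (R := ℂ) (A := A)) := isComodule_comul
  have hP : IsComodule (diagCoact δB δV) := hB.diagCoact hV
  have hF := fun b => diagCoact_act (δY := δV) hm b
  let π : B ⊗[ℂ] V →ₗ[ℂ] M := TensorProduct.lift l ∘ₗ i.lTensor B
  have hπ : ∀ p, δM (π p) = π.lTensor A (diagCoact δB δV p) := fun p => by
    have hlift : δM ∘ₗ TensorProduct.lift l =
        (TensorProduct.lift l).lTensor A ∘ₗ diagCoact δB δM :=
      TensorProduct.ext' fun b x => (hl b x).trans (map₂_mul_apply_eq l b x)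
    have hdiag : diagCoact δB δM (i.lTensor B p) =
        (i.lTensor B).lTensor A (diagCoact δB δV p) := by
      exact (congrArg _ (coactTensor_map hidB hi p)).trans (rTensor_lTensor_comm _ _ _)
    refine (LinearMap.congr_fun hlift (i.lTensor B p)).trans ?_
    rw [LinearMap.comp_apply, hdiag, LinearMap.lTensor_comp_apply]
  -- `j` is `B`-linear but not colinear, so it is replaced by its colinear lift, which can be
  -- deformed.
  let J := colinearLift hP δM j
  have hJ : ∀ b m, J (c.deform δB δM l b m) = c.deform δB (diagCoact (diagCoact δB δV)
      Coalgebra.comul) (LinearMap.rTensorHom A ∘ₗ LinearMap.rTensorHom V ∘ₗ mB) b (J m) := by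
    intro b m
    have e := c.deform_map hidB (fun m => diagCoact_colinearLift hM hP j m)
      (LinearMap.rTensorHom A ∘ₗ LinearMap.rTensorHom V ∘ₗ mB) b m
    rw [LinearMap.id_apply] at e
    rw [map_deform, e]
    congr 3
    exact LinearMap.ext₂ (colinearLift_act hP hF hl hj)
  -- The counit on the factor `A` is not colinear. It is applied only after the twist has been
  -- undone, when the deformed action touches `B ⊗ V` alone, so linearity over `B_γ` is not lost.
  let ε : (B ⊗[ℂ] V) ⊗[ℂ] A →ₗ[ℂ] B ⊗[ℂ] V := (TensorProduct.rid ℂ _).toLinearMap ∘ₗ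
    (Coalgebra.counit (R := ℂ)).lTensor (B ⊗[ℂ] V)
  refine ⟨(c.twistEquiv hB hV).symm.toLinearMap ∘ₗ ε ∘ₗ (c.twistEquiv hP hA).symm.toLinearMap ∘ₗ J,
    fun b m => ?_, fun m => ?_⟩
  · have hε : ∀ (f : B ⊗[ℂ] V →ₗ[ℂ] B ⊗[ℂ] V) z, ε (f.rTensor A z) = f (ε z) := by
      intro f z
      induction z with
      | zero => simp only [map_zero]
      | add x y hx hy => simp only [map_add, hx, hy]
      | tmul p a => simp [ε]
    simp only [LinearMap.comp_apply, LinearEquiv.coe_coe]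
    rw [LinearEquiv.symm_apply_eq, twistEquiv_apply, c.twist_act hB hB hV hm, hJ]
    rw [← twistEquiv_apply c hB hV, LinearEquiv.apply_symm_apply, ← hε]
    congr 1
    rw [LinearEquiv.symm_apply_eq, twistEquiv_apply, c.twist_act hB hP hA hF,
      ← twistEquiv_apply c hP hA, LinearEquiv.apply_symm_apply]
  · have hε : ∀ z, π (ε z) = (TensorProduct.rid ℂ M) ((Coalgebra.counit (R := ℂ)).lTensor M
        (π.rTensor A z)) := by
      intro z
      induction z with
      | zero => simp only [map_zero]
      | add x y hx hy => simp only [map_add, hx, hy]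
      | tmul p a => simp [ε]
    simp only [LinearMap.comp_apply, LinearEquiv.coe_coe]
    rw [lift_deform]
    have h1 := c.twist_map hidB hi ((c.twistEquiv hB hV).symm
      (ε ((c.twistEquiv hP hA).symm (J m))))
    rw [← twistEquiv_apply c hB hV, LinearEquiv.apply_symm_apply] at h1
    refine (congrArg (TensorProduct.lift l) h1).trans ((hε _).trans ?_)
    -- The twist of `m ⊗ 1` is `m ⊗ 1`, so undoing the twist does not disturb the retraction
    -- identity.
    have h2 : π.rTensor A ((c.twistEquiv hP hA).symm (J m)) = m ⊗ₜ 1 := by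
      apply (c.twistEquiv hM hA).injective
      rw [twistEquiv_apply, twistEquiv_apply, c.twist_tmul_one Bialgebra.comul_one hM]
      refine (c.twist_map hπ hid _).trans ?_
      rw [← twistEquiv_apply c hP hA, LinearEquiv.apply_symm_apply]
      exact rTensor_colinearLift hM hP hπ hij m
    rw [h2]
    simp

end UnitaryTwoCocycle

end DeformedProjective

end CocycleCalculus

end

noncomputable section

namespace CocycleCalculus

/-! ### Finite-dimensional subcomodules -/

section Subcomodule

open TensorProduct

variable {A M : Type*} [AddCommGroup A] [Module ℂ A] [AddCommGroup M] [Module ℂ M]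

theorem exists_fg_forall_lid_rTensor_mem (x : A ⊗[ℂ] M) : ∃ S : Submodule ℂ M, S.FG ∧
    ∀ φ : A →ₗ[ℂ] ℂ, TensorProduct.lid ℂ M (φ.rTensor M x) ∈ S := by
  induction x with
  | zero => exact ⟨⊥, Submodule.fg_bot, fun φ => by simp⟩
  | add x y hx hy =>
    obtain ⟨S, hS, h⟩ := hx
    obtain ⟨T, hT, h'⟩ := hy
    refine ⟨S ⊔ T, hS.sup hT, fun φ => ?_⟩
    rw [map_add, map_add]
    exact add_mem (Submodule.mem_sup_left (h φ)) (Submodule.mem_sup_right (h' φ))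
  | tmul a m =>
    refine ⟨ℂ ∙ m, Submodule.fg_span_singleton m, fun φ => ?_⟩
    rw [LinearMap.rTensor_tmul, TensorProduct.lid_tmul]
    exact Submodule.smul_mem _ _ (Submodule.mem_span_singleton_self m)

theorem eq_zero_of_forall_lid_rTensor {x : A ⊗[ℂ] M}
    (h : ∀ φ : A →ₗ[ℂ] ℂ, TensorProduct.lid ℂ M (φ.rTensor M x) = 0) : x = 0 := by
  classical
  let b := Module.Basis.ofVectorSpace ℂ A
  apply (TensorProduct.equivFinsuppOfBasisLeft b (N := M)).injective
  rw [map_zero]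
  refine Finsupp.ext fun i => ?_
  rw [TensorProduct.equivFinsuppOfBasisLeft_apply]
  exact h (b.coord i)

/-- Modulo `V` all slices of `x` vanish, and functionals on `A` separate the tensors. -/
theorem mem_range_lTensor_subtype {V : Submodule ℂ M} {x : A ⊗[ℂ] M}
    (h : ∀ φ : A →ₗ[ℂ] ℂ, TensorProduct.lid ℂ M (φ.rTensor M x) ∈ V) :
    x ∈ LinearMap.range (V.subtype.lTensor A) := by
  have hex := lTensor_exact A (LinearMap.exact_subtype_mkQ V) V.mkQ_surjective
  refine (hex x).1 (eq_zero_of_forall_lid_rTensor fun φ => ?_)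
  rw [lid_rTensor_lTensor, Submodule.mkQ_apply, Submodule.Quotient.mk_eq_zero]
  exact h φ

variable [Coalgebra ℂ A] {δ : M →ₗ[ℂ] A ⊗[ℂ] M}

/-- This is local finiteness of comodules. The subspace spanned by all `φ(e₍₋₁₎) e₍₀₎` is
finite-dimensional because a tensor has finitely many terms, and it is stable because functionals
compose by convolution. -/
theorem IsComodule.exists_finiteDimensional_subcomodule (hδ : IsComodule δ) {n : ℕ}
    (e : Fin n → M) : ∃ V : Submodule ℂ M, FiniteDimensional ℂ V ∧ (∀ l, e l ∈ V) ∧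
      ∃ δV : V →ₗ[ℂ] A ⊗[ℂ] V, ∀ v, δ (V.subtype v) = V.subtype.lTensor A (δV v) := by
  let a : M → (A →ₗ[ℂ] ℂ) →ₗ[ℂ] M := fun m => (TensorProduct.lid ℂ M).toLinearMap ∘ₗ
    LinearMap.applyₗ (δ m) ∘ₗ LinearMap.rTensorHom M
  have ha : ∀ m φ, a m φ = act δ φ m := fun m φ => rfl
  have hfin : ∀ m, FiniteDimensional ℂ (LinearMap.range (a m)) := fun m => by
    obtain ⟨S, hS, h⟩ := exists_fg_forall_lid_rTensor_mem (δ m)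
    have : FiniteDimensional ℂ S := Module.Finite.iff_fg.2 hS
    refine Submodule.finiteDimensional_of_le (S₂ := S) ?_
    rintro _ ⟨φ, rfl⟩
    exact h φ
  let V : Submodule ℂ M := ⨆ l, LinearMap.range (a (e l))
  have hV : ∀ v : V, (δ ∘ₗ V.subtype) v ∈ LinearMap.range (V.subtype.lTensor A) := by
    have : V ≤ (LinearMap.range (V.subtype.lTensor A)).comap δ := by
      refine iSup_le fun l => ?_
      rintro _ ⟨φ, rfl⟩
      refine mem_range_lTensor_subtype fun ψ => ?_
      rw [ha, hδ.coact_act, ← LinearMap.rTensor_comp_apply]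
      exact Submodule.mem_iSup_of_mem l ⟨ψ ∘ₗ lact φ, rfl⟩
    exact fun v => this v.2
  have hinj := Module.Flat.lTensor_preserves_injective_linearMap (M := A) _
    (Submodule.injective_subtype V)
  refine ⟨V, Submodule.finiteDimensional_iSup _, fun l => ?_,
    (LinearEquiv.ofInjective (V.subtype.lTensor A) hinj).symm.toLinearMap ∘ₗ
    (δ ∘ₗ V.subtype).codRestrict _ hV, fun v => ?_⟩
  · refine Submodule.mem_iSup_of_mem l ⟨Coalgebra.counit, ?_⟩
    rw [ha, hδ.act_counit, LinearMap.id_apply]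
  · exact (congrArg Subtype.val (LinearEquiv.apply_symm_apply
      (LinearEquiv.ofInjective (V.subtype.lTensor A) hinj)
      ((δ ∘ₗ V.subtype).codRestrict _ hV v))).symm

end Subcomodule

/-! ### Finite generation and projectivity of the deformed one-forms -/

section FiniteProjective

open TensorProduct

/-- A finite dual basis presents the one-forms as a direct summand of a finite free module. -/
theorem CalculusData.IsCovariantCalculus.oneFormsFiniteProjective {A B E : Type*} [AddCommGroup A]
    [Module ℂ A] [Coalgebra ℂ A] [AddCommGroup B] [Module ℂ B] [AddCommGroup E] [Module ℂ E]
    {D : CalculusData A B E} (h : D.IsCovariantCalculus) {n : ℕ} {e : Fin n → D.Ω 1}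
    {f : Fin n → D.Ω 1 →ₗ[ℂ] B} (hf : ∀ i b ω, f i (h.lact 1 b ω) = D.mulB b (f i ω))
    (he : ∀ ω, ∑ i, h.lact 1 (f i ω) (e i) = ω) : h.OneFormsFiniteProjective := by
  let _ := h.ringB
  let _ := h.moduleOneForms
  let s : D.Ω 1 →ₗ[B] (Fin n → B) :=
    { toFun := fun ω i => f i ω
      map_add' := fun ω η => funext fun i => map_add (f i) ω η
      map_smul' := fun b ω => funext fun i => hf i b ω }
  let p : (Fin n → B) →ₗ[B] D.Ω 1 := Fintype.linearCombination B e
  have hp : p ∘ₗ s = LinearMap.id := LinearMap.ext fun ω =>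
    (Fintype.linearCombination_apply B e (s ω)).trans (he ω)
  have hsurj : Function.Surjective p := fun ω => ⟨s ω, LinearMap.congr_fun hp ω⟩
  exact ⟨Module.Finite.of_surjective p hsurj, Module.Projective.of_split s p hp⟩

variable {A B E : Type*} [CommRing A] [HopfAlgebra ℂ A] [AddCommGroup B] [Module ℂ B]
  [AddCommGroup E] [Module ℂ E] {D : CalculusData A B E}

namespace UnitaryTwoCocycle

variable {star : A → A} (c : UnitaryTwoCocycle star)

theorem lact_eq_deform (h : D.IsCovariantCalculus) (hγ : (c.deformData D).IsCovariantCalculus)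
    (k : ℕ) (b : B) (ω : D.Ω k) :
    hγ.lact k b ω = c.deform D.coactB (h.coactForms k) (h.lact k) b ω := by
  apply Submodule.injective_subtype (D.Ω k)
  refine Eq.trans ?_ (c.map_deform (D.Ω k).subtype (h.lact k) b ω).symm
  have hs : ∀ ω, D.coact ((D.Ω k).subtype ω) = (D.Ω k).subtype.lTensor A (h.coactForms k ω) :=
    fun ω => (h.lTensor_coactForms k ω).symm
  have e : D.wedge.compl₁₂ D.ι (D.Ω k).subtype = (h.lact k).compr₂ (D.Ω k).subtype :=
    LinearMap.ext₂ fun _ _ => rfl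
  rw [← e, ← c.deform_map h.coact_ι hs]
  rfl

theorem ract_eq_deform (h : D.IsCovariantCalculus) (hγ : (c.deformData D).IsCovariantCalculus)
    (k : ℕ) (ω : D.Ω k) (b : B) :
    hγ.ract k ω b = c.deform (h.coactForms k) D.coactB (h.ract k) ω b := by
  apply Submodule.injective_subtype (D.Ω k)
  refine Eq.trans ?_ (c.map_deform (D.Ω k).subtype (h.ract k) ω b).symm
  have hs : ∀ ω, D.coact ((D.Ω k).subtype ω) = (D.Ω k).subtype.lTensor A (h.coactForms k ω) :=
    fun ω => (h.lTensor_coactForms k ω).symm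
  have e : D.wedge.compl₁₂ (D.Ω k).subtype D.ι = (h.ract k).compr₂ (D.Ω k).subtype :=
    LinearMap.ext₂ fun _ _ => rfl
  rw [← e, ← c.deform_map hs h.coact_ι]
  rfl

/-- The dual basis elements are enlarged to a finite-dimensional subcomodule `V`, the section into
`B ⊗ V` is deformed, and a basis of `V` turns the new section back into a dual basis. -/
theorem oneFormsFiniteProjective_deformData (h : D.IsCovariantCalculus)
    (hγ : (c.deformData D).IsCovariantCalculus) (hm : D.mulA = LinearMap.mul ℂ A) {n : ℕ}
    {e : Fin n → D.Ω 1} {f : Fin n → D.Ω 1 →ₗ[ℂ] B}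
    (hf : ∀ i b ω, f i (h.lact 1 b ω) = D.mulB b (f i ω))
    (he : ∀ ω, ∑ i, h.lact 1 (f i ω) (e i) = ω) : hγ.OneFormsFiniteProjective := by
  obtain ⟨V, hfin, hV, δV, hδV⟩ :=
    (h.isComodule_coactForms 1).exists_finiteDimensional_subcomodule e
  let j : D.Ω 1 →ₗ[ℂ] B ⊗[ℂ] V := ∑ i, (TensorProduct.mk ℂ B V).flip ⟨e i, hV i⟩ ∘ₗ f i
  have hj : ∀ ω, j ω = ∑ i, f i ω ⊗ₜ[ℂ] (⟨e i, hV i⟩ : V) := fun ω => by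
    simp [j]
  obtain ⟨K, hK, hK'⟩ := c.exists_deformed_section (j := j) (i := V.subtype) (l := h.lact 1)
    h.base.comodule (h.isComodule_coactForms 1)
    ((h.isComodule_coactForms 1).of_injective V.injective_subtype hδV)
    (fun b x => hm ▸ h.base.map_mul b x) (fun b x => hm ▸ h.coactForms_lact 1 b x) hδV
    (fun b ω => by simp [hj, hf]) (fun ω => by simp [hj, he])
  let v := Module.finBasis ℂ V
  let r : Fin (Module.finrank ℂ V) → B ⊗[ℂ] V →ₗ[ℂ] B := fun i =>
    (TensorProduct.rid ℂ B).toLinearMap ∘ₗ (v.coord i).lTensor B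
  have hr : ∀ x, ∑ i, r i x ⊗ₜ[ℂ] v i = x := by
    intro x
    induction x with
    | zero => simp
    | add x y hx hy => simp only [map_add, TensorProduct.add_tmul, Finset.sum_add_distrib, hx, hy]
    | tmul b x =>
      simp only [r, LinearMap.comp_apply, LinearMap.lTensor_tmul, LinearEquiv.coe_coe,
        TensorProduct.rid_tmul, TensorProduct.smul_tmul, ← TensorProduct.tmul_sum]
      congr 1
      exact v.sum_repr x
  refine hγ.oneFormsFiniteProjective (e := fun i => (v i : D.Ω 1)) (f := fun i => r i ∘ₗ K)
    (fun i b ω => ?_) (fun ω => ?_)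
  · rw [c.lact_eq_deform h hγ, LinearMap.comp_apply, hK, LinearMap.comp_apply]
    change r i ((c.deform D.coactB D.coactB D.mulB b).rTensor V (K ω)) =
      c.deform D.coactB D.coactB D.mulB b (r i (K ω))
    induction K ω with
    | zero => simp only [map_zero]
    | add x y hx hy => simp only [map_add, hx, hy]
    | tmul b x => simp [r]
  · conv_rhs => rw [← hK' ω, ← hr (K ω)]
    simp only [map_sum, LinearMap.lTensor_tmul, TensorProduct.lift.tmul, c.lact_eq_deform h hγ]
    rfl

end UnitaryTwoCocycle

end FiniteProjective

end CocycleCalculus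

end

noncomputable section

namespace CocycleCalculus

/-! ### Deformation of the splitting -/

section DeformedSplitting

open TensorProduct

namespace CalculusData.IsCovariantCalculus

variable {A B E : Type*} [AddCommGroup A] [Module ℂ A] [Coalgebra ℂ A] [AddCommGroup B]
  [Module ℂ B] [AddCommGroup E] [Module ℂ E] {D : CalculusData A B E}
  (h : D.IsCovariantCalculus)

/-- The map `(ω ⊗ b) ⊗ η ↦ ω b ⊗ η - ω ⊗ b η`. -/
def balancing : (D.Ω 1 ⊗[ℂ] B) ⊗[ℂ] D.Ω 1 →ₗ[ℂ] D.Ω 1 ⊗[ℂ] D.Ω 1 :=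
  (TensorProduct.lift (h.ract 1)).rTensor (D.Ω 1) -
    (TensorProduct.lift (h.lact 1)).lTensor (D.Ω 1) ∘ₗ (TensorProduct.assoc ℂ _ _ _).toLinearMap

/-- Written as the range of a linear map, the relations can be compared under the twist by
conjugating that map. -/
theorem balanced_eq_range : h.balanced = LinearMap.range h.balancing := by
  refine le_antisymm (Submodule.span_le.2 ?_) ?_
  · rintro _ ⟨ω, η, b, rfl⟩
    exact ⟨(ω ⊗ₜ b) ⊗ₜ η, rfl⟩
  · rintro _ ⟨z, rfl⟩
    induction z with
    | zero => rw [map_zero]; exact zero_mem _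
    | add x y hx hy => rw [map_add]; exact add_mem hx hy
    | tmul x η =>
      induction x with
      | zero => rw [TensorProduct.zero_tmul, map_zero]; exact zero_mem _
      | add x y hx hy => rw [TensorProduct.add_tmul, map_add]; exact add_mem hx hy
      | tmul ω b => exact Submodule.subset_span ⟨ω, η, b, rfl⟩

theorem lift_tmul : TensorProduct.lift h.tmul = h.balanced.mkQ :=
  TensorProduct.ext' fun _ _ => rfl

theorem coactTensor_mkQ (z : D.Ω 1 ⊗[ℂ] D.Ω 1) : h.coactTensor (h.balanced.mkQ z) =
    TensorProduct.map (TensorProduct.lift D.mulA) h.balanced.mkQ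
      (CocycleCalculus.coactTensor (h.coactForms 1) (h.coactForms 1) z) := by
  induction z with
  | zero => simp only [map_zero]
  | add x y hx hy => simp only [map_add, hx, hy]
  | tmul ω η =>
    rw [← lift_tmul, ← map₂_apply_eq]
    rfl

/-- The left action on `Ω^1 ⊗_B Ω^1`, as a bilinear map. -/
def lactTensorHom : B →ₗ[ℂ] h.Tensor →ₗ[ℂ] h.Tensor where
  toFun := h.lactTensor
  map_add' b b' := by
    refine Submodule.linearMap_qext _ (TensorProduct.ext' fun ω η => ?_)
    change h.balanced.mkQ (h.lact 1 (b + b') ω ⊗ₜ η) =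
      h.balanced.mkQ (h.lact 1 b ω ⊗ₜ η) + h.balanced.mkQ (h.lact 1 b' ω ⊗ₜ η)
    rw [map_add, LinearMap.add_apply, TensorProduct.add_tmul, map_add]
  map_smul' z b := by
    refine Submodule.linearMap_qext _ (TensorProduct.ext' fun ω η => ?_)
    change h.balanced.mkQ (h.lact 1 (z • b) ω ⊗ₜ η) = z • h.balanced.mkQ (h.lact 1 b ω ⊗ₜ η)
    rw [map_smul, LinearMap.smul_apply, ← TensorProduct.smul_tmul', map_smul]

/-- The right action on `Ω^1 ⊗_B Ω^1`, as a bilinear map. -/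
def ractTensorHom : h.Tensor →ₗ[ℂ] B →ₗ[ℂ] h.Tensor :=
  LinearMap.flip
  { toFun := h.ractTensor
    map_add' := fun b b' => by
      refine Submodule.linearMap_qext _ (TensorProduct.ext' fun ω η => ?_)
      change h.balanced.mkQ (ω ⊗ₜ h.ract 1 η (b + b')) =
        h.balanced.mkQ (ω ⊗ₜ h.ract 1 η b) + h.balanced.mkQ (ω ⊗ₜ h.ract 1 η b')
      rw [map_add, TensorProduct.tmul_add, map_add]
    map_smul' := fun z b => by
      refine Submodule.linearMap_qext _ (TensorProduct.ext' fun ω η => ?_)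
      change h.balanced.mkQ (ω ⊗ₜ h.ract 1 η (z • b)) = z • h.balanced.mkQ (ω ⊗ₜ h.ract 1 η b)
      rw [map_smul, TensorProduct.tmul_smul, map_smul] }

end CalculusData.IsCovariantCalculus

variable {A B E : Type*} [CommRing A] [HopfAlgebra ℂ A] [AddCommGroup B] [Module ℂ B]
  [AddCommGroup E] [Module ℂ E] {D : CalculusData A B E}

theorem coact_lift {M N X : Type*} [AddCommGroup M] [Module ℂ M] [AddCommGroup N] [Module ℂ N]
    [AddCommGroup X] [Module ℂ X] {δM : M →ₗ[ℂ] A ⊗[ℂ] M} {δN : N →ₗ[ℂ] A ⊗[ℂ] N}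
    {δX : X →ₗ[ℂ] A ⊗[ℂ] X} {F : M →ₗ[ℂ] N →ₗ[ℂ] X}
    (hF : ∀ b x, δX (F b x) = TensorProduct.map₂ (LinearMap.mul ℂ A) F (δM b) (δN x))
    (y : M ⊗[ℂ] N) :
    δX (TensorProduct.lift F y) = (TensorProduct.lift F).lTensor A (diagCoact δM δN y) :=
  LinearMap.congr_fun (f := δX ∘ₗ TensorProduct.lift F)
    (g := (TensorProduct.lift F).lTensor A ∘ₗ diagCoact δM δN)
    (TensorProduct.ext' fun b x => (hF b x).trans (map₂_mul_apply_eq F b x)) y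

theorem coact_id {M : Type*} [AddCommGroup M] [Module ℂ M] {δM : M →ₗ[ℂ] A ⊗[ℂ] M} (m : M) :
    δM (LinearMap.id (R := ℂ) m) = LinearMap.id.lTensor A (δM m) := by
  rw [LinearMap.lTensor_id]; rfl

namespace UnitaryTwoCocycle

variable {star : A → A} (c : UnitaryTwoCocycle star)

/-- The twist of `Y ⊗ X` is linear over the deformed algebra, on the right. -/
theorem twist_ract {B X Y : Type*} [AddCommGroup B] [Module ℂ B] [AddCommGroup X] [Module ℂ X]
    [AddCommGroup Y] [Module ℂ Y] {δB : B →ₗ[ℂ] A ⊗[ℂ] B} {δX : X →ₗ[ℂ] A ⊗[ℂ] X}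
    {δY : Y →ₗ[ℂ] A ⊗[ℂ] Y} (hB : IsComodule δB) (hX : IsComodule δX) (hY : IsComodule δY)
    {F : X →ₗ[ℂ] B →ₗ[ℂ] X}
    (hF : ∀ x b, δX (F x b) = TensorProduct.map₂ (LinearMap.mul ℂ A) F (δX x) (δB b)) (b : B)
    (z : Y ⊗[ℂ] X) : c.twist δY δX (((c.deform δX δB F).flip b).lTensor Y z) =
      c.deform (diagCoact δY δX) δB (LinearMap.lTensorHom Y ∘ₗ F.flip).flip (c.twist δY δX z) b := by
  have e : TensorProduct.lift (LinearMap.lTensorHom Y ∘ₗ F.flip).flip =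
      (TensorProduct.lift F).lTensor Y ∘ₗ (TensorProduct.assoc ℂ Y X B).toLinearMap := by
    ext; simp
  induction z with
  | zero => simp only [map_zero, LinearMap.zero_apply]
  | add x y hx hy => simp only [map_add, LinearMap.add_apply, hx, hy]
  | tmul y x =>
    have h1 := c.twist_map (coact_id (δM := δY)) (coact_lift hF)
      ((c.twist δX δB).lTensor Y (y ⊗ₜ (x ⊗ₜ b)))
    have h2 := c.twist_assoc hY hX hB ((y ⊗ₜ x) ⊗ₜ b)
    rw [LinearMap.lTensor_tmul, LinearMap.flip_apply, deform_apply, deform_apply, e]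
    refine h1.trans ?_
    exact congrArg ((TensorProduct.lift F).lTensor Y) h2.symm

/-- By colinearity of the actions and coherence of the twists, the twist of `Ω^1 ⊗ Ω^1` after the
deformed balancing map is the old balancing map after the threefold twist `T`. Since `T` is onto,
the ranges correspond. -/
theorem map_balanced (h : D.IsCovariantCalculus) (hγ : (c.deformData D).IsCovariantCalculus)
    (hm : D.mulA = LinearMap.mul ℂ A) : hγ.balanced.map
      (c.twistEquiv (h.isComodule_coactForms 1) (h.isComodule_coactForms 1)).toLinearMap =
      h.balanced := by
  have hM := h.isComodule_coactForms 1
  have hB := h.base.comodule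
  have hl : TensorProduct.lift (hγ.lact 1) =
      TensorProduct.lift (h.lact 1) ∘ₗ c.twist D.coactB (h.coactForms 1) :=
    TensorProduct.ext' fun b ω => (c.lact_eq_deform h hγ 1 b ω).trans (c.deform_apply _ _ _ _ _)
  have hr : TensorProduct.lift (hγ.ract 1) =
      TensorProduct.lift (h.ract 1) ∘ₗ c.twist (h.coactForms 1) D.coactB :=
    TensorProduct.ext' fun b ω => (c.ract_eq_deform h hγ 1 b ω).trans (c.deform_apply _ _ _ _ _)
  let T : (D.Ω 1 ⊗[ℂ] B) ⊗[ℂ] D.Ω 1 ≃ₗ[ℂ] (D.Ω 1 ⊗[ℂ] B) ⊗[ℂ] D.Ω 1 :=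
    ((c.twistEquiv hM hB).rTensor (D.Ω 1)).trans (c.twistEquiv (hM.diagCoact hB) hM)
  have hT : ∀ z, T z = c.twist (diagCoact (h.coactForms 1) D.coactB) (h.coactForms 1)
      ((c.twist (h.coactForms 1) D.coactB).rTensor (D.Ω 1) z) := fun z => rfl
  have key : (c.twistEquiv hM hM).toLinearMap ∘ₗ hγ.balancing = h.balancing ∘ₗ T.toLinearMap := by
    refine LinearMap.ext fun z => ?_
    have e1 := c.twist_map (coact_lift (fun ω b => hm ▸ h.coactForms_ract 1 ω b))
      (coact_id (δM := h.coactForms 1)) ((c.twist (h.coactForms 1) D.coactB).rTensor (D.Ω 1) z)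
    have e2 := c.twist_map (coact_id (δM := h.coactForms 1))
      (coact_lift (fun b ω => hm ▸ h.coactForms_lact 1 b ω))
      ((c.twist D.coactB (h.coactForms 1)).lTensor (D.Ω 1) (TensorProduct.assoc ℂ _ _ _ z))
    rw [← c.twist_assoc hM hB hM] at e2
    simp only [LinearMap.comp_apply, LinearEquiv.coe_coe, twistEquiv_apply,
      CalculusData.IsCovariantCalculus.balancing, LinearMap.sub_apply, map_sub, hl, hr, hT,
      LinearMap.rTensor_comp_apply, LinearMap.lTensor_comp_apply]
    exact congrArg₂ _ e1 e2
  rw [hγ.balanced_eq_range, h.balanced_eq_range, ← LinearMap.range_comp, key,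
    LinearMap.range_comp_of_range_eq_top _ (LinearEquiv.range T)]

/-- The isomorphism `φ(ω ⊗ η) = γ(ω₍₋₁₎ ⊗ η₍₋₁₎) ω₍₀₎ ⊗ η₍₀₎` between the tensor products over
`B_γ` and over `B`. -/
def tensorEquiv (h : D.IsCovariantCalculus) (hγ : (c.deformData D).IsCovariantCalculus)
    (hm : D.mulA = LinearMap.mul ℂ A) : hγ.Tensor ≃ₗ[ℂ] h.Tensor :=
  Submodule.Quotient.equiv hγ.balanced h.balanced
    (c.twistEquiv (h.isComodule_coactForms 1) (h.isComodule_coactForms 1)) (c.map_balanced h hγ hm)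

variable (h : D.IsCovariantCalculus) (hγ : (c.deformData D).IsCovariantCalculus)
  (hm : D.mulA = LinearMap.mul ℂ A)

theorem tensorEquiv_mkQ (z : D.Ω 1 ⊗[ℂ] D.Ω 1) : c.tensorEquiv h hγ hm (hγ.balanced.mkQ z) =
    h.balanced.mkQ (c.twist (h.coactForms 1) (h.coactForms 1) z) := rfl

theorem tensorEquiv_tmul (ω η : D.Ω 1) : c.tensorEquiv h hγ hm (hγ.tmul ω η) =
    c.deform (h.coactForms 1) (h.coactForms 1) h.tmul ω η := by
  rw [deform_apply, h.lift_tmul]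
  rfl

theorem coactTensor_mkQ_eq (h : D.IsCovariantCalculus) (hm : D.mulA = LinearMap.mul ℂ A)
    (z : D.Ω 1 ⊗[ℂ] D.Ω 1) :
    h.coactTensor (h.balanced.mkQ z) =
      h.balanced.mkQ.lTensor A (diagCoact (h.coactForms 1) (h.coactForms 1) z) := by
  rw [h.coactTensor_mkQ, hm, diagCoact, LinearMap.comp_apply, ← LinearMap.lTensor_comp_rTensor]
  rfl

theorem tensorEquiv_lactTensor (b : B) (x : hγ.Tensor) :
    c.tensorEquiv h hγ hm (hγ.lactTensor b x) =
      c.deform D.coactB h.coactTensor h.lactTensorHom b (c.tensorEquiv h hγ hm x) := by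
  obtain ⟨z, rfl⟩ := hγ.balanced.mkQ_surjective x
  have hM := h.isComodule_coactForms 1
  have e0 : hγ.lact 1 b = c.deform D.coactB (h.coactForms 1) (h.lact 1) b :=
    LinearMap.ext (c.lact_eq_deform h hγ 1 b)
  have e1 := c.twist_act h.base.comodule hM hM (F := h.lact 1)
    (fun b ω => hm ▸ h.coactForms_lact 1 b ω) b z
  have e2 := c.deform_map (coact_id (δM := D.coactB)) (coactTensor_mkQ_eq h hm) h.lactTensorHom b
    (c.twist (h.coactForms 1) (h.coactForms 1) z)
  change h.balanced.mkQ (c.twist (h.coactForms 1) (h.coactForms 1)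
    ((hγ.lact 1 b).rTensor (D.Ω 1) z)) = _
  rw [e0, e1, map_deform]
  exact e2.symm

theorem tensorEquiv_ractTensor (b : B) (x : hγ.Tensor) :
    c.tensorEquiv h hγ hm (hγ.ractTensor b x) =
      c.deform h.coactTensor D.coactB h.ractTensorHom (c.tensorEquiv h hγ hm x) b := by
  obtain ⟨z, rfl⟩ := hγ.balanced.mkQ_surjective x
  have hM := h.isComodule_coactForms 1
  have e0 : (hγ.ract 1).flip b = (c.deform (h.coactForms 1) D.coactB (h.ract 1)).flip b :=
    LinearMap.ext fun ω => c.ract_eq_deform h hγ 1 ω b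
  have e1 := c.twist_ract h.base.comodule hM hM (F := h.ract 1)
    (fun ω b => hm ▸ h.coactForms_ract 1 ω b) b z
  have e2 := c.deform_map (coactTensor_mkQ_eq h hm) (coact_id (δM := D.coactB)) h.ractTensorHom
    (c.twist (h.coactForms 1) (h.coactForms 1) z) b
  change h.balanced.mkQ (c.twist (h.coactForms 1) (h.coactForms 1)
    (((hγ.ract 1).flip b).lTensor (D.Ω 1) z)) = _
  rw [e0, e1, map_deform]
  exact e2.symm

theorem coactForms_deformData (k : ℕ) (ω : D.Ω k) : hγ.coactForms k ω = h.coactForms k ω := by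
  apply Module.Flat.lTensor_preserves_injective_linearMap (M := A) _
    (Submodule.injective_subtype (D.Ω k))
  exact (hγ.lTensor_coactForms k ω).trans (h.lTensor_coactForms k ω).symm

theorem coactTensor_tensorEquiv (x : hγ.Tensor) : h.coactTensor (c.tensorEquiv h hγ hm x) =
    (c.tensorEquiv h hγ hm).toLinearMap.lTensor A (hγ.coactTensor x) := by
  obtain ⟨z, rfl⟩ := hγ.balanced.mkQ_surjective x
  have hM := h.isComodule_coactForms 1
  have e0 : hγ.coactForms 1 = h.coactForms 1 :=
    LinearMap.ext (c.coactForms_deformData h hγ 1)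
  have e1 : (c.tensorEquiv h hγ hm).toLinearMap ∘ₗ hγ.balanced.mkQ =
      h.balanced.mkQ ∘ₗ c.twist (h.coactForms 1) (h.coactForms 1) :=
    LinearMap.ext fun z => rfl
  rw [hγ.coactTensor_mkQ, e0, tensorEquiv_mkQ, coactTensor_mkQ_eq h hm, c.diagCoact_twist hM hM,
    LinearMap.lTensor, TensorProduct.map_map, LinearMap.lTensor, TensorProduct.map_map, e1]

/-- The deformed wedge is the old one after the twist, and the isomorphism is induced by that twist.
-/
theorem wedgeTensor_tensorEquiv (x : hγ.Tensor) :
    h.wedgeTensor (c.tensorEquiv h hγ hm x) = hγ.wedgeTensor x := by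
  obtain ⟨z, rfl⟩ := hγ.balanced.mkQ_surjective x
  induction z with
  | zero => simp only [map_zero]
  | add x y hx hy => simp only [map_add, hx, hy]
  | tmul ω η =>
    apply Submodule.injective_subtype (D.Ω 2)
    have hs : ∀ ω, D.coact ((D.Ω 1).subtype ω) = (D.Ω 1).subtype.lTensor A (h.coactForms 1 ω) :=
      fun ω => (h.lTensor_coactForms 1 ω).symm
    have e : D.wedge.compl₁₂ (D.Ω 1).subtype (D.Ω 1).subtype =
        h.wedgeOne.compr₂ (D.Ω 2).subtype := LinearMap.ext₂ fun _ _ => rfl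
    have e1 := c.deform_map hs hs D.wedge ω η
    rw [e, ← map_deform, c.deform_apply (h.coactForms 1) (h.coactForms 1)] at e1
    exact e1.symm

/-- The isomorphism `φ` intertwines the deformed actions with the deformations of the old actions,
and it respects coactions and wedge products. As `s` is colinear, its old bilinearity can be used
inside the deformed pairings. -/
theorem isCovariantSplitting_deformData {s : D.Ω 2 →ₗ[ℂ] h.Tensor} (hs : h.IsCovariantSplitting s) :
    hγ.IsCovariantSplitting ((c.tensorEquiv h hγ hm).symm.toLinearMap ∘ₗ s) where
  map_lact b θ := by
    apply (c.tensorEquiv h hγ hm).injective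
    have e := c.deform_map (coact_id (δM := D.coactB)) hs.covariant h.lactTensorHom b θ
    have e' : h.lactTensorHom.compl₁₂ LinearMap.id s = (h.lact 2).compr₂ s :=
      LinearMap.ext₂ fun b θ => (hs.map_lact b θ).symm
    rw [e', ← map_deform] at e
    rw [tensorEquiv_lactTensor, c.lact_eq_deform h hγ]
    simp only [LinearMap.comp_apply, LinearEquiv.coe_coe, LinearEquiv.apply_symm_apply]
    exact e.symm
  map_ract b θ := by
    apply (c.tensorEquiv h hγ hm).injective
    have e := c.deform_map hs.covariant (coact_id (δM := D.coactB)) h.ractTensorHom θ b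
    have e' : h.ractTensorHom.compl₁₂ s LinearMap.id = (h.ract 2).compr₂ s :=
      LinearMap.ext₂ fun θ b => (hs.map_ract b θ).symm
    rw [e', ← map_deform] at e
    rw [tensorEquiv_ractTensor, c.ract_eq_deform h hγ]
    simp only [LinearMap.comp_apply, LinearEquiv.coe_coe, LinearEquiv.apply_symm_apply]
    exact e.symm
  covariant θ := by
    apply Module.Flat.lTensor_preserves_injective_linearMap (M := A) _
      (c.tensorEquiv h hγ hm).injective
    rw [← LinearMap.lTensor_comp_apply, ← LinearMap.comp_assoc, LinearEquiv.comp_symm,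
      LinearMap.id_comp, c.coactForms_deformData h hγ, ← hs.covariant]
    refine (c.coactTensor_tensorEquiv h hγ hm _).symm.trans ?_
    simp only [LinearMap.comp_apply, LinearEquiv.coe_coe, LinearEquiv.apply_symm_apply]
  splits θ := by
    rw [← c.wedgeTensor_tensorEquiv h hγ hm]
    simp only [LinearMap.comp_apply, LinearEquiv.coe_coe, LinearEquiv.apply_symm_apply, hs.splits]

end UnitaryTwoCocycle

end DeformedSplitting

end CocycleCalculus

end

noncomputable section

namespace CocycleCalculus

/-! ### The classical splitting -/

section ClassicalSplitting

open TensorProduct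

theorem CalculusData.IsCovariantCalculus.tmul_ract {A B E : Type*} [AddCommGroup A] [Module ℂ A]
    [Coalgebra ℂ A] [AddCommGroup B] [Module ℂ B] [AddCommGroup E] [Module ℂ E]
    {D : CalculusData A B E} (h : D.IsCovariantCalculus) (ω η : D.Ω 1) (b : B) :
    h.tmul (h.ract 1 ω b) η = h.tmul ω (h.lact 1 b η) := by
  refine sub_eq_zero.1 ?_
  change h.balanced.mkQ (h.ract 1 ω b ⊗ₜ η) - h.balanced.mkQ (ω ⊗ₜ h.lact 1 b η) = 0
  rw [← map_sub, Submodule.mkQ_apply, Submodule.Quotient.mk_eq_zero]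
  exact Submodule.subset_span ⟨ω, η, b, rfl⟩

variable {A B E : Type*} [CommRing A] [HopfAlgebra ℂ A] [AddCommGroup B] [Module ℂ B]
  [AddCommGroup E] [Module ℂ E] {D : CalculusData A B E}

theorem CalculusData.IsCovariantCalculus.coactForms_wedgeOne (h : D.IsCovariantCalculus)
    (ω η : D.Ω 1) : h.coactForms 2 (h.wedgeOne ω η) =
      TensorProduct.map₂ D.mulA h.wedgeOne (h.coactForms 1 ω) (h.coactForms 1 η) := by
  apply Module.Flat.lTensor_preserves_injective_linearMap (M := A) _
    (Submodule.injective_subtype (D.Ω 2))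
  rw [h.lTensor_coactForms]
  change D.coact (D.wedge ω η) = _
  rw [h.total.map_mul, ← h.lTensor_coactForms, ← h.lTensor_coactForms]
  generalize h.coactForms 1 ω = x
  generalize h.coactForms 1 η = y
  induction x with
  | zero => simp only [map_zero, LinearMap.zero_apply]
  | add x x' hx hx' => simp only [map_add, LinearMap.add_apply, hx, hx']
  | tmul a ω =>
    induction y with
    | zero => simp only [map_zero]
    | add y y' hy hy' => simp only [map_add, hy, hy']
    | tmul a' ω' => simp [wedgeOne]

theorem CalculusData.IsCovariantCalculus.forms_two_ext (h : D.IsCovariantCalculus)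
    (hspan : Submodule.span ℂ {θ | ∃ ω η, θ = h.wedgeOne ω η} = ⊤) {P : Type*} [AddCommGroup P]
    [Module ℂ P] {f g : D.Ω 2 →ₗ[ℂ] P}
    (hfg : ∀ ω η, f (h.wedgeOne ω η) = g (h.wedgeOne ω η)) : f = g := by
  refine LinearMap.ext_on hspan ?_
  rintro _ ⟨ω, η, rfl⟩
  exact hfg ω η

/-- A map given by antisymmetrization is a covariant splitting. -/
theorem CalculusData.IsCovariantCalculus.isCovariantSplitting (h : D.IsCovariantCalculus)
    (hm : D.mulA = LinearMap.mul ℂ A) (hcomm : ∀ ω b, h.ract 1 ω b = h.lact 1 b ω)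
    (hanti : ∀ ω η, h.wedgeOne η ω = -h.wedgeOne ω η)
    (hspan : Submodule.span ℂ {θ | ∃ ω η, θ = h.wedgeOne ω η} = ⊤) {s : D.Ω 2 →ₗ[ℂ] h.Tensor}
    (hs : ∀ ω η, s (h.wedgeOne ω η) = (2⁻¹ : ℂ) • (h.tmul ω η - h.tmul η ω)) :
    h.IsCovariantSplitting s := by
  have hlact : ∀ b ω η, h.lact 2 b (h.wedgeOne ω η) = h.wedgeOne (h.lact 1 b ω) η :=
    fun b ω η => Subtype.ext (h.total.algebra.assoc _ _ _).symm
  have hract : ∀ b ω η, h.ract 2 (h.wedgeOne ω η) b = h.wedgeOne ω (h.ract 1 η b) :=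
    fun b ω η => Subtype.ext (h.total.algebra.assoc _ _ _)
  have hlact' : ∀ b ω η, h.lactTensor b (h.tmul ω η) = h.tmul (h.lact 1 b ω) η :=
    fun b ω η => rfl
  have hract' : ∀ b ω η, h.ractTensor b (h.tmul ω η) = h.tmul ω (h.ract 1 η b) :=
    fun b ω η => rfl
  refine ⟨fun b => LinearMap.congr_fun (f := s ∘ₗ h.lact 2 b) (g := h.lactTensor b ∘ₗ s)
      (h.forms_two_ext hspan fun ω η => ?_),
    fun b => LinearMap.congr_fun (f := s ∘ₗ (h.ract 2).flip b) (g := h.ractTensor b ∘ₗ s)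
      (h.forms_two_ext hspan fun ω η => ?_),
    LinearMap.congr_fun (f := h.coactTensor ∘ₗ s) (g := s.lTensor A ∘ₗ h.coactForms 2)
      (h.forms_two_ext hspan fun ω η => ?_),
    LinearMap.congr_fun (f := h.wedgeTensor ∘ₗ s) (g := LinearMap.id) (h.forms_two_ext hspan fun ω η => ?_)⟩
  -- In the second summand `η ⊗ bω = ηb ⊗ ω = bη ⊗ ω`, by balancing and centrality of functions.
  · rw [LinearMap.comp_apply, LinearMap.comp_apply, hlact, hs, hs, map_smul, map_sub, hlact',
      hlact', ← h.tmul_ract, hcomm]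
  · rw [LinearMap.comp_apply, LinearMap.comp_apply, LinearMap.flip_apply, hract, hs, hs, map_smul,
      map_sub, hract', hract', h.tmul_ract, hcomm η, hcomm ω]
  · have h1 : h.wedgeOne.compr₂ s = (2⁻¹ : ℂ) • (h.tmul - h.tmul.flip) :=
      LinearMap.ext₂ hs
    have h2 : ∀ ω η, h.coactTensor (h.tmul ω η) =
        TensorProduct.map₂ D.mulA h.tmul (h.coactForms 1 ω) (h.coactForms 1 η) := fun _ _ => rfl
    rw [LinearMap.comp_apply, LinearMap.comp_apply, h.coactForms_wedgeOne, hs, map_smul, map_sub,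
      h2, h2, hm]
    -- For elementary tensors the two summands carry `a a'` and `a' a` in the first factor;
    -- commutativity of `A` lets them be combined.
    generalize h.coactForms 1 ω = x
    generalize h.coactForms 1 η = y
    induction x with
    | zero => simp only [map_zero, LinearMap.zero_apply, sub_zero, smul_zero]
    | add x x' hx hx' =>
      simp only [map_add, LinearMap.add_apply, ← hx, ← hx']
      rw [← smul_add, add_sub_add_comm]
    | tmul a ω =>
      induction y with
      | zero => simp only [map_zero, LinearMap.zero_apply, sub_zero, smul_zero]
      | add y y' hy hy' =>
        simp only [map_add, LinearMap.add_apply, ← hy, ← hy']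
        rw [← smul_add, add_sub_add_comm]
      | tmul a' η =>
        simp only [TensorProduct.map₂_apply_tmul, TensorProduct.map_tmul, LinearMap.mul_apply', LinearMap.lTensor_tmul, hs,
          mul_comm a' a, ← TensorProduct.tmul_sub, TensorProduct.tmul_smul]
  · have h1 : ∀ ω η, h.wedgeTensor (h.tmul ω η) = h.wedgeOne ω η := fun _ _ => rfl
    rw [LinearMap.comp_apply, hs, map_smul, map_sub, h1, h1, hanti ω η, sub_neg_eq_add, ← two_smul ℂ,
      smul_smul, inv_mul_cancel₀ two_ne_zero, one_smul, LinearMap.id_apply]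

theorem forms_succ_le {O : Type*} [CommRing O] [Algebra ℝ O] {k : ℕ} {W : Submodule ℂ (Form O)}
    (h : ∀ ω ∈ forms O k, ∀ b, ω * diffForm b ∈ W) : forms O (k + 1) ≤ W := fun _ hω =>
  forms_induction_succ (p := (· ∈ W)) W.zero_mem (fun _ _ => W.add_mem)
    (fun z _ => W.smul_mem z) h hω

variable {O : Type*} [CommRing O] [Algebra ℝ O] {ρ : ℂ ⊗[ℝ] O →ₗ[ℂ] A ⊗[ℂ] (ℂ ⊗[ℝ] O)}
  {d : Form O →ₗ[ℂ] Form O} {δ : Form O →ₗ[ℂ] A ⊗[ℂ] Form O}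

theorem span_wedgeOne (h : (classicalData ρ d δ).IsCovariantCalculus) :
    Submodule.span ℂ {θ | ∃ ω η, θ = h.wedgeOne ω η} = ⊤ := by
  have hle : forms O 2 ≤ (Submodule.span ℂ {θ | ∃ ω η, θ = h.wedgeOne ω η}).map
      (forms O 2).subtype := by
    refine forms_succ_le (k := 1) fun ω hω b => ?_
    exact ⟨h.wedgeOne ⟨ω, hω⟩ ⟨_, diffForm_mem b⟩, Submodule.subset_span ⟨_, _, rfl⟩, rfl⟩
  rw [eq_top_iff]
  rintro ⟨θ, hθ⟩ -
  obtain ⟨θ', hθ', e⟩ := hle hθ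
  rwa [show (⟨θ, hθ⟩ : forms O 2) = θ' from Subtype.ext e.symm]

theorem ract_eq_lact (h : (classicalData ρ d δ).IsCovariantCalculus) (ω : forms O 1)
    (b : ℂ ⊗[ℝ] O) : h.ract 1 ω b = h.lact 1 b ω :=
  Subtype.ext (functionForm_mul_comm b ω)

theorem wedgeOne_anticomm (h : (classicalData ρ d δ).IsCovariantCalculus) (ω η : forms O 1) :
    h.wedgeOne η ω = -h.wedgeOne ω η :=
  Subtype.ext (oneForm_anticomm η.2 ω.2)

variable [IsDomain O] [Algebra.Smooth ℝ O]

/-- The classical splitting, together with a dual basis of the one-forms. -/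
theorem exists_antisymmetrization (x₀ : RealPoint O)
    (h : (classicalData ρ d δ).IsCovariantCalculus) :
    (∃ (n : ℕ) (e : Fin n → forms O 1) (f : Fin n → forms O 1 →ₗ[ℂ] ℂ ⊗[ℝ] O),
      (∀ i b ω, f i (h.lact 1 b ω) = b * f i ω) ∧ ∀ ω, ∑ i, h.lact 1 (f i ω) (e i) = ω) ∧
    ∃ s : forms O 2 →ₗ[ℂ] h.Tensor, ∀ ω η : forms O 1,
      s (h.wedgeOne ω η) = (2⁻¹ : ℂ) • (h.tmul ω η - h.tmul η ω) := by
  obtain ⟨n, y, f, T, hf, hy, hT⟩ := exists_oneForm_dual_basis x₀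
  let e : Fin n → forms O 1 := fun i => ⟨diffForm (y i), diffForm_mem (y i)⟩
  have he : ∀ ω, ∑ i, h.lact 1 (f i ω) (e i) = ω := fun ω => by
    refine Subtype.ext ((hy ω).trans ?_).symm
    rw [AddSubmonoidClass.coe_finsetSum]
    rfl
  refine ⟨⟨n, e, f, fun i b ω => hf i b ω _ rfl, he⟩, ?_⟩
  -- Contraction lowers the degree: on a product of one-forms it is a combination of the two factors
  -- with functions as coefficients.
  have hmem : ∀ i (θ : forms O 2), (T i ∘ₗ (forms O 2).subtype) θ ∈ forms O 1 := by
    intro i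
    have hle : forms O 2 ≤ (forms O 1).comap (T i) := by
      refine forms_succ_le (k := 1) fun ω hω b => ?_
      rw [Submodule.mem_comap, hT i ⟨ω, hω⟩ ⟨_, diffForm_mem b⟩]
      exact sub_mem (h.lsmul_mem (k := 1) _ (diffForm_mem b)) (h.lsmul_mem (k := 1) _ hω)
    exact fun θ => hle θ.2
  let t : Fin n → forms O 2 →ₗ[ℂ] forms O 1 := fun i =>
    (T i ∘ₗ (forms O 2).subtype).codRestrict _ (hmem i)
  have ht : ∀ i ω η, t i (h.wedgeOne ω η) = h.lact 1 (f i ω) η - h.lact 1 (f i η) ω :=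
    fun i ω η => Subtype.ext (hT i ω η)
  -- Moving `f i ω` across the tensor sign and using centrality rebuilds `ω` from its dual basis
  -- expansion.
  have hsum : ∀ ω η, ∑ i, h.tmul (e i) (h.lact 1 (f i ω) η) = h.tmul ω η := fun ω η => by
    simp only [← h.tmul_ract]
    conv_rhs => rw [← he ω, map_sum, LinearMap.sum_apply]
    exact Finset.sum_congr rfl fun i _ => congrArg (h.tmul · η) (ract_eq_lact h _ _)
  -- The formula is linear on two-forms from the outset, so no well-definedness remains. On `ω ∧ η`
  -- the two terms of the contraction sum to `ω ⊗ η` and `η ⊗ ω`.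
  refine ⟨(2⁻¹ : ℂ) • ∑ i, h.tmul (e i) ∘ₗ t i, fun ω η => ?_⟩
  rw [LinearMap.smul_apply, LinearMap.sum_apply]
  simp only [LinearMap.comp_apply, ht, map_sub, Finset.sum_sub_distrib, hsum]

end ClassicalSplitting

end CocycleCalculus

end

/-! ### The calculus of the variety and its deformation -/

theorem mainTheorem12 {OG OX : Type*}
    [CommRing OG] [HopfAlgebra ℝ OG] [Algebra.Smooth ℝ OG]
    [CommRing OX] [IsDomain OX] [Algebra ℝ OX] [Algebra.Smooth ℝ OX]
    (hX : Nonempty (RealPoint OX)) (α : VarietyAction OG OX)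
    (c : UnitaryTwoCocycle (conjStar OG)) :
    ∃ (d : Form OX →ₗ[ℂ] Form OX)
      (δ : Form OX →ₗ[ℂ] (ℂ ⊗[ℝ] OG) ⊗[ℂ] Form OX),
      α.IsDeRham d δ ∧
      ∃ (h : (α.deRhamData d δ).IsCovariantCalculus)
        (hγ : (c.deformData (α.deRhamData d δ)).IsCovariantCalculus),
        hγ.CovariantlyQuasiTame ∧
        ∃ (s : forms OX 2 →ₗ[ℂ] h.Tensor) (φ : hγ.Tensor ≃ₗ[ℂ] h.Tensor),
          (∀ ω η : forms OX 1,
            s (h.wedgeOne ω η) = (2⁻¹ : ℂ) • (h.tmul ω η - h.tmul η ω)) ∧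
          (∀ ω η : forms OX 1, φ (hγ.tmul ω η) =
            c.deform (h.coactForms 1) (h.coactForms 1) h.tmul ω η) ∧
          h.IsCovariantSplitting s ∧
          hγ.IsCovariantSplitting (φ.symm.toLinearMap ∘ₗ s) := by
  obtain ⟨x₀⟩ := hX
  obtain ⟨d, δ, hd, h⟩ := α.exists_isDeRham x₀
  -- The case of no exact factors in the formula for `d`; it identifies the exact forms used in the
  -- spanning argument with the differentials of functions.
  have hdι : ∀ b, d (functionForm b) = diffForm b := fun b => by
    have := hd.d_apply 0 b Fin.elim0
    rwa [List.ofFn_zero, List.prod_nil, mul_one, mul_one] at this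
  have hγ : (c.deformData (α.deRhamData d δ)).IsCovariantCalculus :=
    c.isCovariantCalculus_deformData h rfl rfl fun k W hW => forms_succ_le fun ω hω b =>
      hdι b ▸ hW ω hω b
  obtain ⟨⟨n, e, f, hf, he⟩, s, hs⟩ := exists_antisymmetrization x₀ h
  have hsplit : h.IsCovariantSplitting s :=
    h.isCovariantSplitting rfl (ract_eq_lact h) (wedgeOne_anticomm h) (span_wedgeOne h) hs
  have hsplitγ := c.isCovariantSplitting_deformData h hγ rfl hsplit
  exact ⟨d, δ, hd, h, hγ, ⟨c.oneFormsFiniteProjective_deformData h hγ rfl hf he, _, hsplitγ⟩,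
    s, c.tensorEquiv h hγ rfl, hs, c.tensorEquiv_tmul h hγ rfl, hsplit, hsplitγ⟩
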